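/- Let $V$ be a complex locally convex space with a continuous Hermitian (positive definite) scalar product $\langle\cdot,\cdot\rangle$, antilinear in the first and linear in the second argument. Smoothness over $\mathbb{R}$ or $\mathbb{C}$ is understood in the sense of Michal--Bastiani. Give $\mathbb{P}(V)$ the quotient topology and, for unit vectors $\psi$, the charts $\kappa_\psi([\chi]) = \langle\psi,\chi\rangle^{-1}\chi-\psi$ from $\{[\chi] : \langle\psi,\chi\rangle\neq 0\}$ onto $T_{[\psi]} = \{v\in V : \langle\psi,v\rangle=0\}$, and identify $T_{[\psi]}\mathbb{P}(V)$ with $T_{[\psi]}$ by the differential of $\kappa_\psi$ at $[\psi]$. Give the sphere $\mathbb{S}(V)=\{\psi\in V : \langle\psi,\psi\rangle=1\}$ the charts $\chi\mapsto(\mathrm{Re}\langle\psi,\chi\rangle)^{-1}\chi-\psi$ from $\{\chi : \mathrm{Re}\langle\psi,\chi\rangle>0\}$ onto $T_\psi=\{v : \mathrm{Re}\langle\psi,v\rangle=0\}\cong T_\psi\mathbb{S}(V)$. 1. $\mathbb{P}(V)$ is a (Hausdorff) complex manifold modelled on locally convex spaces. The forms $H_{[\psi]}(v,w)=2\langle v,w\rangle$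 on $T_{[\psi]}$ do not depend on the unit vector $\psi$ representing $[\psi]$, and $(\mathbb{P}(V),H)$ is a locally convex Kähler manifold: $H$ is a smooth field of positive definite Hermitian forms, and $\Omega=\mathrm{Im}\,H$, i.e. $\Omega_{[\psi]}(v,w)=2\,\mathrm{Im}\langle v,w\rangle$, is a symplectic form (smooth, closed, and weakly nondegenerate: $\Omega(v,\cdot)=0$ implies $v=0$). 2. $\mathbb{S}(V)$ is a smooth locally convex manifold, the projection $\pi:\mathbb{S}(V)\to\mathbb{P}(V)$ is a smooth principal $\mathrm{U}(1)$-bundle, and $\alpha_\psi(v)=-i\langle\psi,v\rangle$ ($v\in T_\psi$) is a real-valued principal connection $1$-form on it (smooth, $\mathrm{U}(1)$-invariant, with value $1$ on the generator $\psi\mapsto i\psi$ of the action), with curvature $\Omega$: $d\alpha=\pi^*\Omega$. 3. The tautological bundle $\mathbb{L}(V)=\{(p,l) : p\in\mathbb{P}(V),\ l\in p\}\to\mathbb{P}(V)$, with the topology induced from $\mathbb{P}(V)\times V$ and the charts with inverse $(v,z)\mapsto([\psi+v],z(\psi+v))$, $v\in T_{[\psi]}$, $z\in\mathbb{C}$,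 is a holomorphic line bundle, and $(\psi,c)\mapsto([\psi],c\psi)$ identifies it, as a smooth complex line bundle, with $\mathbb{S}(V)\times_{\mathrm{U}(1)}\mathbb{C}$. Let $\nabla$ be the connection on $\mathbb{L}(V)$ inherited from $\alpha$: if $s([\chi])=f(\chi)\chi$ for $\chi\in\mathbb{S}(V)$ and $Y\in T_\psi$ is $\alpha$-horizontal, then $(\nabla_{\pi_*Y}s)([\psi])=df_\psi(Y)\,\psi$. Then $\mathbb{L}(V)$ with $\nabla$, and with the Hermitian metric $\langle\cdot,\cdot\rangle$ on its fibres, is a prequantum line bundle for $\Omega$: $\nabla$ is a metric connection with curvature $\Omega$. Here the Lie algebra of $\mathrm{U}(1)$ is identified with $\mathbb{R}$, so that curvature $\Omega$ means: if $\nabla e=\theta e$ for a local frame $e$, then $d\theta=i\,\Omega$. -/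

import Mathlib

open Set Filter Topology
open scoped LinearAlgebra.Projectivization

universe u

noncomputable section

/-! ### Differential calculus in locally convex spaces (Michal--Bastiani, Keller's `C^∞_c`) -/

section Calculus

variable (𝕜 : Type*) [NontriviallyNormedField 𝕜]
  {E : Type*} [AddCommGroup E] [Module 𝕜 E]
  {F : Type*} [AddCommGroup F] [Module 𝕜 F] [TopologicalSpace F]

/-- The directional derivative of `f` at `x` in the direction `v` exists and equals `w`. -/
def HasDirDeriv (f : E → F) (x v : E) (w : F) : Prop :=
  Tendsto (fun t : 𝕜 => t⁻¹ • (f (x + t • v) - f x)) (𝓝[≠] 0) (𝓝 w)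

/-- The directional derivative of `f` at `x` in the direction `v`. -/
def dirDeriv (f : E → F) (x v : E) : F :=
  limUnder (𝓝[≠] (0 : 𝕜)) fun t : 𝕜 => t⁻¹ • (f (x + t • v) - f x)

end Calculus

/-- `f` is of class `C^n` over `𝕜` on the open set `U` in the sense of Michal--Bastiani:
`f` is continuous on `U`, all its directional derivatives `df (x, v)` with `x ∈ U` exist,
and `df : U × E → F` is of class `C^(n-1)`. -/
def MBContDiffOn (𝕜 : Type*) [NontriviallyNormedField 𝕜]
    {F : Type*} [AddCommGroup F] [Module 𝕜 F] [TopologicalSpace F] :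
    ℕ → ∀ {E : Type u} [AddCommGroup E] [Module 𝕜 E] [TopologicalSpace E],
      (E → F) → Set E → Prop
  | 0, _, _, _, _, f, U => ContinuousOn f U
  | n + 1, E, _, _, _, f, U => ContinuousOn f U ∧ ∃ df : E × E → F,
      (∀ x ∈ U, ∀ v, HasDirDeriv 𝕜 f x v (df (x, v))) ∧ MBContDiffOn 𝕜 n df (U ×ˢ univ)

/-- `f` is smooth over `𝕜` on the open set `U`; for `𝕜 = ℂ`, `f` is holomorphic on `U`. -/
def MBSmoothOn (𝕜 : Type*) [NontriviallyNormedField 𝕜]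
    {E : Type u} [AddCommGroup E] [Module 𝕜 E] [TopologicalSpace E]
    {F : Type*} [AddCommGroup F] [Module 𝕜 F] [TopologicalSpace F]
    (f : E → F) (U : Set E) : Prop :=
  ∀ n, MBContDiffOn 𝕜 n f U

/-- `E` is a Hausdorff locally convex space over `𝕜`. -/
structure IsLCModel (𝕜 : Type*) [NontriviallyNormedField 𝕜] (E : Type*) [AddCommGroup E]
    [Module 𝕜 E] [Module ℝ E] [TopologicalSpace E] : Prop where
  addGroup : IsTopologicalAddGroup E
  smul : ContinuousSMul 𝕜 E
  convex : LocallyConvexSpace ℝ E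
  t2 : T2Space E

/-! ### Locally convex manifolds -/

/-- The data of a family of charts `κ_i : source i → target i ⊆ E i` on `M`, where the model
space may depend on the chart, together with a chart `at p` around each point `p`. The values
of `toFun i` and `invFun i` outside `source i` and `target i` are irrelevant.
The axioms of a manifold are in `IsLCManifold`. -/
structure ChartFamily (M : Type*) {ι : Type*} (E : ι → Type*) where
  source : ι → Set M
  target : ∀ i, Set (E i)
  toFun : ∀ i, M → E i
  invFun : ∀ i, E i → M
  chartIx : M → ι

/-- `M` with the charts `A` is a manifold (smooth for `𝕜 = ℝ`, complex for `𝕜 = ℂ`) modelled on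
locally convex spaces. -/
structure IsLCManifold (𝕜 : Type*) [NontriviallyNormedField 𝕜] {M : Type*} [TopologicalSpace M]
    {ι : Type*} {E : ι → Type*} [∀ i, AddCommGroup (E i)] [∀ i, Module 𝕜 (E i)]
    [∀ i, Module ℝ (E i)] [∀ i, TopologicalSpace (E i)] (A : ChartFamily M E) : Prop where
  model : ∀ i, IsLCModel 𝕜 (E i)
  t2 : T2Space M
  mem_source_at : ∀ p, p ∈ A.source (A.chartIx p)
  isOpen_source : ∀ i, IsOpen (A.source i)
  isOpen_target : ∀ i, IsOpen (A.target i)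
  mapsTo : ∀ i, MapsTo (A.toFun i) (A.source i) (A.target i)
  mapsTo_inv : ∀ i, MapsTo (A.invFun i) (A.target i) (A.source i)
  left_inv : ∀ i, LeftInvOn (A.invFun i) (A.toFun i) (A.source i)
  right_inv : ∀ i, RightInvOn (A.invFun i) (A.toFun i) (A.target i)
  continuousOn : ∀ i, ContinuousOn (A.toFun i) (A.source i)
  continuousOn_inv : ∀ i, ContinuousOn (A.invFun i) (A.target i)
  smooth_transition : ∀ i j, MBSmoothOn 𝕜 (fun x => A.toFun j (A.invFun i x))
    (A.target i ∩ A.invFun i ⁻¹' A.source j)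

namespace ChartFamily

/-- The product of two families of charts. -/
def prod {M ι N κ : Type*} {E : ι → Type*} {F : κ → Type*} (A : ChartFamily M E)
    (B : ChartFamily N F) : ChartFamily (M × N) (fun k : ι × κ => E k.1 × F k.2) where
  source k := A.source k.1 ×ˢ B.source k.2
  target k := A.target k.1 ×ˢ B.target k.2
  toFun k p := (A.toFun k.1 p.1, B.toFun k.2 p.2)
  invFun k x := (A.invFun k.1 x.1, B.invFun k.2 x.2)
  chartIx p := (A.chartIx p.1, B.chartIx p.2)

/-- The tangent space at `p`, identified with the model space of the chart at `p`. -/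
abbrev Tan {M ι : Type*} {E : ι → Type*} (A : ChartFamily M E) (p : M) : Type _ := E (A.chartIx p)

section

variable {M ι : Type*} {E : ι → Type*} [∀ i, AddCommGroup (E i)] [∀ i, Module ℝ (E i)]
  [∀ i, TopologicalSpace (E i)]
  {N κ : Type*} {F : κ → Type*} [∀ i, AddCommGroup (F i)] [∀ i, Module ℝ (F i)]
  [∀ i, TopologicalSpace (F i)]
  {R : Type*} [AddCommGroup R] [Module ℝ R] [TopologicalSpace R]

/-- `f : M → N` is a smooth map on the open set `U ⊆ M`. -/
def SmoothMapOn [TopologicalSpace M] [TopologicalSpace N] (A : ChartFamily M E)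
    (B : ChartFamily N F) (f : M → N) (U : Set M) : Prop :=
  ContinuousOn f U ∧ ∀ i j, MBSmoothOn ℝ (fun x => B.toFun j (f (A.invFun i x)))
    (A.target i ∩ {x | A.invFun i x ∈ U ∧ f (A.invFun i x) ∈ B.source j})

/-- The function `g : M → R` with values in a locally convex space is smooth on the open set
`U ⊆ M`. -/
def SmoothFunOn (A : ChartFamily M E) (g : M → R) (U : Set M) : Prop :=
  ∀ i, MBSmoothOn ℝ (fun x => g (A.invFun i x)) (A.target i ∩ A.invFun i ⁻¹' U)

/-- The tangent vector at the point with coordinate `x` in the chart `i` whose coordinate in the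
chart `i` is `v`. -/
def toTan (A : ChartFamily M E) (i : ι) (x v : E i) : A.Tan (A.invFun i x) :=
  dirDeriv ℝ (fun y => A.toFun (A.chartIx (A.invFun i x)) (A.invFun i y)) x v

/-- The tangent map of `f : M → N` at `p`. -/
def tangentMap (A : ChartFamily M E) (B : ChartFamily N F) (f : M → N) (p : M) (v : A.Tan p) :
    B.Tan (f p) :=
  dirDeriv ℝ (fun y => B.toFun (B.chartIx (f p)) (f (A.invFun (A.chartIx p) y)))
    (A.toFun (A.chartIx p) p) v

/-- The differential at `p` of a function `g : M → R` with values in a locally convex space. -/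
def dFun (A : ChartFamily M E) (g : M → R) (p : M) (v : A.Tan p) : R :=
  dirDeriv ℝ (fun y => g (A.invFun (A.chartIx p) y)) (A.toFun (A.chartIx p) p) v

/-! #### Differential forms -/

/-- The representation of the 1-form `θ` in the chart `i`. -/
def rep₁ (A : ChartFamily M E) (θ : ∀ p, A.Tan p → R) (i : ι) (x v : E i) : R :=
  θ (A.invFun i x) (A.toTan i x v)

/-- The representation of the 2-tensor `ω` in the chart `i`. -/
def rep₂ (A : ChartFamily M E) (ω : ∀ p, A.Tan p → A.Tan p → R) (i : ι) (x v w : E i) : R :=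
  ω (A.invFun i x) (A.toTan i x v) (A.toTan i x w)

/-- `θ` is a smooth 1-form on `M`. -/
structure IsSmoothOneForm (A : ChartFamily M E) (θ : ∀ p, A.Tan p → R) : Prop where
  linear : ∀ p, IsLinearMap ℝ (θ p)
  smooth : ∀ i, MBSmoothOn ℝ (fun x : E i × E i => A.rep₁ θ i x.1 x.2) (A.target i ×ˢ univ)

/-- `ω` is a smooth (covariant, real bilinear) 2-tensor field on `M`. -/
structure IsSmoothTwoTensor (A : ChartFamily M E) (ω : ∀ p, A.Tan p → A.Tan p → R) : Prop where
  linear_left : ∀ p w, IsLinearMap ℝ (fun v => ω p v w)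
  linear_right : ∀ p v, IsLinearMap ℝ (ω p v)
  smooth : ∀ i, MBSmoothOn ℝ (fun x : E i × E i × E i => A.rep₂ ω i x.1 x.2.1 x.2.2)
    (A.target i ×ˢ univ)

/-- The pullback of the 2-tensor `ω` on `N` along `f : M → N`. -/
def pullback₂ (A : ChartFamily M E) (B : ChartFamily N F) (f : M → N)
    (ω : ∀ p, B.Tan p → B.Tan p → R) : ∀ p, A.Tan p → A.Tan p → R :=
  fun p v w => ω (f p) (tangentMap A B f p v) (tangentMap A B f p w)

end

end ChartFamily

section ExteriorDerivative

variable {E : Type*} [AddCommGroup E] [Module ℝ E]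
  {R : Type*} [AddCommGroup R] [Module ℝ R] [TopologicalSpace R]

/-- The exterior derivative at `x` of a 1-form on an open subset of `E`, on the constant vector
fields `u` and `v`. -/
def extDeriv₁ (θ : E → E → R) (x u v : E) : R :=
  dirDeriv ℝ (fun y => θ y v) x u - dirDeriv ℝ (fun y => θ y u) x v

/-- The exterior derivative at `x` of a 2-form on an open subset of `E`, on the constant vector
fields `u`, `v` and `w`. -/
def extDeriv₂ (ω : E → E → E → R) (x u v w : E) : R :=
  dirDeriv ℝ (fun y => ω y v w) x u + dirDeriv ℝ (fun y => ω y w u) x v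
    + dirDeriv ℝ (fun y => ω y u v) x w

end ExteriorDerivative

namespace ChartFamily

/-! #### Symplectic and Kähler manifolds -/

/-- `ω` is a symplectic form on the smooth locally convex manifold `M`: a smooth, closed 2-form
that is nondegenerate in the weak sense. -/
structure IsSymplectic {M : Type*} [TopologicalSpace M] {ι : Type*} {E : ι → Type*}
    [∀ i, AddCommGroup (E i)] [∀ i, Module ℝ (E i)] [∀ i, TopologicalSpace (E i)]
    (A : ChartFamily M E) (ω : ∀ p, A.Tan p → A.Tan p → ℝ) : Prop where
  manifold : IsLCManifold ℝ A
  tensor : A.IsSmoothTwoTensor ω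
  alternating : ∀ p v, ω p v v = 0
  closed : ∀ i, ∀ x ∈ A.target i, ∀ u v w, extDeriv₂ (A.rep₂ ω i) x u v w = 0
  nondegenerate : ∀ p v, (∀ w, ω p v w = 0) → v = 0

/-- The imaginary part of a Hermitian form. -/
def imForm {M ι : Type*} {E : ι → Type*} (A : ChartFamily M E)
    (H : ∀ p, A.Tan p → A.Tan p → ℂ) : ∀ p, A.Tan p → A.Tan p → ℝ :=
  fun p v w => (H p v w).im

/-- `M` with the Hermitian form `H` (antilinear in the first argument) is a locally convex
Hermitian manifold. The complex structure on the tangent spaces is multiplication by `i`; as the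
transition functions are holomorphic, it does not depend on charts, and its compatibility with
`H` is the sesquilinearity of `H`. -/
structure IsHermitian {M : Type*} [TopologicalSpace M] {ι : Type*} {E : ι → Type*}
    [∀ i, AddCommGroup (E i)] [∀ i, Module ℂ (E i)] [∀ i, TopologicalSpace (E i)]
    (A : ChartFamily M E) (H : ∀ p, A.Tan p → A.Tan p → ℂ) : Prop where
  manifold : IsLCManifold ℂ A
  tensor : A.IsSmoothTwoTensor H
  linear : ∀ p v, IsLinearMap ℂ (H p v)
  conj_symm : ∀ p v w, H p w v = star (H p v w)
  posDef : ∀ p v, v ≠ 0 → 0 < (H p v v).re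

/-- `M` with the Hermitian form `H` is a locally convex Kähler manifold: it is a Hermitian
manifold, and the 2-form `Im H` is symplectic. -/
structure IsKaehler {M : Type*} [TopologicalSpace M] {ι : Type*} {E : ι → Type*}
    [∀ i, AddCommGroup (E i)] [∀ i, Module ℂ (E i)] [∀ i, TopologicalSpace (E i)]
    (A : ChartFamily M E) (H : ∀ p, A.Tan p → A.Tan p → ℂ) : Prop where
  hermitian : A.IsHermitian H
  symplectic : A.IsSymplectic (A.imForm H)

end ChartFamily

/-! ### Principal circle bundles -/

/-- The circle `U(1)` with the angle charts `w ↦ arg (w / z)`, `z ∈ U(1)`. -/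
def circleCharts : ChartFamily Circle (fun _ : Circle => ℝ) where
  source z := {w | ((w / z : Circle) : ℂ) ∈ Complex.slitPlane}
  target _ := Ioo (-Real.pi) Real.pi
  toFun z w := Complex.arg ((w / z : Circle) : ℂ)
  invFun z t := z * Circle.exp t
  chartIx z := z

section Principal

variable {S ι M κ : Type*} [TopologicalSpace S] [TopologicalSpace M] [MulAction Circle S]
  {E : ι → Type*} [∀ i, AddCommGroup (E i)] [∀ i, Module ℝ (E i)] [∀ i, TopologicalSpace (E i)]
  {F : κ → Type*} [∀ i, AddCommGroup (F i)] [∀ i, Module ℝ (F i)] [∀ i, TopologicalSpace (F i)]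

/-- `π : S → M` is a smooth principal `U(1)`-bundle of locally convex manifolds. Every point of
`M` has an open neighbourhood `U` with an equivariant diffeomorphism `τ : U × U(1) → π⁻¹(U)` over
`U`, with inverse `s ↦ (π s, ζ s)`. (As `U(1)` is abelian, we do not distinguish between left and
right actions.) -/
structure IsPrincipalCircleBundle (B : ChartFamily S E) (A : ChartFamily M F) (π : S → M) :
    Prop where
  total : IsLCManifold ℝ B
  base : IsLCManifold ℝ A
  smooth_action : (circleCharts.prod B).SmoothMapOn B (fun q => q.1 • q.2) univ
  smooth_proj : B.SmoothMapOn A π univ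
  locally_trivial : ∀ p : M, ∃ U : Set M, IsOpen U ∧ p ∈ U ∧
    ∃ (τ : M × Circle → S) (ζ : S → Circle),
      (∀ q ∈ U, ∀ z, π (τ (q, z)) = q) ∧
      (∀ q ∈ U, ∀ z w, τ (q, z * w) = z • τ (q, w)) ∧
      (∀ q ∈ U, ∀ z, ζ (τ (q, z)) = z) ∧
      (∀ s, π s ∈ U → τ (π s, ζ s) = s) ∧
      (A.prod circleCharts).SmoothMapOn B τ (U ×ˢ univ) ∧
      B.SmoothMapOn circleCharts ζ (π ⁻¹' U)

/-- The vector field on `S` generated by the `U(1)`-action,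
`X₁(s) = d/dt|₀ (exp(it) • s)`. -/
def circleField (B : ChartFamily S E) (s : S) : B.Tan s :=
  dirDeriv ℝ (fun t : ℝ => B.toFun (B.chartIx s) (Circle.exp t • s)) 0 1

/-- The (real-valued) 1-form `α` on `S` is a principal connection 1-form, where the Lie algebra of
`U(1)` is identified with `ℝ`. -/
structure IsPrincipalConnection (B : ChartFamily S E) (α : ∀ s, B.Tan s → ℝ) : Prop where
  form : B.IsSmoothOneForm α
  invariant : ∀ (z : Circle) (s : S) (v : B.Tan s),
    α (z • s) (ChartFamily.tangentMap B B (fun s' => z • s') s v) = α s v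
  generator : ∀ s, α s (circleField B s) = 1

/-- The connection 1-form `α` has curvature `ω`, i.e. `dα = π^* ω`. -/
def PrincipalCurvature (B : ChartFamily S E) (A : ChartFamily M F) (π : S → M)
    (α : ∀ s, B.Tan s → ℝ) (ω : ∀ p, A.Tan p → A.Tan p → ℝ) : Prop :=
  ∀ i, ∀ x ∈ B.target i, ∀ u v,
    extDeriv₁ (B.rep₁ α i) x u v = B.rep₂ (ChartFamily.pullback₂ B A π ω) i x u v

end Principal

/-! ### Complex line bundles with connection -/

/-- The data of local frames `frame i p ∈ Fib p`, `p ∈ source i`, for a family of complex lines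
`Fib p`, with the coordinate `coord i p` on `Fib p` with respect to `frame i p`. -/
structure LineFrames {M : Type*} (ι : Type*) (Fib : M → Type*) where
  frame : ι → ∀ p, Fib p
  coord : ι → ∀ p, Fib p → ℂ

section LineBundle

variable {M ι : Type*} {E : ι → Type*} {Fib : M → Type*}
  [∀ p, AddCommGroup (Fib p)] [∀ p, Module ℂ (Fib p)]

/-- The charts of the total space of a line bundle defined by local frames. Their inverses are
`(x, z) ↦ z • frame i (κ_i⁻¹ x)`. -/
def LineFrames.charts (D : LineFrames ι Fib) (A : ChartFamily M E) :
    ChartFamily (Bundle.TotalSpace ℂ Fib) (fun i => E i × ℂ) where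
  source i := Bundle.TotalSpace.proj ⁻¹' A.source i
  target i := A.target i ×ˢ univ
  toFun i l := (A.toFun i l.proj, D.coord i l.proj l.snd)
  invFun i x := ⟨A.invFun i x.1, x.2 • D.frame i (A.invFun i x.1)⟩
  chartIx l := A.chartIx l.proj

/-- The total space of the lines `Fib p` is a complex line bundle over the locally convex manifold
`M`: a smooth one for `𝕜 = ℝ`, a holomorphic one for `𝕜 = ℂ`. -/
structure IsLineBundle (𝕜 : Type*) [NontriviallyNormedField 𝕜] [Module 𝕜 ℂ]
    [∀ i, AddCommGroup (E i)] [∀ i, Module 𝕜 (E i)]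
    [∀ i, Module ℝ (E i)] [∀ i, TopologicalSpace (E i)] [TopologicalSpace M]
    [TopologicalSpace (Bundle.TotalSpace ℂ Fib)] (A : ChartFamily M E) (D : LineFrames ι Fib) :
    Prop where
  base : IsLCManifold 𝕜 A
  total : IsLCManifold 𝕜 (D.charts A)
  linear : ∀ i, ∀ p ∈ A.source i, IsLinearMap ℂ (D.coord i p)

variable [∀ i, AddCommGroup (E i)] [∀ i, Module ℝ (E i)] [∀ i, TopologicalSpace (E i)]
  [TopologicalSpace M]

/-- The section `s` is smooth on the open set `U`. -/
def SmoothSectionOn (A : ChartFamily M E) (D : LineFrames ι Fib) (s : ∀ p, Fib p) (U : Set M) :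
    Prop :=
  ∀ i, MBSmoothOn ℝ (fun x => D.coord i (A.invFun i x) (s (A.invFun i x)))
    (A.target i ∩ A.invFun i ⁻¹' U)

/-- `D` is a linear connection (covariant derivative) on a line bundle. Here `D p X s ∈ Fib p` is
the derivative `∇_X s` at `p` of a section `s` that is smooth in a neighbourhood of `p`; its values
on other sections are irrelevant. -/
structure IsConnection (A : ChartFamily M E) (D : LineFrames ι Fib)
    (nabla : ∀ p, A.Tan p → (∀ q, Fib q) → Fib p) : Prop where
  linear : ∀ (U : Set M) (s : ∀ q, Fib q), IsOpen U → SmoothSectionOn A D s U →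
    ∀ p ∈ U, IsLinearMap ℝ (fun X => nabla p X s)
  local_eq : ∀ (U : Set M) (s s' : ∀ q, Fib q), IsOpen U → SmoothSectionOn A D s U →
    (∀ q ∈ U, s q = s' q) → ∀ p ∈ U, ∀ X, nabla p X s = nabla p X s'
  add : ∀ (U : Set M) (s s' : ∀ q, Fib q), IsOpen U → SmoothSectionOn A D s U →
    SmoothSectionOn A D s' U →
    ∀ p ∈ U, ∀ X, nabla p X (fun q => s q + s' q) = nabla p X s + nabla p X s'
  leibniz : ∀ (U : Set M) (g : M → ℂ) (s : ∀ q, Fib q), IsOpen U → A.SmoothFunOn g U →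
    SmoothSectionOn A D s U →
    ∀ p ∈ U, ∀ X, nabla p X (fun q => g q • s q) = A.dFun g p X • s p + g p • nabla p X s
  smooth : ∀ (U : Set M) (s : ∀ q, Fib q), IsOpen U → SmoothSectionOn A D s U →
    ∀ i, MBSmoothOn ℝ
      (fun x : E i × E i =>
        D.coord i (A.invFun i x.1) (nabla (A.invFun i x.1) (A.toTan i x.1 x.2) s))
      ((A.target i ∩ A.invFun i ⁻¹' U) ×ˢ univ)

/-- The local connection 1-form `θ_i` of `∇` in the chart `i`: `∇ e_i = θ_i e_i` for
`e_i = frame i`. -/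
def connectionForm (A : ChartFamily M E) (D : LineFrames ι Fib)
    (nabla : ∀ p, A.Tan p → (∀ q, Fib q) → Fib p) (i : ι) (x v : E i) : ℂ :=
  D.coord i (A.invFun i x) (nabla (A.invFun i x) (A.toTan i x v) (D.frame i))

/-- The line bundle connection `∇` has curvature `ω`. The curvature of a line bundle connection is
the closed 2-form given locally by `dθ_i`; under the identification of the Lie algebra of `U(1)`
with `ℝ`, the curvature is `ω` if this 2-form is `i ω`. -/
def LineBundleCurvature (A : ChartFamily M E) (D : LineFrames ι Fib)
    (nabla : ∀ p, A.Tan p → (∀ q, Fib q) → Fib p) (ω : ∀ p, A.Tan p → A.Tan p → ℝ) : Prop :=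
  ∀ i, ∀ x ∈ A.target i, ∀ u v,
    extDeriv₁ (connectionForm A D nabla i) x u v = Complex.I * ((A.rep₂ ω i x u v : ℝ) : ℂ)

/-- `h` is a smooth Hermitian metric on a line bundle. -/
structure IsHermitianMetric (A : ChartFamily M E) (D : LineFrames ι Fib)
    (h : ∀ p, Fib p → Fib p → ℂ) : Prop where
  linear : ∀ p l, IsLinearMap ℂ (h p l)
  conj_symm : ∀ p l m, h p m l = star (h p l m)
  posDef : ∀ p l, l ≠ 0 → 0 < (h p l l).re
  smooth : ∀ i, A.SmoothFunOn (fun p => h p (D.frame i p) (D.frame i p)) (A.source i)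

/-- The connection `∇` preserves the Hermitian metric `h`. -/
def IsMetricConnection (A : ChartFamily M E) (D : LineFrames ι Fib)
    (h : ∀ p, Fib p → Fib p → ℂ) (nabla : ∀ p, A.Tan p → (∀ q, Fib q) → Fib p) : Prop :=
  ∀ (U : Set M) (s s' : ∀ q, Fib q), IsOpen U → SmoothSectionOn A D s U →
    SmoothSectionOn A D s' U → ∀ p ∈ U, ∀ X,
    A.dFun (fun q => h q (s q) (s' q)) p X = h p (nabla p X s) (s' p) + h p (s p) (nabla p X s')

/-- A prequantum line bundle over the symplectic manifold `(M, ω)`: a Hermitian line bundle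
with a metric connection whose curvature is `ω`. -/
structure IsPrequantum [TopologicalSpace (Bundle.TotalSpace ℂ Fib)] (A : ChartFamily M E)
    (D : LineFrames ι Fib) (h : ∀ p, Fib p → Fib p → ℂ)
    (nabla : ∀ p, A.Tan p → (∀ q, Fib q) → Fib p) (ω : ∀ p, A.Tan p → A.Tan p → ℝ) : Prop where
  symplectic : A.IsSymplectic ω
  bundle : IsLineBundle ℝ A D
  metric : IsHermitianMetric A D h
  connection : IsConnection A D nabla
  metric_connection : IsMetricConnection A D h nabla
  curvature : LineBundleCurvature A D nabla ω

section Associated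

variable {S κ : Type*} [TopologicalSpace S] [MulAction Circle S] {F : κ → Type*}
  [∀ i, AddCommGroup (F i)] [∀ i, Module ℝ (F i)] [∀ i, TopologicalSpace (F i)]

/-- The map `S × ℂ → L, (s, c) ↦ c φ(s)` identifies the line bundle `L → M` with the bundle
`S ×_{U(1)} ℂ` associated to the principal bundle `π : S → M`: the map `φ` is smooth,
equivariant, and `φ(s)` spans the fibre of `L` over `π(s)`. -/
structure IsAssociatedBundle [TopologicalSpace (Bundle.TotalSpace ℂ Fib)] (B : ChartFamily S F)
    (A : ChartFamily M E) (D : LineFrames ι Fib) (π : S → M) (φ : ∀ s, Fib (π s)) : Prop where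
  smooth : B.SmoothMapOn (D.charts A)
    (fun s => (⟨π s, φ s⟩ : Bundle.TotalSpace ℂ Fib)) univ
  equivariant : ∀ (z : Circle) (s : S),
    (⟨π (z • s), φ (z • s)⟩ : Bundle.TotalSpace ℂ Fib) = ⟨π s, (z : ℂ) • φ s⟩
  basis : ∀ s, ∀ l : Fib (π s), ∃! c : ℂ, l = c • φ s

/-- `∇` is the connection on the line bundle `L = S ×_{U(1)} ℂ` inherited from the principal
connection `α`. A section of `L` corresponds to an (equivariant) function `f` on `S`, and `∇_X`
corresponds to the derivative of `f` along the horizontal lift `Y` of `X`. -/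
def IsAssociatedConnection (B : ChartFamily S F) (A : ChartFamily M E)
    (D : LineFrames ι Fib) (π : S → M) (φ : ∀ s, Fib (π s)) (α : ∀ s, B.Tan s → ℝ)
    (nabla : ∀ p, A.Tan p → (∀ q, Fib q) → Fib p) : Prop :=
  ∀ (U : Set M) (σ : ∀ q, Fib q) (f : S → ℂ), IsOpen U → SmoothSectionOn A D σ U →
    (∀ s, σ (π s) = f s • φ s) →
    ∀ s, π s ∈ U → ∀ Y : B.Tan s, α s Y = 0 →
      nabla (π s) (ChartFamily.tangentMap B A π s Y) σ = B.dFun f s Y • φ s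

end Associated

end LineBundle

/-! ### Projective space, the sphere and the tautological bundle -/

section ProjectiveSpace

variable {V : Type*} [AddCommGroup V] [Module ℂ V] [c : InnerProductSpace.Core ℂ V]

/-- The scalar product of `V`, antilinear in the first and linear in the second argument. -/
abbrev ip (x y : V) : ℂ := c.inner x y

theorem ip_add_right (x y z : V) : ip x (y + z) = ip x y + ip x z :=
  InnerProductSpace.Core.inner_add_right x y z

theorem ip_smul_right (x y : V) (r : ℂ) : ip x (r • y) = r * ip x y :=
  InnerProductSpace.Core.inner_smul_right x y

theorem ip_smul_left (x y : V) (r : ℂ) : ip (r • x) y = star r * ip x y :=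
  c.smul_left x y r

theorem ip_zero_right (x : V) : ip x 0 = 0 := InnerProductSpace.Core.inner_zero_right x

theorem ip_sub_right (x y z : V) : ip x (y - z) = ip x y - ip x z :=
  InnerProductSpace.Core.inner_sub_right x y z

theorem ip_self_eq (x : V) : ip x x = ((ip x x).re : ℂ) :=
  Complex.ext (by simp) (by simpa using InnerProductSpace.Core.inner_self_im (𝕜 := ℂ) x)

theorem ip_self_pos {x : V} (hx : x ≠ 0) : 0 < (ip x x).re := by
  refine lt_of_le_of_ne (c.re_inner_nonneg x) fun h => hx (c.definite x ?_)
  have h1 := ip_self_eq x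
  rw [← h] at h1
  simpa using h1

/-- The norm `‖v‖ = ⟨v, v⟩^{1/2}`. -/
def ipNorm (v : V) : ℝ := √(ip v v).re

variable (V) in
/-- The unit sphere `S(V)`. -/
abbrev UnitSphere : Type _ := {ψ : V // ip ψ ψ = 1}

theorem ip_unitVec {v : V} (hv : v ≠ 0) :
    ip (((ipNorm v)⁻¹ : ℂ) • v) (((ipNorm v)⁻¹ : ℂ) • v) = 1 := by
  have h := ip_self_pos hv
  have h2 : ((ipNorm v : ℝ) : ℂ) * (ipNorm v : ℝ) = ip v v := by
    rw [ip_self_eq v, ← Complex.ofReal_mul, ipNorm, Real.mul_self_sqrt h.le]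
  have h3 : ((ipNorm v : ℝ) : ℂ) ≠ 0 := by
    exact_mod_cast (Real.sqrt_pos.2 h).ne'
  rw [ip_smul_left, ip_smul_right, ← h2]
  simp only [star_inv₀, Complex.star_def, Complex.conj_ofReal]
  field_simp

/-- The unit vector `v / ‖v‖`. -/
def unitVec (v : V) (hv : v ≠ 0) : UnitSphere V := ⟨((ipNorm v)⁻¹ : ℂ) • v, ip_unitVec hv⟩

/-- The action of `U(1)` on `S(V)` by scalar multiplication. -/
instance : MulAction Circle (UnitSphere V) where
  smul z ψ := ⟨(z : ℂ) • (ψ : V), by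
    rw [ip_smul_left, ip_smul_right, ψ.2, mul_one, Complex.star_def, mul_comm, Complex.mul_conj,
      Circle.normSq_coe, Complex.ofReal_one]⟩
  one_smul ψ := Subtype.ext (one_smul ℂ (ψ : V))
  mul_smul z w ψ := Subtype.ext (by
    change ((z * w : Circle) : ℂ) • (ψ : V) = (z : ℂ) • (w : ℂ) • (ψ : V)
    rw [Circle.coe_mul, mul_smul])

/-- The complex hyperplane `{v | ⟨ψ, v⟩ = 0}`, the model of `P(V)` around `[ψ]`. -/
def hyperplane (ψ : UnitSphere V) : Submodule ℂ V where
  carrier := {v | ip (ψ : V) v = 0}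
  add_mem' {a b} ha hb := by
    change ip (ψ : V) (a + b) = 0
    rw [ip_add_right, show ip (ψ : V) a = 0 from ha, show ip (ψ : V) b = 0 from hb, add_zero]
  zero_mem' := ip_zero_right (ψ : V)
  smul_mem' r a ha := by
    change ip (ψ : V) (r • a) = 0
    rw [ip_smul_right, show ip (ψ : V) a = 0 from ha, mul_zero]

/-- The real hyperplane `{v | Re ⟨ψ, v⟩ = 0}`, the model of `S(V)` around `ψ`. -/
def realHyperplane (ψ : UnitSphere V) : Submodule ℝ V where
  carrier := {v | (ip (ψ : V) v).re = 0}
  add_mem' {a b} ha hb := by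
    change (ip (ψ : V) (a + b)).re = 0
    rw [ip_add_right, Complex.add_re, show (ip (ψ : V) a).re = 0 from ha,
      show (ip (ψ : V) b).re = 0 from hb, add_zero]
  zero_mem' := by
    change (ip (ψ : V) 0).re = 0
    rw [ip_zero_right, Complex.zero_re]
  smul_mem' r a ha := by
    change (ip (ψ : V) ((r : ℂ) • a)).re = 0
    rw [ip_smul_right, Complex.re_ofReal_mul, show (ip (ψ : V) a).re = 0 from ha, mul_zero]

theorem add_ne_zero_of_re (ψ : UnitSphere V) {v : V} (hv : (ip (ψ : V) v).re = 0) :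
    (ψ : V) + v ≠ 0 := by
  intro h
  have h1 : ip (ψ : V) ((ψ : V) + v) = 0 := by rw [h, ip_zero_right]
  rw [ip_add_right, ψ.2] at h1
  have h2 := congrArg Complex.re h1
  simp [hv] at h2

theorem add_ne_zero_of_mem (ψ : UnitSphere V) (v : hyperplane ψ) : (ψ : V) + v ≠ 0 :=
  add_ne_zero_of_re ψ (by rw [show ip (ψ : V) v = 0 from v.2, Complex.zero_re])

/-- The inclusion `{v | ⟨ψ, v⟩ = 0} ⊆ {v | Re ⟨ψ, v⟩ = 0}`. -/
def hyperplaneIncl (ψ : UnitSphere V) (v : hyperplane ψ) : realHyperplane ψ :=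
  ⟨(v : V), by
    change (ip (ψ : V) (v : V)).re = 0
    rw [show ip (ψ : V) v = 0 from v.2, Complex.zero_re]⟩

/-- `w ↦ w - ⟨ψ, w⟩ ψ`. -/
def toHyperplane (ψ : UnitSphere V) (w : V) : hyperplane ψ :=
  ⟨w - ip (ψ : V) w • (ψ : V), by
    change ip (ψ : V) _ = 0
    rw [ip_sub_right, ip_smul_right, ψ.2, mul_one, sub_self]⟩

/-- `w ↦ w - Re ⟨ψ, w⟩ ψ`. -/
def toRealHyperplane (ψ : UnitSphere V) (w : V) : realHyperplane ψ :=
  ⟨w - ((ip (ψ : V) w).re : ℂ) • (ψ : V), by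
    change (ip (ψ : V) _).re = 0
    rw [ip_sub_right, ip_smul_right, ψ.2, mul_one, Complex.sub_re, Complex.ofReal_re, sub_self]⟩

/-- The charts `κ_ψ([χ]) = ⟨ψ, χ⟩⁻¹ χ - ψ` of `P(V)` for unit vectors `ψ`, defined on
`{[χ] | ⟨ψ, χ⟩ ≠ 0}`, with inverse `v ↦ [ψ + v]`. (On this set `w = ⟨ψ, χ⟩⁻¹ χ` satisfies
`⟨ψ, w⟩ = 1`, so `toHyperplane ψ w = w - ψ`.) The chart around `p` is `κ_ψ` for a unit vector `ψ`
in `p`. -/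
def projCharts : ChartFamily (ℙ ℂ V) (fun ψ : UnitSphere V => hyperplane ψ) where
  source ψ := {p | ip (ψ : V) p.rep ≠ 0}
  target _ := univ
  toFun ψ p := toHyperplane ψ ((ip (ψ : V) p.rep)⁻¹ • p.rep)
  invFun ψ v := Projectivization.mk ℂ ((ψ : V) + v) (add_ne_zero_of_mem ψ v)
  chartIx p := unitVec p.rep p.rep_nonzero

/-- The charts `κ_ψ(χ) = (Re ⟨ψ, χ⟩)⁻¹ χ - ψ` of `S(V)`, defined on `{χ | Re ⟨ψ, χ⟩ > 0}`,
with inverse `v ↦ (ψ + v) / ‖ψ + v‖`. -/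
def sphereCharts : ChartFamily (UnitSphere V) (fun ψ : UnitSphere V => realHyperplane ψ) where
  source ψ := {χ | 0 < (ip (ψ : V) χ).re}
  target _ := univ
  toFun ψ χ := toRealHyperplane ψ ((((ip (ψ : V) χ).re)⁻¹ : ℂ) • (χ : V))
  invFun ψ v := unitVec ((ψ : V) + v) (add_ne_zero_of_re ψ v.2)
  chartIx ψ := ψ

theorem UnitSphere.ne_zero (ψ : UnitSphere V) : (ψ : V) ≠ 0 := by
  intro h
  have h1 := ψ.2
  rw [h, ip_zero_right] at h1
  exact zero_ne_one h1

/-- The projection `S(V) → P(V)`. -/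
def sphereProj (ψ : UnitSphere V) : ℙ ℂ V := Projectivization.mk ℂ (ψ : V) ψ.ne_zero

/-- The Hermitian form `H_{[ψ]}(v, w) = 2 ⟨v, w⟩` on `T_{[ψ]} P(V) = {v | ⟨ψ, v⟩ = 0}`. -/
def fubiniStudyH (p : ℙ ℂ V) (v w : (projCharts (V := V)).Tan p) : ℂ := 2 * ip (v : V) (w : V)

/-- The 2-form `Ω_{[ψ]}(v, w) = 2 Im ⟨v, w⟩` on `T_{[ψ]} P(V) = {v | ⟨ψ, v⟩ = 0}`. -/
def fubiniStudyΩ (p : ℙ ℂ V) (v w : (projCharts (V := V)).Tan p) : ℝ := 2 * (ip (v : V) (w : V)).im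

/-- The 1-form `α_ψ(v) = -i ⟨ψ, v⟩` on `T_ψ S(V) = {v | Re ⟨ψ, v⟩ = 0}`; this number is real, see
`ofReal_sphereα`. -/
def sphereα (ψ : UnitSphere V) (v : (sphereCharts (V := V)).Tan ψ) : ℝ :=
  (-Complex.I * ip (ψ : V) (v : V)).re

theorem ofReal_sphereα (ψ : UnitSphere V) (v : (sphereCharts (V := V)).Tan ψ) :
    (sphereα ψ v : ℂ) = -Complex.I * ip (ψ : V) (v : V) := by
  have h : (ip (ψ : V) (v : V)).re = 0 := v.2
  apply Complex.ext <;> simp [sphereα, h]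

variable (V) in
/-- The fibres of the tautological bundle `L(V)`: the fibre over the line `p` is `p`. -/
abbrev TautFib : ℙ ℂ V → Type _ := fun p => p.submodule

/-- The frames `[χ] ↦ ⟨ψ, χ⟩⁻¹ χ` (that is, `[ψ + v] ↦ ψ + v`) of the tautological bundle on
`{[χ] | ⟨ψ, χ⟩ ≠ 0}`. They define the charts with inverse `(v, z) ↦ z (ψ + v)`. -/
def tautFrames : LineFrames (UnitSphere V) (TautFib V) where
  frame ψ p := ⟨(ip (ψ : V) p.rep)⁻¹ • p.rep, by
    rw [p.submodule_eq]
    exact Submodule.smul_mem _ _ (Submodule.mem_span_singleton_self _)⟩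
  coord ψ _ l := ip (ψ : V) (l : V)

/-- The unit vector `ψ` as an element of the fibre of the tautological bundle over `[ψ]`. -/
def tautVec (ψ : UnitSphere V) : TautFib V (sphereProj ψ) :=
  ⟨(ψ : V), by
    rw [sphereProj, Projectivization.submodule_mk]
    exact Submodule.mem_span_singleton_self _⟩

/-- The Hermitian metric on the tautological bundle. -/
def tautMetric (p : ℙ ℂ V) (l m : TautFib V p) : ℂ := ip (l : V) (m : V)

/-- The connection on the tautological bundle: if the section `s` corresponds to the function
`f(χ) = ⟨χ, s([χ])⟩` on `S(V)`, i.e. `s([χ]) = f(χ) χ`, then `(∇_X s)([ψ]) = df_ψ(X) ψ`, where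
`ψ` is a unit vector and `X ∈ T_{[ψ]} P(V) = {X | ⟨ψ, X⟩ = 0} ⊆ T_ψ S(V)` is its own
horizontal lift. -/
def tautConnection [TopologicalSpace V] (p : ℙ ℂ V) (X : (projCharts (V := V)).Tan p)
    (s : ∀ q, TautFib V q) : TautFib V p :=
  ⟨(sphereCharts (V := V)).dFun (fun χ => ip (χ : V) (s (sphereProj χ) : V))
      (unitVec p.rep p.rep_nonzero) (hyperplaneIncl _ X) • (unitVec p.rep p.rep_nonzero : V), by
    rw [p.submodule_eq]
    exact Submodule.smul_mem _ _
      (Submodule.smul_mem _ _ (Submodule.mem_span_singleton_self _))⟩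

variable [TopologicalSpace V]

/-- The quotient topology on `P(V)`. -/
instance : TopologicalSpace (ℙ ℂ V) :=
  TopologicalSpace.coinduced (Projectivization.mk' ℂ) inferInstance

/-- The topology of `L(V)` as a subspace of `P(V) × V`. -/
instance : TopologicalSpace (Bundle.TotalSpace ℂ (TautFib V)) :=
  TopologicalSpace.induced (fun l => (l.proj, (l.snd : V))) inferInstance

end ProjectiveSpace

end

set_option linter.unusedSectionVars false

universe v

noncomputable section

/-! ### Directional derivatives -/

section DirDeriv

variable {𝕜 : Type*} [NontriviallyNormedField 𝕜]
  {E : Type*} [AddCommGroup E] [Module 𝕜 E]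
  {F : Type*} [AddCommGroup F] [Module 𝕜 F] [TopologicalSpace F]
  {G : Type*} [AddCommGroup G] [Module 𝕜 G] [TopologicalSpace G]

/-! All structures are computed upstairs, on `V \ {0}`. The charts of `P(V)` and `S(V)` parametrise
by the affine hyperplanes `ψ + T`, and as functions of a representing vector they are homogeneous of
degree zero, under nonzero complex scalars for `P(V)` and under positive real scalars for `S(V)`.
Chosen representatives and norms therefore cancel (`projCharts_toFun_mk`,
`sphereCharts_toFun_unitVec`), and every transition map is the restriction of an expression built
from the scalar product, an inverse and scalar multiplication.

For such expressions smoothness follows from a few closure properties: continuous linear maps,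
continuous bilinear maps (`MBContDiffOn.bilin`), and outer functions between normed spaces such as
the inverse, the square root, `arg` and `exp` (`ContDiffOn.comp_mbContDiffOn`). A chain rule is
needed only along curves and for functions with normed values; it comes from the mean value
inequality (`MBContDiffOn.tendsto_slope`).

The tangent space at a point is the model space of the chart centred there. If `w` lies on the line
of `φ`, the differential of `κ_φ` at `w` annihilates the radial direction and sends `v` to the
orthogonal projection of `⟨φ, w⟩⁻¹ v` (`projCharts_toTan`, `sphereCharts_toTan`,
`sphereProj_tangentMap`). With `w = ψ + x`, the form `H` becomes `fsForm w u v = 2 (⟨u, v⟩ / ⟨w, w⟩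
- ⟨u, w⟩ ⟨w, v⟩ / ⟨w, w⟩²)`, which is invariant under dilations and blind to radial vectors. The
form `α` becomes `Im ⟨w, v⟩ / ⟨w, w⟩`, and `∇` has the local connection form `⟨w, v⟩ / ⟨w, w⟩`,
whose real part `½ d log ⟨w, w⟩` is exact. Closedness of `Ω` and both curvature identities thus
become rational identities between scalar products (`fsDeriv_cyclic`, `connDeriv_sub`,
`tautConnDeriv_sub`).

The bundle `S(V)` is trivialised over `⟨ψ, ·⟩ ≠ 0` by choosing in each line the unit vector with
positive product with `ψ`. The connection `∇` is the orthogonal projection onto the line of the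
derivative taken in `V` (`hasDirDeriv_section`), hence metric. Its agreement with `α` rests on the
norm being stationary at a unit vector in orthogonal directions (`hasDirDeriv_ipNorm`). Its
smoothness comes from the formula `ds + θ s` in a frame (`tautConnection_smooth`). -/

theorem HasDirDeriv.dirDeriv_eq [T2Space F] {f : E → F} {x v : E} {w : F}
    (h : HasDirDeriv 𝕜 f x v w) : dirDeriv 𝕜 f x v = w :=
  h.limUnder_eq

theorem HasDirDeriv.unique [T2Space F] {f : E → F} {x v : E} {w w' : F}
    (hw : HasDirDeriv 𝕜 f x v w) (hw' : HasDirDeriv 𝕜 f x v w') : w = w' :=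
  tendsto_nhds_unique hw hw'

/-- Directional derivatives only depend on the restriction of the function to a line. -/
theorem HasDirDeriv.congr {E' : Type*} [AddCommGroup E'] [Module 𝕜 E'] {f : E → F} {x v : E}
    {g : E' → F} {y u : E'} {w : F} (h : HasDirDeriv 𝕜 f x v w) (hx : f x = g y)
    (hfg : ∀ᶠ t in 𝓝[≠] (0 : 𝕜), f (x + t • v) = g (y + t • u)) :
    HasDirDeriv 𝕜 g y u w := by
  refine Tendsto.congr' ?_ h
  filter_upwards [hfg] with t ht
  rw [hx, ht]

theorem eventually_add_smul_mem [TopologicalSpace E] [ContinuousAdd E] [ContinuousSMul 𝕜 E]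
    {U : Set E} (hU : IsOpen U) {x : E} (hx : x ∈ U) (v : E) :
    ∀ᶠ t in 𝓝[≠] (0 : 𝕜), x + t • v ∈ U := by
  have h : Tendsto (fun t : 𝕜 => x + t • v) (𝓝 0) (𝓝 x) := by
    have : Continuous fun t : 𝕜 => x + t • v := by fun_prop
    simpa using this.tendsto 0
  exact (h.mono_left nhdsWithin_le_nhds).eventually (hU.mem_nhds hx)

theorem HasDirDeriv.congr_of_eqOn [TopologicalSpace E] [ContinuousAdd E] [ContinuousSMul 𝕜 E]
    {f g : E → F} {U : Set E} (hU : IsOpen U) {x v : E} {w : F} (h : HasDirDeriv 𝕜 f x v w)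
    (hx : x ∈ U) (hfg : EqOn f g U) : HasDirDeriv 𝕜 g x v w :=
  h.congr (hfg hx) ((eventually_add_smul_mem hU hx v).mono fun _ ht => hfg ht)

theorem hasDirDeriv_const (x v : E) (a : F) : HasDirDeriv 𝕜 (fun _ : E => a) x v 0 := by
  simpa [HasDirDeriv] using tendsto_const_nhds

theorem HasDirDeriv.clm_comp {f : E → F} {x v : E} {w : F} (h : HasDirDeriv 𝕜 f x v w)
    (L : F →L[𝕜] G) : HasDirDeriv 𝕜 (fun y => L (f y)) x v (L w) := by
  refine ((L.continuous.tendsto w).comp h).congr fun t => ?_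
  simp

theorem HasDirDeriv.prodMk {f : E → F} {g : E → G} {x v : E} {w : F} {w' : G}
    (hf : HasDirDeriv 𝕜 f x v w) (hg : HasDirDeriv 𝕜 g x v w') :
    HasDirDeriv 𝕜 (fun y => (f y, g y)) x v (w, w') :=
  (Filter.Tendsto.prodMk_nhds hf hg).congr fun t => by simp

theorem hasDirDeriv_clm [ContinuousSMul 𝕜 F] [TopologicalSpace E] (L : E →L[𝕜] F) (x v : E) :
    HasDirDeriv 𝕜 L x v (L v) := by
  refine tendsto_const_nhds.congr' ?_
  filter_upwards [self_mem_nhdsWithin] with t ht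
  simp [smul_smul, inv_mul_cancel₀ (show t ≠ 0 from ht)]

theorem HasDirDeriv.smul_dir [ContinuousSMul 𝕜 F] {f : E → F} {x v : E} {w : F}
    (h : HasDirDeriv 𝕜 f x v w) (a : 𝕜) : HasDirDeriv 𝕜 f x (a • v) (a • w) := by
  rcases eq_or_ne a 0 with rfl | ha
  · simpa [HasDirDeriv] using tendsto_const_nhds
  -- The quotient along `a • v` at parameter `t` is `a` times the quotient along `v` at `t * a`, and
  -- `t * a` again tends to zero through nonzero values.
  · have h1 : Tendsto (fun t : 𝕜 => t * a) (𝓝[≠] 0) (𝓝[≠] 0) := by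
      refine tendsto_nhdsWithin_iff.2 ⟨?_, ?_⟩
      · have : Continuous fun t : 𝕜 => t * a := by fun_prop
        simpa using (this.tendsto 0).mono_left nhdsWithin_le_nhds
      · filter_upwards [self_mem_nhdsWithin] with t ht
        exact mul_ne_zero ht ha
    refine ((h.comp h1).const_smul a).congr' ?_
    filter_upwards [self_mem_nhdsWithin] with t ht
    simp only [Function.comp_apply, smul_smul, mul_inv]
    congr 1
    field_simp

/-- Off `t = 0`, the value at `x + t • v` is `f x` plus `t` times a convergent quotient. This gives
the continuity along a line that the product rule asks of one factor, without continuity of `f`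
itself. -/
theorem HasDirDeriv.tendsto [ContinuousAdd F] [ContinuousSMul 𝕜 F] {f : E → F} {x v : E} {w : F}
    (h : HasDirDeriv 𝕜 f x v w) :
    Tendsto (fun t : 𝕜 => f (x + t • v)) (𝓝[≠] 0) (𝓝 (f x)) := by
  have h1 : Tendsto (fun t : 𝕜 => t) (𝓝[≠] 0) (𝓝 0) := nhdsWithin_le_nhds
  have h2 := (tendsto_const_nhds (x := f x)).add (h1.smul h)
  rw [zero_smul, add_zero] at h2
  refine h2.congr' ?_
  filter_upwards [self_mem_nhdsWithin] with t ht
  rw [smul_smul, mul_inv_cancel₀ (show t ≠ 0 from ht), one_smul, add_sub_cancel]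

end DirDeriv

/-! ### The product rule -/

section Bilinear

variable {𝕜 : Type*} [NontriviallyNormedField 𝕜]
  {E : Type*} [AddCommGroup E] [Module 𝕜 E]
  {F : Type*} [AddCommGroup F] [Module 𝕜 F] [TopologicalSpace F]
  {G : Type*} [AddCommGroup G] [Module 𝕜 G] [TopologicalSpace G]
  {K : Type*} [AddCommGroup K] [Module 𝕜 K] [TopologicalSpace K] [ContinuousAdd K]

/-- The increment splits as `B (Δf) (g (x + t • v)) + B (f x) (Δg)`. The first term has `g` at the
moved point, which is why `hc` is needed; joint continuity of `B` does the rest. -/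
theorem HasDirDeriv.bilin (B : F →ₗ[𝕜] G →ₗ[𝕜] K) (hB : Continuous fun p : F × G => B p.1 p.2)
    {f : E → F} {g : E → G} {x v : E} {w : F} {w' : G}
    (hf : HasDirDeriv 𝕜 f x v w) (hg : HasDirDeriv 𝕜 g x v w')
    (hc : Tendsto (fun t : 𝕜 => g (x + t • v)) (𝓝[≠] 0) (𝓝 (g x))) :
    HasDirDeriv 𝕜 (fun y => B (f y) (g y)) x v (B w (g x) + B (f x) w') := by
  have h1 := (hB.tendsto (w, g x)).comp (Filter.Tendsto.prodMk_nhds hf hc)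
  have h2 := (hB.tendsto (f x, w')).comp
    (Filter.Tendsto.prodMk_nhds (tendsto_const_nhds (x := f x)) hg)
  refine (h1.add h2).congr fun t => ?_
  simp only [Function.comp_apply, map_smul, map_sub, LinearMap.smul_apply, LinearMap.sub_apply,
    ← smul_add]
  congr 1
  abel

end Bilinear

/-! ### Directional derivatives with values in normed spaces -/

section Normed

variable {𝕜 : Type*} [NontriviallyNormedField 𝕜]
  {E : Type*} [AddCommGroup E] [Module 𝕜 E]
  {F : Type*} [NormedAddCommGroup F] [NormedSpace 𝕜 F]
  {G : Type*} [NormedAddCommGroup G] [NormedSpace 𝕜 G]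

theorem hasDirDeriv_iff_hasDerivAt {f : E → F} {x v : E} {w : F} :
    HasDirDeriv 𝕜 f x v w ↔ HasDerivAt (fun t : 𝕜 => f (x + t • v)) w 0 := by
  rw [hasDerivAt_iff_tendsto_slope_zero]
  simp [HasDirDeriv]

theorem HasFDerivAt.comp_hasDirDeriv {φ : F → G} {φ' : F →L[𝕜] G} {f : E → F} {x v : E} {w : F}
    (hφ : HasFDerivAt φ φ' (f x)) (h : HasDirDeriv 𝕜 f x v w) :
    HasDirDeriv 𝕜 (fun y => φ (f y)) x v (φ' w) := by
  rw [hasDirDeriv_iff_hasDerivAt] at h ⊢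
  refine HasFDerivAt.comp_hasDerivAt (f := fun t : 𝕜 => f (x + t • v)) 0 ?_ h
  simpa using hφ

end Normed

/-! ### Michal-Bastiani smooth maps -/

section MB

variable {𝕜 : Type*} [NontriviallyNormedField 𝕜]
  {E : Type u} [AddCommGroup E] [Module 𝕜 E] [TopologicalSpace E]
  {E' : Type u} [AddCommGroup E'] [Module 𝕜 E'] [TopologicalSpace E']
  {F : Type*} [AddCommGroup F] [Module 𝕜 F] [TopologicalSpace F]
  {G : Type*} [AddCommGroup G] [Module 𝕜 G] [TopologicalSpace G]

theorem MBContDiffOn.continuousOn {n : ℕ} {f : E → F} {U : Set E} (h : MBContDiffOn 𝕜 n f U) :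
    ContinuousOn f U := by
  cases n with
  | zero => exact h
  | succ n => exact h.1

theorem MBContDiffOn.of_succ {n : ℕ} {f : E → F} {U : Set E} (h : MBContDiffOn 𝕜 (n + 1) f U) :
    MBContDiffOn 𝕜 n f U := by
  -- The space `E` has to vary in this and the following inductions, because the derivative of a
  -- function on `E` is a function on `E × E`.
  induction n generalizing E with
  | zero => exact h.1
  | succ n ih =>
    obtain ⟨hc, df, hd, hs⟩ := h
    exact ⟨hc, df, hd, ih hs⟩

theorem MBContDiffOn.mono {n : ℕ} {f : E → F} {U U' : Set E} (h : MBContDiffOn 𝕜 n f U)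
    (hU : U' ⊆ U) : MBContDiffOn 𝕜 n f U' := by
  induction n generalizing E with
  | zero => exact ContinuousOn.mono h hU
  | succ n ih =>
    obtain ⟨hc, df, hd, hs⟩ := h
    exact ⟨hc.mono hU, df, fun x hx => hd x (hU hx), ih hs (prod_mono hU subset_rfl)⟩

theorem MBContDiffOn.congr [ContinuousAdd E] [ContinuousSMul 𝕜 E] {n : ℕ} {f g : E → F}
    {U : Set E} (hU : IsOpen U) (h : MBContDiffOn 𝕜 n f U) (hfg : EqOn f g U) :
    MBContDiffOn 𝕜 n g U := by
  cases n with
  | zero => exact ContinuousOn.congr h hfg.symm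
  | succ n =>
    obtain ⟨hc, df, hd, hs⟩ := h
    exact ⟨hc.congr hfg.symm, df, fun x hx v => (hd x hx v).congr_of_eqOn hU hx hfg, hs⟩

theorem mbContDiffOn_const (n : ℕ) (a : F) (U : Set E) :
    MBContDiffOn 𝕜 n (fun _ : E => a) U := by
  induction n generalizing E a with
  | zero => exact continuousOn_const
  | succ n ih => exact ⟨continuousOn_const, _, fun x _ v => hasDirDeriv_const x v a, ih 0 _⟩

/-- The derivative of `L` is `(x, v) ↦ L v`, again continuous and linear, so the class of continuous
linear maps is closed under differentiation. -/
theorem mbContDiffOn_clm [ContinuousSMul 𝕜 F] (n : ℕ) (L : E →L[𝕜] F) (U : Set E) :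
    MBContDiffOn 𝕜 n L U := by
  induction n generalizing E with
  | zero => exact L.continuous.continuousOn
  | succ n ih =>
    exact ⟨L.continuous.continuousOn, _, fun x _ v => hasDirDeriv_clm L x v,
      ih (L.comp (ContinuousLinearMap.snd 𝕜 E E)) _⟩

theorem MBContDiffOn.comp_clm {n : ℕ} {f : E → F} {U : Set E} (h : MBContDiffOn 𝕜 n f U)
    (L : E' →L[𝕜] E) {U' : Set E'} (hL : MapsTo L U' U) :
    MBContDiffOn 𝕜 n (fun x => f (L x)) U' := by
  induction n generalizing E E' with
  | zero => exact ContinuousOn.comp h L.continuous.continuousOn hL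
  | succ n ih =>
    obtain ⟨hc, df, hd, hs⟩ := h
    refine ⟨hc.comp L.continuous.continuousOn hL, fun p => df (L p.1, L p.2), fun x hx v => ?_,
      ih hs (L.prodMap L) fun p hp => ⟨hL hp.1, mem_univ _⟩⟩
    simpa [HasDirDeriv] using hd (L x) (hL hx) (L v)

theorem MBContDiffOn.clm_comp {n : ℕ} {f : E → F} {U : Set E} (h : MBContDiffOn 𝕜 n f U)
    (L : F →L[𝕜] G) : MBContDiffOn 𝕜 n (fun x => L (f x)) U := by
  induction n generalizing E with
  | zero => exact L.continuous.comp_continuousOn h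
  | succ n ih =>
    obtain ⟨hc, df, hd, hs⟩ := h
    exact ⟨L.continuous.comp_continuousOn hc, _, fun x hx v => (hd x hx v).clm_comp L, ih hs⟩

theorem MBContDiffOn.prodMk {n : ℕ} {f : E → F} {g : E → G} {U : Set E}
    (hf : MBContDiffOn 𝕜 n f U) (hg : MBContDiffOn 𝕜 n g U) :
    MBContDiffOn 𝕜 n (fun x => (f x, g x)) U := by
  induction n generalizing E with
  | zero => exact ContinuousOn.prodMk hf hg
  | succ n ih =>
    obtain ⟨hc, df, hd, hs⟩ := hf
    obtain ⟨hc', dg, hd', hs'⟩ := hg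
    exact ⟨hc.prodMk hc', _, fun x hx v => (hd x hx v).prodMk (hd' x hx v), ih hs hs'⟩

theorem MBContDiffOn.add [ContinuousAdd F] {n : ℕ} {f g : E → F} {U : Set E}
    (hf : MBContDiffOn 𝕜 n f U) (hg : MBContDiffOn 𝕜 n g U) :
    MBContDiffOn 𝕜 n (fun x => f x + g x) U :=
  (hf.prodMk hg).clm_comp (ContinuousLinearMap.fst 𝕜 F F + ContinuousLinearMap.snd 𝕜 F F)

end MB

/-! ### Bilinear expressions and outer functions between normed spaces -/

section MBBilinear

variable {𝕜 : Type*} [NontriviallyNormedField 𝕜]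
  {E : Type u} [AddCommGroup E] [Module 𝕜 E] [TopologicalSpace E] [ContinuousAdd E]
  [ContinuousSMul 𝕜 E]

/-- By the product rule the derivative is a sum of two expressions of the same kind, pairing `df`
with `g` and `f` with `dg`; one order of differentiability is given up for the undifferentiated
factors and the induction closes. -/
theorem MBContDiffOn.bilin {F : Type*} [AddCommGroup F] [Module 𝕜 F] [TopologicalSpace F]
    {G : Type*} [AddCommGroup G] [Module 𝕜 G] [TopologicalSpace G]
    {K : Type*} [AddCommGroup K] [Module 𝕜 K] [TopologicalSpace K] [ContinuousAdd K]
    (B : F →ₗ[𝕜] G →ₗ[𝕜] K) (hB : Continuous fun p : F × G => B p.1 p.2) {n : ℕ}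
    {f : E → F} {g : E → G} {U : Set E} (hU : IsOpen U)
    (hf : MBContDiffOn 𝕜 n f U) (hg : MBContDiffOn 𝕜 n g U) :
    MBContDiffOn 𝕜 n (fun x => B (f x) (g x)) U := by
  induction n generalizing E with
  | zero => exact hB.comp_continuousOn (ContinuousOn.prodMk hf hg)
  | succ n ih =>
    have hf' := hf.of_succ.comp_clm (ContinuousLinearMap.fst 𝕜 E E) (U' := U ×ˢ univ)
      fun p hp => hp.1
    have hg' := hg.of_succ.comp_clm (ContinuousLinearMap.fst 𝕜 E E) (U' := U ×ˢ univ)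
      fun p hp => hp.1
    obtain ⟨hc, df, hd, hs⟩ := hf
    obtain ⟨hc', dg, hd', hs'⟩ := hg
    refine ⟨hB.comp_continuousOn (hc.prodMk hc'),
      fun p => B (df p) (g p.1) + B (f p.1) (dg p), fun x hx v => ?_,
      (ih (hU.prod isOpen_univ) hs hg').add (ih (hU.prod isOpen_univ) hf' hs')⟩
    refine (hd x hx v).bilin B hB (hd' x hx v) ?_
    have h1 : Tendsto (fun t : 𝕜 => x + t • v) (𝓝 0) (𝓝 x) := by
      have : Continuous fun t : 𝕜 => x + t • v := by fun_prop
      simpa using this.tendsto 0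
    exact ((hc'.continuousAt (hU.mem_nhds hx)).tendsto.comp h1).mono_left nhdsWithin_le_nhds

/-- The derivative `φ'(f x) (df (x, v))` is the evaluation pairing of `φ' ∘ f` with `df`. The
induction applies to `φ'`, whose values lie in `F →L[𝕜] G`; so `G` varies, and `F` and `G` share a
universe. -/
theorem ContDiffOn.comp_mbContDiffOn {F G : Type v} [NormedAddCommGroup F] [NormedSpace 𝕜 F]
    [NormedAddCommGroup G] [NormedSpace 𝕜 G] {n : ℕ} {φ : F → G} {O : Set F}
    (hφ : ContDiffOn 𝕜 n φ O) (hO : IsOpen O) {f : E → F} {U : Set E} (hU : IsOpen U)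
    (hf : MBContDiffOn 𝕜 n f U) (hm : MapsTo f U O) :
    MBContDiffOn 𝕜 n (fun x => φ (f x)) U := by
  induction n generalizing E G with
  | zero => exact hφ.continuousOn.comp hf hm
  | succ n ih =>
    have hf' := hf.of_succ.comp_clm (ContinuousLinearMap.fst 𝕜 E E) (U' := U ×ˢ univ)
      fun p hp => hp.1
    obtain ⟨hc, df, hd, hs⟩ := hf
    have hφ' := (contDiffOn_succ_iff_fderiv_of_isOpen (n := n) hO).1 (by exact_mod_cast hφ)
    refine ⟨hφ.continuousOn.comp hc hm, fun p => fderiv 𝕜 φ (f p.1) (df p), fun x hx v => ?_, ?_⟩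
    · exact (hφ'.1.differentiableAt (hO.mem_nhds (hm hx))).hasFDerivAt.comp_hasDirDeriv (hd x hx v)
    · exact MBContDiffOn.bilin (ContinuousLinearMap.coeLM 𝕜) isBoundedBilinearMap_apply.continuous
        (hU.prod isOpen_univ)
        (ih hφ'.2.2 (hU.prod isOpen_univ) hf' fun p hp => hm hp.1) hs

end MBBilinear

section MBSmooth

variable {𝕜 : Type*} [NontriviallyNormedField 𝕜]
  {E : Type u} [AddCommGroup E] [Module 𝕜 E] [TopologicalSpace E]
  {F : Type*} [AddCommGroup F] [Module 𝕜 F] [TopologicalSpace F]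

theorem MBSmoothOn.continuousOn {f : E → F} {U : Set E} (h : MBSmoothOn 𝕜 f U) :
    ContinuousOn f U := (h 0).continuousOn

theorem MBSmoothOn.hasDirDeriv [T2Space F] {f : E → F} {U : Set E} (h : MBSmoothOn 𝕜 f U) {x : E}
    (hx : x ∈ U) (v : E) : HasDirDeriv 𝕜 f x v (dirDeriv 𝕜 f x v) := by
  obtain ⟨-, df, hd, -⟩ := h 1
  have h1 := hd x hx v
  rwa [h1.dirDeriv_eq]

end MBSmooth

section MBSmooth

variable {𝕜 : Type*} [NontriviallyNormedField 𝕜]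
  {E : Type u} [AddCommGroup E] [Module 𝕜 E] [TopologicalSpace E] [ContinuousAdd E]
  [ContinuousSMul 𝕜 E]
  {F : Type*} [AddCommGroup F] [Module 𝕜 F] [TopologicalSpace F]

theorem MBSmoothOn.dirDeriv [T2Space F] {f : E → F} {U : Set E} (hU : IsOpen U)
    (h : MBSmoothOn 𝕜 f U) :
    MBSmoothOn 𝕜 (fun p : E × E => dirDeriv 𝕜 f p.1 p.2) (U ×ˢ univ) := by
  intro n
  obtain ⟨-, df, hd, hs⟩ := h (n + 1)
  exact hs.congr (hU.prod isOpen_univ) fun p hp => ((hd p.1 hp.1 p.2).dirDeriv_eq).symm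

theorem ContDiffOn.comp_mbSmoothOn {F G : Type v} [NormedAddCommGroup F] [NormedSpace 𝕜 F]
    [NormedAddCommGroup G] [NormedSpace 𝕜 G] {φ : F → G} {O : Set F}
    (hφ : ∀ n : ℕ, ContDiffOn 𝕜 n φ O) (hO : IsOpen O) {f : E → F} {U : Set E} (hU : IsOpen U)
    (hf : MBSmoothOn 𝕜 f U) (hm : MapsTo f U O) :
    MBSmoothOn 𝕜 (fun x => φ (f x)) U :=
  fun n => (hφ n).comp_mbContDiffOn hO hU (hf n) hm

theorem MBSmoothOn.congr {f g : E → F} {U : Set E} (hU : IsOpen U) (h : MBSmoothOn 𝕜 f U)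
    (hfg : EqOn f g U) : MBSmoothOn 𝕜 g U :=
  fun n => (h n).congr hU hfg

theorem MBSmoothOn.smul [ContinuousAdd F] [ContinuousSMul 𝕜 F] {f : E → 𝕜} {g : E → F} {U : Set E}
    (hU : IsOpen U) (hf : MBSmoothOn 𝕜 f U) (hg : MBSmoothOn 𝕜 g U) :
    MBSmoothOn 𝕜 (fun x => f x • g x) U :=
  fun n => (hf n).bilin (LinearMap.lsmul 𝕜 F) continuous_smul hU (hg n)

theorem MBSmoothOn.inv {f : E → 𝕜} {U : Set E} (hU : IsOpen U) (hf : MBSmoothOn 𝕜 f U)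
    (h0 : ∀ x ∈ U, f x ≠ 0) : MBSmoothOn 𝕜 (fun x => (f x)⁻¹) U :=
  ContDiffOn.comp_mbSmoothOn (O := {0}ᶜ)
    (fun _ _ hx => (contDiffAt_inv 𝕜 hx).contDiffWithinAt) isOpen_compl_singleton hU hf h0

end MBSmooth

section MBSmooth

variable {𝕜 : Type*} [NontriviallyNormedField 𝕜]
  {E : Type u} [AddCommGroup E] [Module 𝕜 E] [TopologicalSpace E]
  {E' : Type u} [AddCommGroup E'] [Module 𝕜 E'] [TopologicalSpace E']
  {F : Type*} [AddCommGroup F] [Module 𝕜 F] [TopologicalSpace F]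
  {G : Type*} [AddCommGroup G] [Module 𝕜 G] [TopologicalSpace G]

theorem MBSmoothOn.mono {f : E → F} {U U' : Set E} (h : MBSmoothOn 𝕜 f U) (hU : U' ⊆ U) :
    MBSmoothOn 𝕜 f U' :=
  fun n => (h n).mono hU

theorem mbSmoothOn_const (a : F) (U : Set E) : MBSmoothOn 𝕜 (fun _ : E => a) U :=
  fun n => mbContDiffOn_const n a U

theorem mbSmoothOn_clm [ContinuousSMul 𝕜 F] (L : E →L[𝕜] F) (U : Set E) : MBSmoothOn 𝕜 L U :=
  fun n => mbContDiffOn_clm n L U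

theorem MBSmoothOn.comp_clm {f : E → F} {U : Set E} (h : MBSmoothOn 𝕜 f U) (L : E' →L[𝕜] E)
    {U' : Set E'} (hL : MapsTo L U' U) : MBSmoothOn 𝕜 (fun x => f (L x)) U' :=
  fun n => (h n).comp_clm L hL

theorem MBSmoothOn.clm_comp {f : E → F} {U : Set E} (h : MBSmoothOn 𝕜 f U) (L : F →L[𝕜] G) :
    MBSmoothOn 𝕜 (fun x => L (f x)) U :=
  fun n => (h n).clm_comp L

theorem MBSmoothOn.prodMk {f : E → F} {g : E → G} {U : Set E} (hf : MBSmoothOn 𝕜 f U)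
    (hg : MBSmoothOn 𝕜 g U) : MBSmoothOn 𝕜 (fun x => (f x, g x)) U :=
  fun n => (hf n).prodMk (hg n)

theorem MBSmoothOn.add [ContinuousAdd F] {f g : E → F} {U : Set E} (hf : MBSmoothOn 𝕜 f U)
    (hg : MBSmoothOn 𝕜 g U) : MBSmoothOn 𝕜 (fun x => f x + g x) U :=
  fun n => (hf n).add (hg n)

end MBSmooth

/-! ### From complex to real smoothness -/

section RestrictScalars

theorem HasDirDeriv.restrictScalars {E : Type*} [AddCommGroup E] [Module ℂ E] [Module ℝ E]
    [IsScalarTower ℝ ℂ E] {F : Type*} [AddCommGroup F] [Module ℂ F] [Module ℝ F]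
    [IsScalarTower ℝ ℂ F] [TopologicalSpace F] {f : E → F} {x v : E} {w : F}
    (h : HasDirDeriv ℂ f x v w) : HasDirDeriv ℝ f x v w := by
  have h1 : Tendsto (fun t : ℝ => (t : ℂ)) (𝓝[≠] 0) (𝓝[≠] 0) := by
    refine tendsto_nhdsWithin_iff.2 ⟨?_, ?_⟩
    · simpa using (Complex.continuous_ofReal.tendsto 0).mono_left nhdsWithin_le_nhds
    · filter_upwards [self_mem_nhdsWithin] with t ht
      simpa using ht
  refine (Tendsto.comp h h1).congr fun t => ?_
  simp only [Function.comp_apply, ← Complex.coe_algebraMap,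
    algebraMap_smul, ← map_inv₀]

theorem MBSmoothOn.restrictScalars {E : Type u} [AddCommGroup E] [Module ℂ E] [Module ℝ E]
    [IsScalarTower ℝ ℂ E] [TopologicalSpace E] {F : Type*} [AddCommGroup F] [Module ℂ F]
    [Module ℝ F] [IsScalarTower ℝ ℂ F] [TopologicalSpace F] {f : E → F} {U : Set E}
    (h : MBSmoothOn ℂ f U) : MBSmoothOn ℝ f U := by
  intro n
  replace h := h n
  induction n generalizing E with
  | zero => exact h
  | succ n ih =>
    obtain ⟨hc, df, hd, hs⟩ := h
    exact ⟨hc, df, fun x hx v => (hd x hx v).restrictScalars, ih hs⟩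

end RestrictScalars

/-! ### The chain rule along curves -/

section ChainRule

variable {E : Type u} [AddCommGroup E] [Module ℝ E] [TopologicalSpace E] [IsTopologicalAddGroup E]
  [ContinuousSMul ℝ E] {F : Type*} [NormedAddCommGroup F] [NormedSpace ℝ F]

/-- A function of class `C^1` with values in a normed space is strictly differentiable in every
direction. -/
theorem MBContDiffOn.tendsto_slope {f : E → F} {U : Set E} (hf : MBContDiffOn ℝ 1 f U)
    (hU : IsOpen U) {x v : E} (hx : x ∈ U) {w : F} (hw : HasDirDeriv ℝ f x v w) {α : Type*}
    {l : Filter α} {y u : α → E} {t : α → ℝ} (hy : Tendsto y l (𝓝 x)) (hu : Tendsto u l (𝓝 v))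
    (ht : Tendsto t l (𝓝[≠] 0)) :
    Tendsto (fun a => (t a)⁻¹ • (f (y a + t a • u a) - f (y a))) l (𝓝 w) := by
  obtain ⟨-, df, hd, hs⟩ := hf
  have hdf : ContinuousAt df (x, v) :=
    ContinuousOn.continuousAt hs ((hU.prod isOpen_univ).mem_nhds ⟨hx, mem_univ _⟩)
  obtain rfl : w = df (x, v) := hw.unique (hd x hx v)
  obtain ⟨ht0, ht1⟩ := tendsto_nhdsWithin_iff.1 ht
  rw [Metric.tendsto_nhds]
  intro ε hε
  have h1 : ∀ᶠ p in 𝓝 (x, v), p.1 ∈ U ∧ ‖df p - df (x, v)‖ ≤ ε / 2 := by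
    refine (continuous_fst.continuousAt.eventually (hU.mem_nhds hx)).and ?_
    filter_upwards [hdf.eventually (Metric.closedBall_mem_nhds _ (half_pos hε))] with p hp
    simpa [dist_eq_norm] using hp
  rw [nhds_prod_eq] at h1
  obtain ⟨P, hP, Q, hQ, hPQ⟩ := eventually_prod_iff.1 h1
  -- The point `y a + (s * t a) • u a` is split as `x`, plus the small vector `y a - x`, plus the
  -- small vector `s • t a • u a`; each small vector gets its own neighbourhood of zero.
  have h2 : ∀ᶠ p in 𝓝 (0 : E) ×ˢ 𝓝 (0 : E), P (x + p.1 + p.2) := by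
    rw [← nhds_prod_eq]
    have : Continuous fun p : E × E => x + p.1 + p.2 := by fun_prop
    have := this.tendsto (0, 0)
    simp only [add_zero] at this
    exact this.eventually hP
  obtain ⟨P₁, hP₁, P₂, hP₂, hPP⟩ := eventually_prod_iff.1 h2
  -- A balanced neighbourhood containing `t a • u a` contains the whole segment from zero to it, so
  -- local convexity of `E` plays no role.
  obtain ⟨W, ⟨hW0, hWb⟩, hWP⟩ := (nhds_basis_balanced ℝ E).mem_iff.1 hP₂
  have hy' : Tendsto (fun a => y a - x) l (𝓝 0) := by simpa using hy.sub_const x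
  have htu : Tendsto (fun a => t a • u a) l (𝓝 0) := by simpa using ht0.smul hu
  filter_upwards [hy'.eventually hP₁, htu.eventually hW0, hu.eventually hQ, ht1] with a ha1 ha2 ha3
    ha4
  have ha4 : t a ≠ 0 := ha4
  have key : ∀ s ∈ Icc (0 : ℝ) 1, y a + (s * t a) • u a ∈ U ∧
      ‖df (y a + (s * t a) • u a, u a) - df (x, v)‖ ≤ ε / 2 := by
    intro s hs
    refine hPQ (y := u a) ?_ ha3
    have hm : s • t a • u a ∈ W := by
      refine hWb s ?_ (smul_mem_smul_set ha2)
      rw [Real.norm_eq_abs, abs_le]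
      constructor <;> linarith [hs.1, hs.2]
    have := hPP ha1 (hWP hm)
    simpa [smul_smul] using this
  -- After subtracting the expected linear term, the curve on `[0, 1]` has velocity `t a` times an
  -- increment of `df`, which `key` bounds by `ε / 2`; the mean value inequality then bounds the
  -- error of the slope.
  have hder : ∀ s ∈ Icc (0 : ℝ) 1, HasDerivWithinAt
      (fun s : ℝ => f (y a + (s * t a) • u a) - (s * t a) • df (x, v))
      (t a • (df (y a + (s * t a) • u a, u a) - df (x, v))) (Icc 0 1) s := by
    intro s hs
    have h3 := hasDirDeriv_iff_hasDerivAt.1 (hd _ (key s hs).1 (u a))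
    have h4 : HasDerivAt (fun r : ℝ => (r - s) * t a) (t a) s := by
      simpa using ((hasDerivAt_id s).sub_const s).mul_const (t a)
    have h5 := HasDerivAt.scomp_of_eq s h3 h4 (by simp)
    have h6 : HasDerivAt (fun r : ℝ => (r * t a) • df (x, v)) (t a • df (x, v)) s := by
      simpa using ((hasDerivAt_id s).mul_const (t a)).smul_const (df (x, v))
    have h7 := (h5.sub h6).hasDerivWithinAt (s := Icc (0 : ℝ) 1)
    rw [smul_sub]
    refine h7.congr_of_mem (fun r _ => ?_) hs
    simp only [Function.comp_apply, Pi.sub_apply]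
    congr 2
    rw [add_assoc, ← add_smul]
    congr 2
    ring
  have hb := norm_image_sub_le_of_norm_deriv_le_segment' hder (C := |t a| * (ε / 2))
    (fun s hs => by
      rw [norm_smul, Real.norm_eq_abs]
      exact mul_le_mul_of_nonneg_left (key s ⟨hs.1, hs.2.le⟩).2 (abs_nonneg _)) 1 (by simp)
  simp only [one_mul, zero_mul, zero_smul, add_zero, sub_zero, mul_one] at hb
  have ha5 : 0 < |t a| := abs_pos.2 ha4
  have h8 : (t a)⁻¹ • (f (y a + t a • u a) - f (y a)) - df (x, v) =
      (t a)⁻¹ • (f (y a + t a • u a) - t a • df (x, v) - f (y a)) := by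
    simp only [smul_sub, smul_smul, inv_mul_cancel₀ ha4, one_smul]
    abel
  rw [dist_eq_norm, h8, norm_smul, norm_inv, Real.norm_eq_abs, inv_mul_lt_iff₀ ha5]
  exact hb.trans_lt (mul_lt_mul_of_pos_left (half_lt_self hε) ha5)

/-- The chain rule along a curve. -/
theorem MBContDiffOn.tendsto_slope_curve {f : E → F} {U : Set E} (hf : MBContDiffOn ℝ 1 f U)
    (hU : IsOpen U) {x v : E} (hx : x ∈ U) {w : F} (hw : HasDirDeriv ℝ f x v w) {γ : ℝ → E}
    (hγ : Tendsto (fun t : ℝ => t⁻¹ • (γ t - x)) (𝓝[≠] 0) (𝓝 v)) :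
    Tendsto (fun t : ℝ => t⁻¹ • (f (γ t) - f x)) (𝓝[≠] 0) (𝓝 w) := by
  -- The curve is written as `γ t = x + t • u t` with `u t = t⁻¹ • (γ t - x)`, a direction that
  -- varies with `t` and tends to `v`.
  refine (hf.tendsto_slope hU hx hw (tendsto_const_nhds (x := x)) hγ tendsto_id).congr' ?_
  filter_upwards [self_mem_nhdsWithin] with t ht
  simp [smul_smul, mul_inv_cancel₀ (show t ≠ 0 from ht)]

/-- Additivity in the direction is not automatic for directional derivatives. The quotient along `v
+ v'` is the quotient along `v` at `x` plus the quotient along `v'` at the moving point `x + t • v`,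
and `MBContDiffOn.tendsto_slope` allows the base point to move. -/
theorem MBContDiffOn.hasDirDeriv_add {f : E → F} {U : Set E} (hf : MBContDiffOn ℝ 1 f U)
    (hU : IsOpen U) {x v v' : E} (hx : x ∈ U) {w w' : F} (hw : HasDirDeriv ℝ f x v w)
    (hw' : HasDirDeriv ℝ f x v' w') : HasDirDeriv ℝ f x (v + v') (w + w') := by
  have h1 : Tendsto (fun t : ℝ => x + t • v) (𝓝[≠] 0) (𝓝 x) := by
    have : Continuous fun t : ℝ => x + t • v := by fun_prop
    simpa using (this.tendsto 0).mono_left nhdsWithin_le_nhds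
  refine (hw.add (hf.tendsto_slope hU hx hw' h1 tendsto_const_nhds tendsto_id)).congr fun t => ?_
  simp only [id, smul_add t v, ← add_assoc]
  rw [← smul_add]
  congr 1
  abel

theorem MBSmoothOn.isLinearMap_dirDeriv {f : E → F} {U : Set E} (hf : MBSmoothOn ℝ f U)
    (hU : IsOpen U) {x : E} (hx : x ∈ U) : IsLinearMap ℝ (fun v => _root_.dirDeriv ℝ f x v) where
  map_add v v' := ((hf 1).hasDirDeriv_add hU hx (hf.hasDirDeriv hx v)
    (hf.hasDirDeriv hx v')).dirDeriv_eq
  map_smul a v := ((hf.hasDirDeriv hx v).smul_dir a).dirDeriv_eq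

end ChainRule

instance continuousSMul_real_of_complex {V : Type*} [AddCommGroup V] [Module ℂ V]
    [TopologicalSpace V] [ContinuousSMul ℂ V] : ContinuousSMul ℝ V :=
  IsScalarTower.continuousSMul ℂ

theorem mk_eq_mk_of_smul {V : Type*} [AddCommGroup V] [Module ℂ V] {v w : V} (hv : v ≠ 0)
    (hw : w ≠ 0) {a : ℂ} (h : v = a • w) :
    Projectivization.mk ℂ v hv = Projectivization.mk ℂ w hw :=
  (Projectivization.mk_eq_mk_iff' ℂ v w hv hw).2 ⟨a, h.symm⟩

/-! ### The scalar product and the charts, algebraically -/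

section Algebra

variable {V : Type*} [AddCommGroup V] [Module ℂ V] [c : InnerProductSpace.Core ℂ V]

theorem ip_conj (x y : V) : star (ip x y) = ip y x :=
  InnerProductSpace.Core.inner_conj_symm y x

theorem ip_add_left (x y z : V) : ip (x + y) z = ip x z + ip y z :=
  InnerProductSpace.Core.inner_add_left x y z

theorem ip_sub_left (x y z : V) : ip (x - y) z = ip x z - ip y z :=
  InnerProductSpace.Core.inner_sub_left x y z

theorem ip_zero_left (x : V) : ip 0 x = 0 := InnerProductSpace.Core.inner_zero_left x

theorem ip_real_smul_right (x y : V) (r : ℝ) : ip x (r • y) = r * ip x y :=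
  ip_smul_right x y (r : ℂ)

theorem ip_real_smul_left (x y : V) (r : ℝ) : ip (r • x) y = r * ip x y := by
  simpa using ip_smul_left x y (r : ℂ)

theorem ip_self_ne_zero {x : V} (hx : x ≠ 0) : ip x x ≠ 0 := by
  intro h
  have := ip_self_pos hx
  simp [h] at this

theorem ipNorm_pos {x : V} (hx : x ≠ 0) : 0 < ipNorm x := Real.sqrt_pos.2 (ip_self_pos hx)

theorem ipNorm_sq (x : V) : ((ipNorm x : ℝ) : ℂ) * (ipNorm x : ℝ) = ip x x := by
  rcases eq_or_ne x 0 with rfl | hx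
  · simp [ipNorm, ip_zero_left]
  · rw [ip_self_eq x, ← Complex.ofReal_mul, ipNorm, Real.mul_self_sqrt (ip_self_pos hx).le]

theorem UnitSphere.ip_self (ψ : UnitSphere V) : ip (ψ : V) (ψ : V) = 1 := ψ.2

theorem ipNorm_unit (ψ : UnitSphere V) : ipNorm (ψ : V) = 1 := by
  simp [ipNorm, ψ.2]

theorem coe_unitVec {w : V} (hw : w ≠ 0) : (unitVec w hw : V) = ((ipNorm w)⁻¹ : ℂ) • w := rfl

theorem unitVec_unit (ψ : UnitSphere V) (h : (ψ : V) ≠ 0) : unitVec (ψ : V) h = ψ :=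
  Subtype.ext (by simp [coe_unitVec, ipNorm_unit])

theorem coe_circle_smul (z : Circle) (ψ : UnitSphere V) :
    ((z • ψ : UnitSphere V) : V) = (z : ℂ) • (ψ : V) := rfl

theorem ip_hyperplane {ψ : UnitSphere V} (v : hyperplane ψ) : ip (ψ : V) (v : V) = 0 := v.2

theorem ip_hyperplane_left {ψ : UnitSphere V} (v : hyperplane ψ) : ip (v : V) (ψ : V) = 0 := by
  rw [← ip_conj, ip_hyperplane, star_zero]

theorem re_ip_realHyperplane {ψ : UnitSphere V} (v : realHyperplane ψ) :
    (ip (ψ : V) (v : V)).re = 0 := v.2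

theorem coe_toHyperplane (ψ : UnitSphere V) (w : V) :
    (toHyperplane ψ w : V) = w - ip (ψ : V) w • (ψ : V) := rfl

theorem coe_toRealHyperplane (ψ : UnitSphere V) (w : V) :
    (toRealHyperplane ψ w : V) = w - ((ip (ψ : V) w).re : ℂ) • (ψ : V) := rfl

theorem toHyperplane_add_coe (ψ : UnitSphere V) (v : hyperplane ψ) :
    toHyperplane ψ ((ψ : V) + v) = v :=
  Subtype.ext (by simp [coe_toHyperplane, ip_add_right, UnitSphere.ip_self, ip_hyperplane])

theorem toHyperplane_coe (ψ : UnitSphere V) (v : hyperplane ψ) :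
    toHyperplane ψ (v : V) = v :=
  Subtype.ext (by simp [coe_toHyperplane, ip_hyperplane])

theorem toRealHyperplane_add_coe (ψ : UnitSphere V) (v : realHyperplane ψ) :
    toRealHyperplane ψ ((ψ : V) + v) = v :=
  Subtype.ext (by
    simp [coe_toRealHyperplane, ip_add_right, UnitSphere.ip_self, re_ip_realHyperplane])

/-- The expression is homogeneous of degree zero, so the unknown scalar between `w` and the chosen
representative cancels. If `ip x w = 0`, both sides are zero by the convention for inverses, and no
condition is needed. -/
theorem inv_ip_smul_rep (x : V) {w : V} (hw : w ≠ 0) :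
    (ip x (Projectivization.mk ℂ w hw).rep)⁻¹ • (Projectivization.mk ℂ w hw).rep =
      (ip x w)⁻¹ • w := by
  obtain ⟨a, ha⟩ := Projectivization.exists_smul_eq_mk_rep ℂ w hw
  rw [← ha, Units.smul_def, ip_smul_right, smul_smul, mul_inv, mul_right_comm,
    inv_mul_cancel₀ a.ne_zero, one_mul]

theorem projCharts_toFun_mk (ψ : UnitSphere V) {w : V} (hw : w ≠ 0) :
    projCharts.toFun ψ (Projectivization.mk ℂ w hw) =
      toHyperplane ψ ((ip (ψ : V) w)⁻¹ • w) :=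
  congrArg (toHyperplane ψ) (inv_ip_smul_rep (ψ : V) hw)

theorem mk_mem_projCharts_source (ψ : UnitSphere V) {w : V} (hw : w ≠ 0) :
    Projectivization.mk ℂ w hw ∈ projCharts.source ψ ↔ ip (ψ : V) w ≠ 0 := by
  obtain ⟨a, ha⟩ := Projectivization.exists_smul_eq_mk_rep ℂ w hw
  change ip (ψ : V) (Projectivization.mk ℂ w hw).rep ≠ 0 ↔ _
  rw [← ha, Units.smul_def, ip_smul_right]
  simp

theorem coe_tautFrames_frame_mk (ψ : UnitSphere V) {w : V} (hw : w ≠ 0) :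
    (tautFrames.frame ψ (Projectivization.mk ℂ w hw) : V) = (ip (ψ : V) w)⁻¹ • w :=
  inv_ip_smul_rep (ψ : V) hw

theorem ip_add_coe (ψ : UnitSphere V) (v : hyperplane ψ) : ip (ψ : V) ((ψ : V) + v) = 1 := by
  rw [ip_add_right, ψ.ip_self, ip_hyperplane, add_zero]

theorem re_ip_add_coe (ψ : UnitSphere V) (v : realHyperplane ψ) :
    (ip (ψ : V) ((ψ : V) + v)).re = 1 := by
  rw [ip_add_right, ψ.ip_self, Complex.add_re, re_ip_realHyperplane, add_zero, Complex.one_re]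

theorem projCharts_invFun_mem_source (ψ φ : UnitSphere V) (v : hyperplane ψ) :
    projCharts.invFun ψ v ∈ projCharts.source φ ↔ ip (φ : V) ((ψ : V) + v) ≠ 0 :=
  mk_mem_projCharts_source φ _

theorem projCharts_invFun_mem_source_self (ψ : UnitSphere V) (v : hyperplane ψ) :
    projCharts.invFun ψ v ∈ projCharts.source ψ := by
  rw [projCharts_invFun_mem_source, ip_add_coe]
  exact one_ne_zero

theorem projCharts_toFun_invFun (ψ φ : UnitSphere V) (v : hyperplane ψ) :
    projCharts.toFun φ (projCharts.invFun ψ v) =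
      toHyperplane φ ((ip (φ : V) ((ψ : V) + v))⁻¹ • ((ψ : V) + v)) :=
  projCharts_toFun_mk φ _

theorem projCharts_right_inv (ψ : UnitSphere V) (v : hyperplane ψ) :
    projCharts.toFun ψ (projCharts.invFun ψ v) = v := by
  rw [projCharts_toFun_invFun, ip_add_coe, inv_one, one_smul, toHyperplane_add_coe]

theorem add_coe_toHyperplane {ψ : UnitSphere V} {w : V} (hw : ip (ψ : V) w ≠ 0) :
    (ψ : V) + toHyperplane ψ ((ip (ψ : V) w)⁻¹ • w) = (ip (ψ : V) w)⁻¹ • w := by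
  rw [coe_toHyperplane, ip_smul_right, inv_mul_cancel₀ hw, one_smul, add_sub_cancel]

theorem projCharts_left_inv (ψ : UnitSphere V) {p : ℙ ℂ V} (hp : p ∈ projCharts.source ψ) :
    projCharts.invFun ψ (projCharts.toFun ψ p) = p := by
  induction p with
  | h w hw =>
    rw [mk_mem_projCharts_source] at hp
    refine mk_eq_mk_of_smul _ _ (a := (ip (ψ : V) w)⁻¹) ?_
    rw [projCharts_toFun_mk, add_coe_toHyperplane hp]

theorem coe_tautFrames_frame_invFun (ψ φ : UnitSphere V) (v : hyperplane ψ) :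
    (tautFrames.frame φ (projCharts.invFun ψ v) : V) =
      (ip (φ : V) ((ψ : V) + v))⁻¹ • ((ψ : V) + v) :=
  coe_tautFrames_frame_mk φ _

theorem mem_source_chartIx (p : ℙ ℂ V) : p ∈ projCharts.source (projCharts.chartIx p) := by
  change ip (unitVec p.rep p.rep_nonzero : V) p.rep ≠ 0
  rw [coe_unitVec, ip_smul_left]
  have := (ipNorm_pos p.rep_nonzero).ne'
  simp [ip_self_ne_zero p.rep_nonzero, this]

/-- A representative of a line is a multiple of the unit vector chosen in it. -/
theorem eq_smul_chartIx {w : V} (hw : w ≠ 0) {φ : UnitSphere V}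
    (hφ : φ = projCharts.chartIx (Projectivization.mk ℂ w hw)) : w = ip (φ : V) w • (φ : V) := by
  obtain ⟨a, ha⟩ := Projectivization.exists_smul_eq_mk_rep ℂ w hw
  have h1 : (φ : V) = ((ipNorm (Projectivization.mk ℂ w hw).rep : ℂ)⁻¹ * a) • w := by
    rw [hφ, mul_smul, ← Units.smul_def a w, ha]
    rfl
  have h2 : ((ipNorm (Projectivization.mk ℂ w hw).rep : ℂ)⁻¹ * a) ≠ 0 :=
    mul_ne_zero (inv_ne_zero (by
      exact_mod_cast (ipNorm_pos (Projectivization.mk ℂ w hw).rep_nonzero).ne')) a.ne_zero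
  set b := ((ipNorm (Projectivization.mk ℂ w hw).rep : ℂ)⁻¹ * a)
  have h3 : w = b⁻¹ • (φ : V) := by rw [h1, smul_smul, inv_mul_cancel₀ h2, one_smul]
  conv_rhs => rw [h3, ip_smul_right, φ.ip_self, mul_one]
  exact h3

theorem mk_chartIx (p : ℙ ℂ V) :
    Projectivization.mk ℂ (projCharts.chartIx p : V) (UnitSphere.ne_zero _) = p := by
  conv_rhs => rw [← p.mk_rep]
  exact mk_eq_mk_of_smul _ _ rfl

theorem projCharts_toFun_chartIx (p : ℙ ℂ V) :
    projCharts.toFun (projCharts.chartIx p) p = 0 := by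
  have h : projCharts.toFun (projCharts.chartIx p)
      (Projectivization.mk ℂ (projCharts.chartIx p : V) (UnitSphere.ne_zero _)) = 0 := by
    rw [projCharts_toFun_mk, UnitSphere.ip_self, inv_one, one_smul]
    exact Subtype.ext (by simp [coe_toHyperplane, UnitSphere.ip_self])
  rwa [mk_chartIx] at h

/-- The normalising factor `1 / ‖w‖` is real and cancels between the vector and `Re ⟨ψ, ·⟩`. Hence
the transition maps of the sphere contain no square root. -/
theorem sphereCharts_toFun_unitVec (ψ : UnitSphere V) {w : V} (hw : w ≠ 0) :
    sphereCharts.toFun ψ (unitVec w hw) =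
      toRealHyperplane ψ ((((ip (ψ : V) w).re)⁻¹ : ℂ) • w) := by
  refine congrArg (toRealHyperplane ψ) ?_
  have h : (ipNorm w : ℂ) ≠ 0 := by exact_mod_cast (ipNorm_pos hw).ne'
  have h1 : (ip (ψ : V) (unitVec w hw : V)).re = (ipNorm w)⁻¹ * (ip (ψ : V) w).re := by
    rw [coe_unitVec, ip_smul_right, ← Complex.ofReal_inv, Complex.re_ofReal_mul]
  rw [h1, coe_unitVec, smul_smul, Complex.ofReal_mul, Complex.ofReal_inv, mul_inv, inv_inv,
    mul_right_comm, mul_inv_cancel₀ h, one_mul]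

theorem unitVec_mem_sphereCharts_source (ψ : UnitSphere V) {w : V} (hw : w ≠ 0) :
    unitVec w hw ∈ sphereCharts.source ψ ↔ 0 < (ip (ψ : V) w).re := by
  change 0 < (ip (ψ : V) (unitVec w hw : V)).re ↔ _
  have h := inv_pos.2 (ipNorm_pos hw)
  rw [coe_unitVec, ip_smul_right, ← Complex.ofReal_inv, Complex.re_ofReal_mul]
  exact mul_pos_iff_of_pos_left h

theorem unitVec_real_smul {w : V} {r : ℝ} (hr : 0 < r) (hw : w ≠ 0) (h : (r : ℂ) • w ≠ 0) :
    unitVec ((r : ℂ) • w) h = unitVec w hw := by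
  refine Subtype.ext ?_
  have h1 : ipNorm ((r : ℂ) • w) = r * ipNorm w := by
    rw [ipNorm, ip_smul_left, ip_smul_right, Complex.star_def, Complex.conj_ofReal,
      Complex.re_ofReal_mul, Complex.re_ofReal_mul, ← mul_assoc,
      Real.sqrt_mul (mul_self_nonneg r), Real.sqrt_mul_self hr.le, ipNorm]
  have h2 : (r : ℂ) ≠ 0 := by exact_mod_cast hr.ne'
  rw [coe_unitVec, coe_unitVec, h1, smul_smul, Complex.ofReal_mul, mul_inv, mul_right_comm,
    inv_mul_cancel₀ h2, one_mul]

theorem sphereCharts_right_inv (ψ : UnitSphere V) (v : realHyperplane ψ) :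
    sphereCharts.toFun ψ (sphereCharts.invFun ψ v) = v := by
  refine (sphereCharts_toFun_unitVec ψ (add_ne_zero_of_re ψ v.2)).trans ?_
  rw [re_ip_add_coe, Complex.ofReal_one, inv_one, one_smul, toRealHyperplane_add_coe]

theorem add_coe_toRealHyperplane {ψ : UnitSphere V} {w : V} (hw : (ip (ψ : V) w).re ≠ 0) :
    (ψ : V) + toRealHyperplane ψ ((((ip (ψ : V) w).re)⁻¹ : ℂ) • w) =
      (((ip (ψ : V) w).re)⁻¹ : ℂ) • w := by
  rw [coe_toRealHyperplane, ip_smul_right, ← Complex.ofReal_inv, Complex.re_ofReal_mul,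
    inv_mul_cancel₀ hw, Complex.ofReal_one, one_smul, add_sub_cancel]

theorem sphereCharts_left_inv (ψ : UnitSphere V) {χ : UnitSphere V}
    (hχ : χ ∈ sphereCharts.source ψ) : sphereCharts.invFun ψ (sphereCharts.toFun ψ χ) = χ := by
  have h : 0 < (ip (ψ : V) χ).re := hχ
  have h1 : (((ip (ψ : V) χ).re)⁻¹ : ℂ) • (χ : V) ≠ 0 := by
    rw [← add_coe_toRealHyperplane h.ne']
    exact add_ne_zero_of_re ψ (toRealHyperplane ψ _).2
  have h2 : sphereCharts.invFun ψ (sphereCharts.toFun ψ χ) = unitVec _ h1 := by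
    refine Subtype.ext ?_
    change ((ipNorm _)⁻¹ : ℂ) • _ = ((ipNorm _)⁻¹ : ℂ) • _
    rw [show (ψ : V) + (sphereCharts.toFun ψ χ : V) = _ from add_coe_toRealHyperplane h.ne']
  rw [h2]
  simp only [← Complex.ofReal_inv] at h1 ⊢
  rw [unitVec_real_smul (inv_pos.2 h) χ.ne_zero, unitVec_unit]

theorem sphereCharts_toFun_self (ψ : UnitSphere V) : sphereCharts.toFun ψ ψ = 0 := by
  have := sphereCharts_toFun_unitVec ψ ψ.ne_zero
  rw [unitVec_unit, ψ.ip_self, Complex.one_re, Complex.ofReal_one, inv_one, one_smul] at this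
  rw [this]
  exact Subtype.ext (by simp [coe_toRealHyperplane, ψ.ip_self])

theorem sphereProj_unitVec {w : V} (hw : w ≠ 0) :
    sphereProj (unitVec w hw) = Projectivization.mk ℂ w hw :=
  mk_eq_mk_of_smul _ _ rfl

theorem sphereProj_smul (z : Circle) (ψ : UnitSphere V) : sphereProj (z • ψ) = sphereProj ψ :=
  mk_eq_mk_of_smul _ _ rfl

theorem star_circle_mul_self (z : Circle) : star (z : ℂ) * z = 1 := by
  rw [mul_comm, Complex.star_def, Complex.mul_conj, Circle.normSq_coe, Complex.ofReal_one]

theorem smul_unitVec (z : Circle) {w : V} (hw : w ≠ 0) (hw' : (z : ℂ) • w ≠ 0) :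
    z • unitVec w hw = unitVec ((z : ℂ) • w) hw' := by
  refine Subtype.ext ?_
  have h : ipNorm ((z : ℂ) • w) = ipNorm w := by
    rw [ipNorm, ip_smul_left, ip_smul_right, ← mul_assoc, star_circle_mul_self, one_mul, ipNorm]
  rw [coe_circle_smul, coe_unitVec, coe_unitVec, h, smul_comm]

end Algebra

/-! ### Continuity of the scalar product and of the projections -/

section Continuity

variable {V : Type*} [AddCommGroup V] [Module ℂ V] [InnerProductSpace.Core ℂ V]

/-- The scalar product as a real bilinear map. -/
def ipBilin : V →ₗ[ℝ] V →ₗ[ℝ] ℂ :=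
  LinearMap.mk₂ ℝ (fun x y => ip x y) ip_add_left (fun a x y => ip_real_smul_left x y a)
    ip_add_right (fun a x y => ip_real_smul_right x y a)

/-- Strict Cauchy–Schwarz inequality: `w - ⟨ψ, w⟩ ψ` is nonzero because the lines differ, and its
square norm is `⟨w, w⟩ - |⟨ψ, w⟩|²`. -/
theorem norm_ip_unit_lt (ψ : UnitSphere V) {w : V} (hw : w ≠ 0)
    (h : Projectivization.mk ℂ w hw ≠ sphereProj ψ) : ‖ip (ψ : V) w‖ ^ 2 < (ip w w).re := by
  set a := ip (ψ : V) w
  have h1 : w - a • (ψ : V) ≠ 0 := fun h0 => h (mk_eq_mk_of_smul _ _ (sub_eq_zero.1 h0))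
  have h2 := ip_self_pos h1
  have h3 : ip (w - a • (ψ : V)) (w - a • (ψ : V)) = ip w w - ((‖a‖ ^ 2 : ℝ) : ℂ) := by
    have h4 : ip w (ψ : V) = star a := (ip_conj _ _).symm
    have h5 : ((‖a‖ ^ 2 : ℝ) : ℂ) = star a * a := by
      rw [← Complex.normSq_eq_norm_sq, mul_comm, Complex.star_def, Complex.mul_conj]
    rw [h5, ip_sub_left, ip_sub_right, ip_sub_right, ip_smul_left, ip_smul_right, ip_smul_left,
      ip_smul_right, ψ.ip_self, h4]
    change ip w w - a * star a - (star a * a - star a * (a * 1)) = _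
    ring
  rw [h3, Complex.sub_re, Complex.ofReal_re] at h2
  linarith

variable [TopologicalSpace V]

theorem continuous_ip (hip : Continuous fun x : V × V => ip x.1 x.2) {X : Type*}
    [TopologicalSpace X] {f g : X → V} (hf : Continuous f) (hg : Continuous g) :
    Continuous fun x => ip (f x) (g x) :=
  hip.comp (hf.prodMk hg)

variable [IsTopologicalAddGroup V]

/-- The continuous function `y ↦ ⟨y, y⟩` separates any nonzero vector from zero, which suffices in a
topological group. -/
theorem t2Space_of_ip (hip : Continuous fun x : V × V => ip x.1 x.2) : T2Space V := by
  refine IsTopologicalAddGroup.t2Space_of_zero_sep fun x hx => ?_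
  have hc : Continuous fun y : V => ip y y := continuous_ip hip continuous_id continuous_id
  refine ⟨{y | ip y y ≠ ip x x}, (isOpen_ne_fun hc continuous_const).mem_nhds ?_, fun h => h rfl⟩
  simpa [ip_zero_left] using (ip_self_ne_zero hx).symm

variable [ContinuousSMul ℂ V]

/-- The functional `⟨x, ·⟩`. -/
def ipCLM (hip : Continuous fun x : V × V => ip x.1 x.2) (x : V) : V →L[ℂ] ℂ where
  toFun y := ip x y
  map_add' := ip_add_right x
  map_smul' a y := ip_smul_right x y a
  cont := continuous_ip hip continuous_const continuous_id

/-- The projection `toHyperplane ψ` as a continuous linear map. -/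
def toHyperplaneCLM (hip : Continuous fun x : V × V => ip x.1 x.2) (ψ : UnitSphere V) :
    V →L[ℂ] hyperplane ψ where
  toFun := toHyperplane ψ
  map_add' v w := Subtype.ext (by
    simp only [coe_toHyperplane, Submodule.coe_add, ip_add_right, add_smul]
    abel)
  map_smul' a v := Subtype.ext (by
    simp [coe_toHyperplane, ip_smul_right, smul_sub, smul_smul])
  cont := Continuous.subtype_mk
    (continuous_id.sub ((continuous_ip hip continuous_const continuous_id).smul continuous_const)) _

/-- The projection `toRealHyperplane ψ` as a continuous linear map. -/
def toRealHyperplaneCLM (hip : Continuous fun x : V × V => ip x.1 x.2) (ψ : UnitSphere V) :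
    V →L[ℝ] realHyperplane ψ where
  toFun := toRealHyperplane ψ
  map_add' v w := Subtype.ext (by
    simp only [coe_toRealHyperplane, Submodule.coe_add, ip_add_right, Complex.add_re,
      Complex.ofReal_add, add_smul]
    abel)
  map_smul' a v := Subtype.ext (by
    simp only [coe_toRealHyperplane, Submodule.coe_smul, RingHom.id_apply, ip_real_smul_right,
      Complex.re_ofReal_mul, smul_sub, Complex.ofReal_mul, mul_smul, Complex.coe_smul])
  cont := Continuous.subtype_mk
    (continuous_id.sub ((Complex.continuous_ofReal.comp (Complex.continuous_re.comp
      (continuous_ip hip continuous_const continuous_id))).smul continuous_const)) _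

end Continuity

/-! ### Smoothness of complex-valued functions over the reals -/

section Real

variable {E : Type u} [AddCommGroup E] [Module ℝ E] [TopologicalSpace E]

theorem MBSmoothOn.ofReal {f : E → ℝ} {U : Set E} (hf : MBSmoothOn ℝ f U) :
    MBSmoothOn ℝ (fun x => (f x : ℂ)) U :=
  hf.clm_comp Complex.ofRealCLM

theorem MBSmoothOn.re {f : E → ℂ} {U : Set E} (hf : MBSmoothOn ℝ f U) :
    MBSmoothOn ℝ (fun x => (f x).re) U :=
  hf.clm_comp Complex.reCLM

theorem MBSmoothOn.im {f : E → ℂ} {U : Set E} (hf : MBSmoothOn ℝ f U) :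
    MBSmoothOn ℝ (fun x => (f x).im) U :=
  hf.clm_comp Complex.imCLM

variable [ContinuousAdd E] [ContinuousSMul ℝ E]

/-- Antilinearity in the first argument makes the scalar product bilinear over the reals only.
Holomorphy is available just when the first argument is fixed, as in `ipCLM`. -/
theorem MBSmoothOn.ip' {V : Type*} [AddCommGroup V] [Module ℂ V] [TopologicalSpace V]
    [InnerProductSpace.Core ℂ V] (hip : Continuous fun x : V × V => ip x.1 x.2) {f g : E → V} {U : Set E}
    (hU : IsOpen U) (hf : MBSmoothOn ℝ f U) (hg : MBSmoothOn ℝ g U) :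
    MBSmoothOn ℝ (fun x => ip (f x) (g x)) U :=
  fun n => (hf n).bilin ipBilin hip hU (hg n)

theorem MBSmoothOn.complex_smul {W : Type*} [AddCommGroup W] [Module ℂ W] [TopologicalSpace W]
    [ContinuousAdd W] [ContinuousSMul ℂ W] {f : E → ℂ} {g : E → W} {U : Set E} (hU : IsOpen U)
    (hf : MBSmoothOn ℝ f U) (hg : MBSmoothOn ℝ g U) : MBSmoothOn ℝ (fun x => f x • g x) U :=
  fun n => (hf n).bilin
    (LinearMap.mk₂ ℝ (fun (a : ℂ) (w : W) => a • w) add_smul (fun r a w => smul_assoc r a w)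
      smul_add (fun r a w => smul_comm a r w)) continuous_smul hU (hg n)

theorem MBSmoothOn.complex_inv {f : E → ℂ} {U : Set E} (hU : IsOpen U) (hf : MBSmoothOn ℝ f U)
    (h0 : ∀ x ∈ U, f x ≠ 0) : MBSmoothOn ℝ (fun x => (f x)⁻¹) U :=
  ContDiffOn.comp_mbSmoothOn (O := {0}ᶜ)
    (fun _ _ hx => (contDiffAt_inv ℝ hx).contDiffWithinAt) isOpen_compl_singleton hU hf h0

theorem MBSmoothOn.complex_mul {f g : E → ℂ} {U : Set E} (hU : IsOpen U)
    (hf : MBSmoothOn ℝ f U) (hg : MBSmoothOn ℝ g U) : MBSmoothOn ℝ (fun x => f x * g x) U :=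
  hf.complex_smul hU hg

end Real

/-! ### The topology of projective space -/

section Topology

variable {V : Type*} [AddCommGroup V] [Module ℂ V] [TopologicalSpace V]
  [ContinuousSMul ℂ V]

/-- The saturation of an open set is the union of its dilates by nonzero scalars, each of them open.
Openness of the quotient map allows continuity at a single point of `P(V)` to be tested on vectors.
-/
theorem isOpenQuotientMap_projectivization_mk :
    IsOpenQuotientMap (Projectivization.mk' ℂ : {v : V // v ≠ 0} → ℙ ℂ V) where
  surjective := fun p => ⟨⟨p.rep, p.rep_nonzero⟩, p.mk_rep⟩
  continuous := continuous_coinduced_rng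
  isOpenMap := by
    intro U hU
    refine isOpen_coinduced.2 ?_
    have h : Projectivization.mk' ℂ ⁻¹' (Projectivization.mk' ℂ '' U) =
        ⋃ a : ℂˣ, (fun v : {v : V // v ≠ 0} =>
          (⟨(a : ℂ) • (v : V), smul_ne_zero a.ne_zero v.2⟩ : {v : V // v ≠ 0})) ⁻¹' U := by
      ext v
      simp only [mem_preimage, mem_image, mem_iUnion]
      constructor
      · rintro ⟨u, hu, huv⟩
        obtain ⟨a, ha⟩ := (Projectivization.mk_eq_mk_iff ℂ _ _ u.2 v.2).1 huv
        refine ⟨a, ?_⟩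
        convert hu
        exact ha
      · rintro ⟨a, ha⟩
        exact ⟨_, ha, mk_eq_mk_of_smul _ _ rfl⟩
    rw [h]
    exact isOpen_iUnion fun a => hU.preimage (Continuous.subtype_mk (by fun_prop) _)

theorem continuous_projectivization_mk {X : Type*} [TopologicalSpace X] {f : X → V}
    (hf : Continuous f) (h0 : ∀ x, f x ≠ 0) :
    Continuous fun x => Projectivization.mk ℂ (f x) (h0 x) :=
  (isOpenQuotientMap_projectivization_mk (V := V)).continuous.comp (hf.subtype_mk h0)

variable [IsTopologicalAddGroup V] [InnerProductSpace.Core ℂ V]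

theorem isOpen_projCharts_source (hip : Continuous fun x : V × V => ip x.1 x.2)
    (ψ : UnitSphere V) : IsOpen (projCharts.source ψ) := by
  refine isOpen_coinduced.2 ?_
  have h : Projectivization.mk' ℂ ⁻¹' (projCharts.source ψ) =
      {w : {v : V // v ≠ 0} | ip (ψ : V) w ≠ 0} := by
    ext w
    exact mk_mem_projCharts_source ψ w.2
  rw [h]
  exact isOpen_ne_fun (continuous_ip hip continuous_const continuous_subtype_val) continuous_const

theorem continuousOn_projCharts_toFun (hip : Continuous fun x : V × V => ip x.1 x.2)
    (ψ : UnitSphere V) : ContinuousOn (projCharts.toFun ψ) (projCharts.source ψ) := by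
  intro p hp
  refine ContinuousAt.continuousWithinAt ?_
  induction p with
  | h w hw =>
    rw [mk_mem_projCharts_source] at hp
    refine (isOpenQuotientMap_projectivization_mk.continuousAt_comp_iff (x := ⟨w, hw⟩)).1 ?_
    have h : projCharts.toFun ψ ∘ Projectivization.mk' ℂ = fun w : {v : V // v ≠ 0} =>
        toHyperplane ψ ((ip (ψ : V) w)⁻¹ • (w : V)) :=
      funext fun w => projCharts_toFun_mk ψ w.2
    rw [h]
    refine (toHyperplaneCLM hip ψ).continuous.continuousAt.comp ?_
    exact (ContinuousAt.inv₀ (continuous_ip hip continuous_const continuous_subtype_val).continuousAt hp).smul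
      continuous_subtype_val.continuousAt

theorem continuous_projCharts_invFun (ψ : UnitSphere V) : Continuous (projCharts.invFun ψ) :=
  continuous_projectivization_mk (f := fun v : hyperplane ψ => (ψ : V) + v)
    (continuous_const.add continuous_subtype_val) (add_ne_zero_of_mem ψ)

/-- For a unit vector `ψ` in the line `p`, the transition probability `|⟨ψ, w⟩|² / ⟨w, w⟩` is a
continuous function on `P(V)` that takes the value `1` only at `p`; disjoint intervals around its
values separate `p` from `q`. -/
theorem t2Space_projectivization (hip : Continuous fun x : V × V => ip x.1 x.2) :
    T2Space (ℙ ℂ V) := by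
  refine t2Space_iff_disjoint_nhds.2 fun p q hpq => ?_
  set ψ := projCharts.chartIx p
  have hψ : sphereProj ψ = p := mk_chartIx p
  let g : ℙ ℂ V → ℝ := fun q => ‖ip (ψ : V) q.rep‖ ^ 2 / (ip q.rep q.rep).re
  have hg : ∀ (w : V) (hw : w ≠ 0),
      g (Projectivization.mk ℂ w hw) = ‖ip (ψ : V) w‖ ^ 2 / (ip w w).re := by
    intro w hw
    obtain ⟨a, ha⟩ := Projectivization.exists_smul_eq_mk_rep ℂ w hw
    have h1 : ip ((a : ℂ) • w) ((a : ℂ) • w) = ((‖(a : ℂ)‖ ^ 2 : ℝ) : ℂ) * ip w w := by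
      rw [ip_smul_left, ip_smul_right, ← mul_assoc, ← Complex.normSq_eq_norm_sq,
        mul_comm (star _), Complex.star_def, Complex.mul_conj]
    have h2 : ‖(a : ℂ)‖ ^ 2 ≠ 0 := pow_ne_zero _ (norm_ne_zero_iff.2 a.ne_zero)
    simp only [g, ← ha, Units.smul_def]
    rw [h1, ip_smul_right, norm_mul, mul_pow, Complex.re_ofReal_mul, mul_div_mul_left _ _ h2]
  have hc : Continuous g := by
    refine continuous_coinduced_dom.2 ?_
    have h : g ∘ Projectivization.mk' ℂ = fun w : {v : V // v ≠ 0} =>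
        ‖ip (ψ : V) w‖ ^ 2 / (ip (w : V) w).re := funext fun w => hg w w.2
    rw [h]
    refine Continuous.div
      ((continuous_ip hip continuous_const continuous_subtype_val).norm.pow 2)
      (Complex.continuous_re.comp (continuous_ip hip continuous_subtype_val continuous_subtype_val))
      fun w => (ip_self_pos w.2).ne'
  have h1 : g p = 1 := by
    have h2 := hg ψ ψ.ne_zero
    rw [ψ.ip_self] at h2
    simpa [← hψ, sphereProj] using h2
  have h2 : g q ≠ 1 := by
    induction q with
    | h w hw =>
      rw [hg w hw]
      have h3 := norm_ip_unit_lt ψ hw (hψ ▸ hpq.symm)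
      exact ((div_lt_one (ip_self_pos hw)).2 h3).ne
  exact ((hc.tendsto p).disjoint (disjoint_nhds_nhds.2 (h1.trans_ne h2.symm)) (hc.tendsto q))

end Topology

/-! ### The manifolds `P(V)`, `S(V)` and `L(V)` -/

theorem IsLCModel.restrictScalars {E : Type*} [AddCommGroup E] [Module ℂ E] [Module ℝ E]
    [IsScalarTower ℝ ℂ E] [TopologicalSpace E] (h : IsLCModel ℂ E) : IsLCModel ℝ E where
  addGroup := h.addGroup
  smul := by
    have := h.smul
    exact IsScalarTower.continuousSMul ℂ
  convex := h.convex
  t2 := h.t2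

theorem IsLCManifold.restrictScalars {M : Type*} [TopologicalSpace M] {ι : Type*} {E : ι → Type*}
    [∀ i, AddCommGroup (E i)] [∀ i, Module ℂ (E i)] [∀ i, Module ℝ (E i)]
    [∀ i, IsScalarTower ℝ ℂ (E i)] [∀ i, TopologicalSpace (E i)] {A : ChartFamily M E}
    (h : IsLCManifold ℂ A) : IsLCManifold ℝ A where
  model i := (h.model i).restrictScalars
  t2 := h.t2
  mem_source_at := h.mem_source_at
  isOpen_source := h.isOpen_source
  isOpen_target := h.isOpen_target
  mapsTo := h.mapsTo
  mapsTo_inv := h.mapsTo_inv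
  left_inv := h.left_inv
  right_inv := h.right_inv
  continuousOn := h.continuousOn
  continuousOn_inv := h.continuousOn_inv
  smooth_transition i j := (h.smooth_transition i j).restrictScalars

section Manifolds

variable {V : Type*} [AddCommGroup V] [Module ℂ V] [TopologicalSpace V]
  [IsTopologicalAddGroup V] [ContinuousSMul ℂ V] [InnerProductSpace.Core ℂ V]

theorem isLCModel_hyperplane [LocallyConvexSpace ℝ V]
    (hip : Continuous fun x : V × V => ip x.1 x.2) (ψ : UnitSphere V) :
    IsLCModel ℂ (hyperplane ψ) where
  addGroup := inferInstance
  smul := inferInstance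
  convex := Topology.IsInducing.locallyConvexSpace (𝕜 := ℝ)
    (f := (hyperplane ψ).subtype.restrictScalars ℝ) Topology.IsInducing.subtypeVal
  t2 := by
    have := t2Space_of_ip hip
    infer_instance

theorem isLCModel_realHyperplane [LocallyConvexSpace ℝ V]
    (hip : Continuous fun x : V × V => ip x.1 x.2) (ψ : UnitSphere V) :
    IsLCModel ℝ (realHyperplane ψ) where
  addGroup := inferInstance
  smul := inferInstance
  convex := inferInstance
  t2 := by
    have := t2Space_of_ip hip
    infer_instance

theorem mbSmoothOn_add_coe (ψ : UnitSphere V) (U : Set (hyperplane ψ)) :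
    MBSmoothOn ℂ (fun x : hyperplane ψ => (ψ : V) + x) U :=
  (mbSmoothOn_const (ψ : V) U).add (mbSmoothOn_clm (hyperplane ψ).subtypeL U)

theorem mbSmoothOn_add_coe_real (ψ : UnitSphere V) (U : Set (realHyperplane ψ)) :
    MBSmoothOn ℝ (fun x : realHyperplane ψ => (ψ : V) + x) U :=
  (mbSmoothOn_const (ψ : V) U).add (mbSmoothOn_clm (realHyperplane ψ).subtypeL U)

/-- The map `y ↦ κ_ψ([y])` is holomorphic. -/
theorem MBSmoothOn.toHyperplane (hip : Continuous fun x : V × V => ip x.1 x.2)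
    {E : Type u} [AddCommGroup E] [Module ℂ E] [TopologicalSpace E] [ContinuousAdd E]
    [ContinuousSMul ℂ E] (ψ : UnitSphere V) {f : E → V} {U : Set E} (hU : IsOpen U)
    (hf : MBSmoothOn ℂ f U) (h0 : ∀ x ∈ U, ip (ψ : V) (f x) ≠ 0) :
    MBSmoothOn ℂ (fun x => toHyperplane ψ ((ip (ψ : V) (f x))⁻¹ • f x)) U :=
  (((hf.clm_comp (ipCLM hip (ψ : V))).inv hU h0).smul hU hf).clm_comp (toHyperplaneCLM hip ψ)

/-- The map `y ↦ κ_ψ([y])` is smooth. -/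
theorem MBSmoothOn.toHyperplane_real (hip : Continuous fun x : V × V => ip x.1 x.2)
    {E : Type u} [AddCommGroup E] [Module ℝ E] [TopologicalSpace E] [ContinuousAdd E]
    [ContinuousSMul ℝ E] (ψ : UnitSphere V) {f : E → V} {U : Set E} (hU : IsOpen U)
    (hf : MBSmoothOn ℝ f U) (h0 : ∀ x ∈ U, ip (ψ : V) (f x) ≠ 0) :
    MBSmoothOn ℝ (fun x => _root_.toHyperplane ψ ((ip (ψ : V) (f x))⁻¹ • f x)) U :=
  (((MBSmoothOn.ip' hip hU (mbSmoothOn_const (ψ : V) U) hf).complex_inv hU h0).complex_smul hU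
    hf).clm_comp ((toHyperplaneCLM hip ψ).restrictScalars ℝ)

/-- The map `y ↦ κ_ψ(y / ‖y‖)` is smooth. -/
theorem MBSmoothOn.toRealHyperplane (hip : Continuous fun x : V × V => ip x.1 x.2)
    {E : Type u} [AddCommGroup E] [Module ℝ E] [TopologicalSpace E] [ContinuousAdd E]
    [ContinuousSMul ℝ E] (ψ : UnitSphere V) {f : E → V} {U : Set E} (hU : IsOpen U)
    (hf : MBSmoothOn ℝ f U) (h0 : ∀ x ∈ U, (ip (ψ : V) (f x)).re ≠ 0) :
    MBSmoothOn ℝ (fun x => toRealHyperplane ψ ((((ip (ψ : V) (f x)).re)⁻¹ : ℂ) • f x)) U :=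
  (((MBSmoothOn.ip' hip hU (mbSmoothOn_const (ψ : V) U) hf).re.ofReal.complex_inv hU
    fun x hx => Complex.ofReal_ne_zero.2 (h0 x hx)).complex_smul hU hf).clm_comp
    (toRealHyperplaneCLM hip ψ)

theorem isOpen_ip_ne_zero (hip : Continuous fun x : V × V => ip x.1 x.2) (y : V) {X : Type*}
    [TopologicalSpace X] {f : X → V} (hf : Continuous f) : IsOpen {x | ip y (f x) ≠ 0} :=
  isOpen_ne_fun (continuous_ip hip continuous_const hf) continuous_const

theorem isOpen_re_ip_pos (hip : Continuous fun x : V × V => ip x.1 x.2) (y : V) {X : Type*}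
    [TopologicalSpace X] {f : X → V} (hf : Continuous f) : IsOpen {x | 0 < (ip y (f x)).re} :=
  isOpen_lt continuous_const (Complex.continuous_re.comp (continuous_ip hip continuous_const hf))

theorem continuous_add_coe (ψ : UnitSphere V) :
    Continuous fun x : hyperplane ψ => (ψ : V) + x :=
  continuous_const.add continuous_subtype_val

theorem continuous_add_coe_real (ψ : UnitSphere V) :
    Continuous fun x : realHyperplane ψ => (ψ : V) + x :=
  continuous_const.add continuous_subtype_val

theorem isLCManifold_projCharts [LocallyConvexSpace ℝ V]
    (hip : Continuous fun x : V × V => ip x.1 x.2) :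
    IsLCManifold ℂ (projCharts (V := V)) where
  model := isLCModel_hyperplane hip
  t2 := t2Space_projectivization hip
  mem_source_at := mem_source_chartIx
  isOpen_source := isOpen_projCharts_source hip
  isOpen_target _ := isOpen_univ
  mapsTo _ _ _ := mem_univ _
  mapsTo_inv ψ v _ := projCharts_invFun_mem_source_self ψ v
  left_inv ψ _ hp := projCharts_left_inv ψ hp
  right_inv ψ v _ := projCharts_right_inv ψ v
  continuousOn := continuousOn_projCharts_toFun hip
  continuousOn_inv ψ := (continuous_projCharts_invFun ψ).continuousOn
  smooth_transition ψ φ := by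
    -- The transition map is `y ↦ κ_φ([y])` restricted to the affine hyperplane `ψ + T`, and is
    -- holomorphic wherever `⟨φ, y⟩ ≠ 0`.
    simp only [projCharts_toFun_invFun]
    refine (MBSmoothOn.toHyperplane hip φ (isOpen_ip_ne_zero hip φ (continuous_add_coe ψ))
      (mbSmoothOn_add_coe ψ _) fun x hx => hx).mono fun x hx => ?_
    exact (projCharts_invFun_mem_source ψ φ x).1 hx.2

theorem continuous_unitVec (hip : Continuous fun x : V × V => ip x.1 x.2) {X : Type*}
    [TopologicalSpace X] {f : X → V} (hf : Continuous f) (h0 : ∀ x, f x ≠ 0) :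
    Continuous fun x => unitVec (f x) (h0 x) := by
  refine Continuous.subtype_mk (Continuous.smul ?_ hf) _
  refine (Complex.continuous_ofReal.comp (Real.continuous_sqrt.comp
    (Complex.continuous_re.comp (continuous_ip hip hf hf)))).inv₀ fun x => ?_
  exact Complex.ofReal_ne_zero.2 (ipNorm_pos (h0 x)).ne'

theorem sphereCharts_toFun_invFun (ψ φ : UnitSphere V) (v : realHyperplane ψ) :
    sphereCharts.toFun φ (sphereCharts.invFun ψ v) =
      toRealHyperplane φ ((((ip (φ : V) ((ψ : V) + v)).re)⁻¹ : ℂ) • ((ψ : V) + v)) :=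
  sphereCharts_toFun_unitVec φ (add_ne_zero_of_re ψ v.2)

theorem sphereCharts_invFun_mem_source (ψ φ : UnitSphere V) (v : realHyperplane ψ) :
    sphereCharts.invFun ψ v ∈ sphereCharts.source φ ↔ 0 < (ip (φ : V) ((ψ : V) + v)).re :=
  unitVec_mem_sphereCharts_source φ (add_ne_zero_of_re ψ v.2)

theorem isLCManifold_sphereCharts [LocallyConvexSpace ℝ V]
    (hip : Continuous fun x : V × V => ip x.1 x.2) :
    IsLCManifold ℝ (sphereCharts (V := V)) where
  model := isLCModel_realHyperplane hip
  t2 := by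
    have := t2Space_of_ip hip
    infer_instance
  mem_source_at ψ := by
    change 0 < (ip (ψ : V) (ψ : V)).re
    rw [ψ.ip_self]
    exact one_pos
  isOpen_source ψ := isOpen_re_ip_pos hip ψ continuous_subtype_val
  isOpen_target _ := isOpen_univ
  mapsTo _ _ _ := mem_univ _
  mapsTo_inv ψ v _ := by
    rw [sphereCharts_invFun_mem_source, re_ip_add_coe]
    exact one_pos
  left_inv ψ _ hp := sphereCharts_left_inv ψ hp
  right_inv ψ v _ := sphereCharts_right_inv ψ v
  continuousOn ψ := by
    refine (toRealHyperplaneCLM hip ψ).continuous.comp_continuousOn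
      (ContinuousOn.smul (ContinuousOn.inv₀ ?_ fun χ hχ => ?_) continuous_subtype_val.continuousOn)
    · exact (Complex.continuous_ofReal.comp (Complex.continuous_re.comp
        (continuous_ip hip continuous_const continuous_subtype_val))).continuousOn
    · exact Complex.ofReal_ne_zero.2 (show 0 < (ip (ψ : V) χ).re from hχ).ne'
  continuousOn_inv ψ :=
    (continuous_unitVec hip (continuous_add_coe_real ψ)
      fun v => add_ne_zero_of_re ψ v.2).continuousOn
  smooth_transition ψ φ := by
    simp only [sphereCharts_toFun_invFun]
    refine (MBSmoothOn.toRealHyperplane hip φ (isOpen_re_ip_pos hip φ (continuous_add_coe_real ψ))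
      (mbSmoothOn_add_coe_real ψ _) fun x hx => ne_of_gt hx).mono fun x hx => ?_
    exact (sphereCharts_invFun_mem_source ψ φ x).1 hx.2

/-! ### The tautological bundle -/

theorem tautTotalSpace_ext {l m : Bundle.TotalSpace ℂ (TautFib V)} (h : l.proj = m.proj)
    (h' : (l.snd : V) = m.snd) : l = m := by
  obtain ⟨p, l⟩ := l
  obtain ⟨q, m⟩ := m
  obtain rfl : p = q := h
  exact congrArg (Bundle.TotalSpace.mk p) (Subtype.ext h')

theorem continuous_tautTotalSpace :
    Continuous fun l : Bundle.TotalSpace ℂ (TautFib V) => (l.proj, (l.snd : V)) :=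
  continuous_induced_dom

theorem continuous_tautTotalSpace_proj :
    Continuous (Bundle.TotalSpace.proj : Bundle.TotalSpace ℂ (TautFib V) → ℙ ℂ V) :=
  continuous_fst.comp continuous_tautTotalSpace

theorem continuous_tautTotalSpace_snd :
    Continuous fun l : Bundle.TotalSpace ℂ (TautFib V) => (l.snd : V) :=
  continuous_snd.comp continuous_tautTotalSpace

theorem tautFrames_coord (ψ : UnitSphere V) (p : ℙ ℂ V) (l : TautFib V p) :
    tautFrames.coord ψ p l = ip (ψ : V) (l : V) := rfl

theorem mem_mk_submodule {w : V} (hw : w ≠ 0) {l : V} :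
    l ∈ (Projectivization.mk ℂ w hw).submodule ↔ ∃ a : ℂ, a • w = l := by
  rw [Projectivization.submodule_mk, Submodule.mem_span_singleton]

/-- On the line `p`, with `⟨ψ, p⟩ ≠ 0`, the coordinate `coord ψ` is the one defined by `frame ψ`. -/
theorem coord_smul_frame {ψ : UnitSphere V} {p : ℙ ℂ V} (hp : p ∈ projCharts.source ψ)
    (l : TautFib V p) : ip (ψ : V) (l : V) • (tautFrames.frame ψ p : V) = l := by
  induction p with
  | h w hw =>
    obtain ⟨a, ha⟩ := (mem_mk_submodule hw).1 l.2
    have hp := (mk_mem_projCharts_source ψ hw).1 hp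
    rw [coe_tautFrames_frame_mk, ← ha, ip_smul_right, smul_smul, mul_assoc, mul_inv_cancel₀ hp,
      mul_one]

theorem coe_tautFrames_frame_invFun_self (ψ : UnitSphere V) (v : hyperplane ψ) :
    (tautFrames.frame ψ (projCharts.invFun ψ v) : V) = (ψ : V) + v := by
  rw [coe_tautFrames_frame_invFun, ip_add_coe, inv_one, one_smul]

theorem tautCharts_toFun_invFun (ψ φ : UnitSphere V) (x : hyperplane ψ × ℂ) :
    (tautFrames.charts projCharts).toFun φ ((tautFrames.charts projCharts).invFun ψ x) =
      (toHyperplane φ ((ip (φ : V) ((ψ : V) + x.1))⁻¹ • ((ψ : V) + x.1)),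
        ip (φ : V) (x.2 • ((ψ : V) + x.1))) := by
  rw [← projCharts_toFun_invFun, ← coe_tautFrames_frame_invFun_self]
  rfl

theorem isLCManifold_tautCharts [LocallyConvexSpace ℝ V]
    (hip : Continuous fun x : V × V => ip x.1 x.2) :
    IsLCManifold ℂ ((tautFrames (V := V)).charts projCharts) where
  model ψ :=
    have h := isLCModel_hyperplane hip ψ
    have := h.convex
    have := h.t2
    { addGroup := inferInstance
      smul := inferInstance
      convex := inferInstance
      t2 := inferInstance }
  t2 := by
    have := t2Space_of_ip hip
    have := t2Space_projectivization hip
    refine T2Space.of_injective_continuous (f := fun l : Bundle.TotalSpace ℂ (TautFib V) =>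
      (l.proj, (l.snd : V))) (fun l m h => ?_) continuous_induced_dom
    exact tautTotalSpace_ext (congrArg Prod.fst h) (congrArg Prod.snd h)
  mem_source_at l := mem_source_chartIx l.proj
  isOpen_source ψ := (isOpen_projCharts_source hip ψ).preimage continuous_tautTotalSpace_proj
  isOpen_target _ := isOpen_univ.prod isOpen_univ
  mapsTo _ _ _ := ⟨mem_univ _, mem_univ _⟩
  mapsTo_inv ψ x _ := projCharts_invFun_mem_source_self ψ x.1
  left_inv ψ l hl := by
    refine tautTotalSpace_ext (projCharts_left_inv ψ hl) ?_
    change ip (ψ : V) (l.snd : V) •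
      (tautFrames.frame ψ (projCharts.invFun ψ (projCharts.toFun ψ l.proj)) : V) = l.snd
    rw [projCharts_left_inv ψ hl]
    exact coord_smul_frame hl l.snd
  right_inv ψ x _ := by
    refine Prod.ext (projCharts_right_inv ψ x.1) ?_
    change ip (ψ : V) (x.2 • (tautFrames.frame ψ (projCharts.invFun ψ x.1) : V)) = x.2
    rw [coe_tautFrames_frame_invFun_self, ip_smul_right, ip_add_coe, mul_one]
  continuousOn ψ :=
    ((continuousOn_projCharts_toFun hip ψ).comp continuous_tautTotalSpace_proj.continuousOn
      fun _ hl => hl).prodMk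
      (continuous_ip hip continuous_const continuous_tautTotalSpace_snd).continuousOn
  continuousOn_inv ψ := by
    refine (continuous_induced_rng.2 (((continuous_projCharts_invFun ψ).comp
      continuous_fst).prodMk ?_)).continuousOn
    change Continuous fun x : hyperplane ψ × ℂ =>
      x.2 • (tautFrames.frame ψ (projCharts.invFun ψ x.1) : V)
    simp only [coe_tautFrames_frame_invFun_self]
    exact continuous_snd.smul ((continuous_add_coe ψ).comp continuous_fst)
  smooth_transition ψ φ := by
    have hO := isOpen_ip_ne_zero hip (φ : V) ((continuous_add_coe ψ).comp
      (continuous_fst : Continuous (Prod.fst : hyperplane ψ × ℂ → _)))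
    have h1 : MBSmoothOn ℂ (fun x : hyperplane ψ × ℂ => (ψ : V) + x.1)
        {x | ip (φ : V) ((ψ : V) + x.1) ≠ 0} :=
      (mbSmoothOn_add_coe ψ univ).comp_clm (ContinuousLinearMap.fst ℂ (hyperplane ψ) ℂ)
        fun _ _ => mem_univ _
    have h2 := (MBSmoothOn.toHyperplane hip φ hO h1 fun x hx => hx).prodMk
      (((mbSmoothOn_clm (ContinuousLinearMap.snd ℂ (hyperplane ψ) ℂ) _).smul hO h1).clm_comp
        (ipCLM hip (φ : V)))
    simp only [tautCharts_toFun_invFun]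
    exact h2.mono fun x hx => (projCharts_invFun_mem_source ψ φ x.1).1 hx.2

theorem isLineBundle_tautFrames [LocallyConvexSpace ℝ V]
    (hip : Continuous fun x : V × V => ip x.1 x.2) :
    IsLineBundle ℂ (projCharts (V := V)) tautFrames where
  base := isLCManifold_projCharts hip
  total := isLCManifold_tautCharts hip
  linear ψ _ _ := ⟨fun l m => ip_add_right (ψ : V) l m, fun a l => ip_smul_right (ψ : V) l a⟩

theorem isLineBundle_tautFrames_real [LocallyConvexSpace ℝ V]
    (hip : Continuous fun x : V × V => ip x.1 x.2) :
    IsLineBundle ℝ (projCharts (V := V)) tautFrames where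
  base := (isLCManifold_projCharts hip).restrictScalars
  total := (isLCManifold_tautCharts hip).restrictScalars
  linear := (isLineBundle_tautFrames hip).linear

end Manifolds

/-! ### Tangent vectors -/

section RealDeriv

variable {E : Type*} [AddCommGroup E] [Module ℝ E]

theorem HasDirDeriv.complex_smul {W : Type*} [AddCommGroup W] [Module ℂ W] [TopologicalSpace W]
    [ContinuousAdd W] [ContinuousSMul ℂ W] {f : E → ℂ} {g : E → W} {x v : E} {a : ℂ} {w : W}
    (hf : HasDirDeriv ℝ f x v a) (hg : HasDirDeriv ℝ g x v w) :
    HasDirDeriv ℝ (fun y => f y • g y) x v (a • g x + f x • w) :=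
  hf.bilin (LinearMap.mk₂ ℝ (fun (a : ℂ) (w : W) => a • w) add_smul (fun r a w => smul_assoc r a w)
    smul_add (fun r a w => smul_comm a r w)) continuous_smul hg hg.tendsto

theorem HasDirDeriv.ip' {V : Type*} [AddCommGroup V] [Module ℂ V] [TopologicalSpace V]
    [ContinuousAdd V] [ContinuousSMul ℂ V] [InnerProductSpace.Core ℂ V]
    (hip : Continuous fun x : V × V => ip x.1 x.2) {f g : E → V} {x v : E} {w w' : V}
    (hf : HasDirDeriv ℝ f x v w) (hg : HasDirDeriv ℝ g x v w') :
    HasDirDeriv ℝ (fun y => ip (f y) (g y)) x v (ip w (g x) + ip (f x) w') :=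
  hf.bilin ipBilin hip hg hg.tendsto

theorem HasDirDeriv.complex_inv {f : E → ℂ} {x v : E} {a : ℂ} (hf : HasDirDeriv ℝ f x v a)
    (h0 : f x ≠ 0) : HasDirDeriv ℝ (fun y => (f y)⁻¹) x v (-a / f x ^ 2) := by
  rw [hasDirDeriv_iff_hasDerivAt] at hf ⊢
  simpa using hf.fun_inv (by simpa using h0)

theorem HasDirDeriv.add {F : Type*} [AddCommGroup F] [Module ℝ F] [TopologicalSpace F]
    [ContinuousAdd F] {f g : E → F} {x v : E} {a b : F} (hf : HasDirDeriv ℝ f x v a)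
    (hg : HasDirDeriv ℝ g x v b) : HasDirDeriv ℝ (fun y => f y + g y) x v (a + b) :=
  (hf.prodMk hg).clm_comp (ContinuousLinearMap.fst ℝ F F + ContinuousLinearMap.snd ℝ F F)

theorem HasDirDeriv.re {f : E → ℂ} {x v : E} {a : ℂ} (hf : HasDirDeriv ℝ f x v a) :
    HasDirDeriv ℝ (fun y => (f y).re) x v a.re :=
  hf.clm_comp Complex.reCLM

theorem HasDirDeriv.im {f : E → ℂ} {x v : E} {a : ℂ} (hf : HasDirDeriv ℝ f x v a) :
    HasDirDeriv ℝ (fun y => (f y).im) x v a.im :=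
  hf.clm_comp Complex.imCLM

theorem HasDirDeriv.ofReal {f : E → ℝ} {x v : E} {a : ℝ} (hf : HasDirDeriv ℝ f x v a) :
    HasDirDeriv ℝ (fun y => (f y : ℂ)) x v a :=
  hf.clm_comp Complex.ofRealCLM

end RealDeriv

section Tangent

variable {V : Type*} [AddCommGroup V] [Module ℂ V] [TopologicalSpace V]
  [IsTopologicalAddGroup V] [ContinuousSMul ℂ V] [InnerProductSpace.Core ℂ V]

theorem hasDirDeriv_self (w v : V) : HasDirDeriv ℝ (fun y : V => y) w v v :=
  hasDirDeriv_clm (ContinuousLinearMap.id ℝ V) w v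

theorem toHyperplane_smul_self (ψ : UnitSphere V) (a : ℂ) : toHyperplane ψ (a • (ψ : V)) = 0 :=
  Subtype.ext (by simp [coe_toHyperplane, ip_smul_right, ψ.ip_self])

theorem toRealHyperplane_smul_self (ψ : UnitSphere V) (a : ℝ) :
    toRealHyperplane ψ ((a : ℂ) • (ψ : V)) = 0 :=
  Subtype.ext (by
    rw [coe_toRealHyperplane, ip_smul_right, ψ.ip_self, mul_one, Complex.ofReal_re, sub_self]
    rfl)

/-- The differential of `y ↦ κ_φ([y])` at a point of `[φ]`. -/
theorem hasDirDeriv_toHyperplane (hip : Continuous fun x : V × V => ip x.1 x.2) {φ : UnitSphere V}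
    {w : V} (hw : w ≠ 0) (hφ : w = ip (φ : V) w • (φ : V)) (v : V) :
    HasDirDeriv ℝ (fun y : V => toHyperplane φ ((ip (φ : V) y)⁻¹ • y)) w v
      (toHyperplane φ ((ip (φ : V) w)⁻¹ • v)) := by
  have h0 : ip (φ : V) w ≠ 0 := fun h => hw (by rw [hφ, h, zero_smul])
  have h1 := (hasDirDeriv_const (𝕜 := ℝ) w v (φ : V)).ip' hip (hasDirDeriv_self w v)
  have h2 := ((h1.complex_inv h0).complex_smul (hasDirDeriv_self w v)).clm_comp
    ((toHyperplaneCLM hip φ).restrictScalars ℝ)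
  -- Differentiating the scalar factor produces a multiple of `w`, hence of `φ`, which the
  -- projection kills; only the term where the vector is differentiated survives.
  have h3 : ∀ a b : ℂ, toHyperplaneCLM hip φ (a • w + b • v) = toHyperplane φ (b • v) := by
    intro a b
    rw [map_add]
    change toHyperplane φ _ + toHyperplane φ _ = _
    rw [hφ, smul_smul, toHyperplane_smul_self, zero_add]
  rw [ContinuousLinearMap.coe_restrictScalars', h3] at h2
  exact h2

/-- The differential of `y ↦ κ_φ(y / ‖y‖)` at a positive multiple of `φ`. -/
theorem hasDirDeriv_toRealHyperplane (hip : Continuous fun x : V × V => ip x.1 x.2)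
    {φ : UnitSphere V} {r : ℝ} (hr : r ≠ 0) {w : V} (hφ : w = (r : ℂ) • (φ : V)) (v : V) :
    HasDirDeriv ℝ (fun y : V => toRealHyperplane φ ((((ip (φ : V) y).re)⁻¹ : ℂ) • y)) w v
      (toRealHyperplane φ ((r : ℂ)⁻¹ • v)) := by
  have h0 : (ip (φ : V) w).re = r := by rw [hφ, ip_smul_right, φ.ip_self]; simp
  have h1 := ((hasDirDeriv_const (𝕜 := ℝ) w v (φ : V)).ip' hip (hasDirDeriv_self w v)).re.ofReal
  have h3 := h1.complex_inv (by rw [h0]; exact Complex.ofReal_ne_zero.2 hr)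
  have h2 := (h3.complex_smul (hasDirDeriv_self w v)).clm_comp (toRealHyperplaneCLM hip φ)
  -- Here the projection kills only real multiples of `φ`, so it matters that `r` and the derivative
  -- of the scalar factor are real.
  have h4 : ∀ (a : ℝ) (b : ℂ),
      toRealHyperplaneCLM hip φ ((a : ℂ) • w + b • v) = toRealHyperplane φ (b • v) := by
    intro a b
    rw [map_add]
    change toRealHyperplane φ _ + toRealHyperplane φ _ = _
    rw [hφ, smul_smul, ← Complex.ofReal_mul, toRealHyperplane_smul_self, zero_add]
  rw [← Complex.ofReal_neg, ← Complex.ofReal_pow, ← Complex.ofReal_div, h4, h0] at h2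
  exact h2

/-- The chart at the point `[ψ + x]` belongs to a unit vector `φ` proportional to `ψ + x`, so the
transition map is differentiated exactly where its radial term drops out. Comparing in `V` and
giving `φ` through an equation avoids rewriting inside the type of the tangent vector. -/
theorem projCharts_toTan (hip : Continuous fun x : V × V => ip x.1 x.2) {ψ φ : UnitSphere V}
    {x : hyperplane ψ} (hφ : φ = projCharts.chartIx (projCharts.invFun ψ x)) (v : hyperplane ψ) :
    ((projCharts.toTan ψ x v : hyperplane _) : V) =
      toHyperplane φ ((ip (φ : V) ((ψ : V) + x))⁻¹ • (v : V)) := by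
  have := t2Space_of_ip hip
  have h := hasDirDeriv_toHyperplane hip (add_ne_zero_of_mem ψ x)
    (eq_smul_chartIx (add_ne_zero_of_mem ψ x) rfl) (v : V)
  subst hφ
  refine congrArg Subtype.val (HasDirDeriv.dirDeriv_eq (𝕜 := ℝ)
    (h.congr (projCharts_toFun_invFun ψ _ x).symm (Eventually.of_forall fun t => ?_)))
  rw [projCharts_toFun_invFun, Submodule.coe_add, ← add_assoc]
  rfl

theorem sphereCharts_toTan (hip : Continuous fun x : V × V => ip x.1 x.2) {ψ φ : UnitSphere V}
    {x : realHyperplane ψ} (hφ : φ = sphereCharts.invFun ψ x) (v : realHyperplane ψ) :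
    ((sphereCharts.toTan ψ x v : realHyperplane _) : V) =
      toRealHyperplane φ ((ipNorm ((ψ : V) + x) : ℂ)⁻¹ • (v : V)) := by
  have := t2Space_of_ip hip
  have hw := add_ne_zero_of_re ψ x.2
  have hr := (ipNorm_pos hw).ne'
  have h := hasDirDeriv_toRealHyperplane hip (φ := sphereCharts.invFun ψ x) hr
    (w := (ψ : V) + x) (by
      change _ = _ • (_ : ℂ) • _
      rw [smul_smul, mul_inv_cancel₀ (Complex.ofReal_ne_zero.2 hr), one_smul]) (v : V)
  subst hφ
  refine congrArg Subtype.val (HasDirDeriv.dirDeriv_eq (𝕜 := ℝ)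
    (h.congr (sphereCharts_toFun_invFun ψ _ x).symm (Eventually.of_forall fun t => ?_)))
  rw [sphereCharts_toFun_invFun, Submodule.coe_add, ← add_assoc]
  rfl

theorem eq_smul_chartIx_sphereProj {s φ : UnitSphere V}
    (hφ : φ = projCharts.chartIx (sphereProj s)) : (s : V) = ip (φ : V) s • (φ : V) :=
  eq_smul_chartIx s.ne_zero hφ

theorem sphereProj_invFun (ψ : UnitSphere V) (x : realHyperplane ψ) :
    sphereProj (sphereCharts.invFun ψ x) =
      Projectivization.mk ℂ ((ψ : V) + x) (add_ne_zero_of_re ψ x.2) :=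
  sphereProj_unitVec _

theorem sphereCharts_invFun_zero (ψ : UnitSphere V) : sphereCharts.invFun ψ 0 = ψ :=
  Subtype.ext (by
    change ((ipNorm ((ψ : V) + 0) : ℂ))⁻¹ • ((ψ : V) + 0) = ψ
    rw [add_zero, ipNorm_unit, Complex.ofReal_one, inv_one, one_smul])

/-- The unit vector `φ` that defines the chart at `[s]` need not be `s`; the two differ by the phase
`⟨φ, s⟩`, which is the factor in the formula. -/
theorem sphereProj_tangentMap (hip : Continuous fun x : V × V => ip x.1 x.2) {s φ : UnitSphere V}
    (hφ : φ = projCharts.chartIx (sphereProj s)) (v : realHyperplane s) :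
    ((ChartFamily.tangentMap sphereCharts projCharts sphereProj s v : hyperplane _) : V) =
      toHyperplane φ ((ip (φ : V) (s : V))⁻¹ • (v : V)) := by
  have := t2Space_of_ip hip
  have h := hasDirDeriv_toHyperplane hip s.ne_zero (eq_smul_chartIx_sphereProj rfl) (v : V)
  subst hφ
  have h0 : sphereCharts.toFun (sphereCharts.chartIx s) s = 0 := sphereCharts_toFun_self s
  refine congrArg Subtype.val (HasDirDeriv.dirDeriv_eq (𝕜 := ℝ)
    (h.congr ?_ (Eventually.of_forall fun t => ?_)))
  · rw [h0, show sphereCharts.invFun (sphereCharts.chartIx s) 0 = s from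
      sphereCharts_invFun_zero s]
    exact (projCharts_toFun_mk _ s.ne_zero).symm
  · rw [h0, sphereProj_invFun, projCharts_toFun_mk, zero_add]
    rfl

end Tangent

/-! ### The Fubini-Study form -/

section FubiniStudy

variable {V : Type*} [AddCommGroup V] [Module ℂ V] [InnerProductSpace.Core ℂ V]

/-- The pullback of the Hermitian form `H` of `P(V)` to `V \ {0}`. -/
def fsForm (w u v : V) : ℂ := 2 * (ip u v / ip w w - ip u w * ip w v / ip w w ^ 2)

/-- A form pulled back from `P(V)` is invariant under dilations by `a`, whose differential
multiplies tangent vectors by `a` as well. -/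
theorem fsForm_smul {w : V} (hw : w ≠ 0) {a : ℂ} (ha : a ≠ 0) (u v : V) :
    fsForm (a • w) (a • u) (a • v) = fsForm w u v := by
  have h := ip_self_ne_zero hw
  have ha' : star a ≠ 0 := star_ne_zero.2 ha
  simp only [fsForm, ip_smul_left, ip_smul_right]
  field_simp

/-- Multiples of `w` are tangent to the line through `w` and are lost in `P(V)`. -/
theorem fsForm_add_smul {w : V} (hw : w ≠ 0) (a b : ℂ) (u v : V) :
    fsForm w (u + a • w) (v + b • w) = fsForm w u v := by
  have h := ip_self_ne_zero hw
  simp only [fsForm, ip_smul_left, ip_smul_right, ip_add_left, ip_add_right]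
  field_simp
  ring

theorem two_mul_ip_toHyperplane (φ : UnitSphere V) (u v : V) :
    2 * ip (toHyperplane φ u : V) (toHyperplane φ v : V) = fsForm (φ : V) u v := by
  simp only [fsForm, coe_toHyperplane, ip_sub_left, ip_sub_right, ip_smul_left, ip_smul_right,
    φ.ip_self]
  rw [ip_conj]
  ring

theorem two_mul_ip_toHyperplane_of_eq_smul {φ : UnitSphere V} {w : V} (hw : w ≠ 0)
    (hφ : w = ip (φ : V) w • (φ : V)) (u v : V) :
    2 * ip (toHyperplane φ ((ip (φ : V) w)⁻¹ • u) : V) (toHyperplane φ ((ip (φ : V) w)⁻¹ • v) : V)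
      = fsForm w u v := by
  have h0 : ip (φ : V) w ≠ 0 := fun h => hw (by rw [hφ, h, zero_smul])
  rw [two_mul_ip_toHyperplane]
  have h1 : (ip (φ : V) w)⁻¹ • w = φ := by
    conv_lhs => rw [hφ, ip_smul_right, φ.ip_self, mul_one, smul_smul, inv_mul_cancel₀ h0, one_smul]
  have h2 := fsForm_smul hw (inv_ne_zero h0) u v
  rwa [h1] at h2

/-- The tensor `H` in the charts of `P(V)`. -/
theorem rep₂_fubiniStudyH [TopologicalSpace V] [IsTopologicalAddGroup V] [ContinuousSMul ℂ V]
    (hip : Continuous fun x : V × V => ip x.1 x.2) (ψ : UnitSphere V) (x u v : hyperplane ψ) :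
    projCharts.rep₂ fubiniStudyH ψ x u v = fsForm ((ψ : V) + x) u v := by
  change 2 * ip ((projCharts.toTan ψ x u : hyperplane _) : V)
    ((projCharts.toTan ψ x v : hyperplane _) : V) = _
  rw [projCharts_toTan hip rfl, projCharts_toTan hip rfl]
  exact two_mul_ip_toHyperplane_of_eq_smul (add_ne_zero_of_mem ψ x)
    (eq_smul_chartIx (add_ne_zero_of_mem ψ x) rfl) u v

theorem imForm_fubiniStudyH :
    (projCharts (V := V)).imForm fubiniStudyH = fubiniStudyΩ := by
  funext p v w
  simp [ChartFamily.imForm, fubiniStudyH, fubiniStudyΩ]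

theorem rep₂_fubiniStudyΩ [TopologicalSpace V] [IsTopologicalAddGroup V] [ContinuousSMul ℂ V]
    (hip : Continuous fun x : V × V => ip x.1 x.2) (ψ : UnitSphere V) (x u v : hyperplane ψ) :
    projCharts.rep₂ fubiniStudyΩ ψ x u v = (fsForm ((ψ : V) + x) u v).im := by
  rw [← imForm_fubiniStudyH, ← rep₂_fubiniStudyH hip]
  rfl

/-- The definition of `H` at `[ψ]` uses a chosen unit vector of that line. Reading it at the origin
of `κ_ψ` for an arbitrary `ψ` shows that the formula is independent of this choice. -/
theorem rep₂_fubiniStudyH_zero [TopologicalSpace V] [IsTopologicalAddGroup V] [ContinuousSMul ℂ V]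
    (hip : Continuous fun x : V × V => ip x.1 x.2) (ψ : UnitSphere V) (v w : hyperplane ψ) :
    projCharts.rep₂ fubiniStudyH ψ 0 v w = 2 * ip (v : V) (w : V) := by
  rw [rep₂_fubiniStudyH hip, Submodule.coe_zero, add_zero, ← two_mul_ip_toHyperplane,
    toHyperplane_coe, toHyperplane_coe]

theorem rep₂_fubiniStudyΩ_zero [TopologicalSpace V] [IsTopologicalAddGroup V] [ContinuousSMul ℂ V]
    (hip : Continuous fun x : V × V => ip x.1 x.2) (ψ : UnitSphere V) (v w : hyperplane ψ) :
    projCharts.rep₂ fubiniStudyΩ ψ 0 v w = 2 * (ip (v : V) (w : V)).im := by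
  have h := congrArg Complex.im (rep₂_fubiniStudyH_zero hip ψ v w)
  simpa [rep₂_fubiniStudyH hip, rep₂_fubiniStudyΩ hip] using h

/-- The derivative of `fsForm` with respect to the base point. -/
def fsDeriv (w z u v : V) : ℂ :=
  2 * (-(ip u v * (ip z w + ip w z)) / ip w w ^ 2
    - (ip u z * ip w v + ip u w * ip z v) / ip w w ^ 2
    + 2 * (ip u w * ip w v * (ip z w + ip w z)) / ip w w ^ 3)

theorem hasDirDeriv_fsForm [TopologicalSpace V] [IsTopologicalAddGroup V] [ContinuousSMul ℂ V]
    (hip : Continuous fun x : V × V => ip x.1 x.2) {w : V} (hw : w ≠ 0) (z u v : V) :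
    HasDirDeriv ℝ (fun y => fsForm y u v) w z (fsDeriv w z u v) := by
  have hs := hasDirDeriv_self w z
  have hc : ∀ a : V, HasDirDeriv ℝ (fun _ : V => a) w z 0 := fun a => hasDirDeriv_const w z a
  have h0 := ip_self_ne_zero hw
  have hN := hasDirDeriv_iff_hasDerivAt.1 (hs.ip' hip hs)
  have hu := hasDirDeriv_iff_hasDerivAt.1 ((hc u).ip' hip hs)
  have hv := hasDirDeriv_iff_hasDerivAt.1 (hs.ip' hip (hc v))
  rw [hasDirDeriv_iff_hasDerivAt]
  have h1 := (((hasDerivAt_const (0 : ℝ) (ip u v)).fun_div hN (by simpa using h0)).fun_sub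
    ((hu.fun_mul hv).fun_div (hN.fun_pow 2) (by simpa using h0))).const_mul 2
  refine h1.congr_deriv ?_
  simp only [ip_zero_left, ip_zero_right, zero_smul, add_zero, zero_add, fsDeriv]
  field_simp
  ring

/-- The derivative inherits the Hermitian symmetry of `fsForm`, so each imaginary part is an
antisymmetrisation in the last two slots divided by `2i`. In the cyclic sum all terms cancel as a
rational identity in the scalar products. -/
theorem fsDeriv_cyclic {w : V} (hw : w ≠ 0) (a u v : V) :
    (fsDeriv w a u v).im + (fsDeriv w u v a).im + (fsDeriv w v a u).im = 0 := by
  have h0 := ip_self_ne_zero hw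
  have hc : ∀ a u v : V, star (fsDeriv w a u v) = fsDeriv w a v u := by
    intro a u v
    simp only [fsDeriv, star_mul', star_add, star_sub, star_neg, star_div₀, star_pow, ip_conj,
      star_ofNat]
    ring
  have h1 : ∀ a u v : V, ((fsDeriv w a u v).im : ℂ) =
      (fsDeriv w a u v - fsDeriv w a v u) / (2 * Complex.I) := by
    intro a u v
    rw [← hc a u v, Complex.im_eq_sub_conj]
    rfl
  rw [← Complex.ofReal_inj]
  push_cast
  rw [h1, h1, h1, ← add_div, ← add_div, div_eq_zero_iff]
  left
  simp only [fsDeriv]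
  field_simp
  ring

end FubiniStudy

/-! ### The Kähler structure of `P(V)` -/

section Kaehler

variable {V : Type*} [AddCommGroup V] [Module ℂ V] [TopologicalSpace V]
  [IsTopologicalAddGroup V] [ContinuousSMul ℂ V] [InnerProductSpace.Core ℂ V]

theorem mbSmoothOn_fsForm (hip : Continuous fun x : V × V => ip x.1 x.2)
    {E : Type u} [AddCommGroup E] [Module ℝ E] [TopologicalSpace E] [ContinuousAdd E]
    [ContinuousSMul ℝ E] {U : Set E} (hU : IsOpen U) {f g h : E → V} (hf : MBSmoothOn ℝ f U)
    (hg : MBSmoothOn ℝ g U) (hh : MBSmoothOn ℝ h U) (h0 : ∀ x ∈ U, f x ≠ 0) :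
    MBSmoothOn ℝ (fun x => fsForm (f x) (g x) (h x)) U := by
  have hN := (MBSmoothOn.ip' hip hU hf hf).complex_inv hU fun x hx => ip_self_ne_zero (h0 x hx)
  have h1 := (MBSmoothOn.ip' hip hU hg hh).complex_mul hU hN
  have h2 := ((MBSmoothOn.ip' hip hU hg hf).complex_mul hU
    (MBSmoothOn.ip' hip hU hf hh)).complex_mul hU (hN.complex_mul hU hN)
  have h3 := (mbSmoothOn_const (2 : ℂ) U).complex_mul hU
    (h1.add ((mbSmoothOn_const (-1 : ℂ) U).complex_mul hU h2))
  refine h3.congr hU fun x _ => ?_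
  simp only [fsForm]
  ring

theorem isSmoothTwoTensor_fubiniStudyH (hip : Continuous fun x : V × V => ip x.1 x.2) :
    (projCharts (V := V)).IsSmoothTwoTensor fubiniStudyH where
  linear_left p w := by
    refine ⟨fun v v' => ?_, fun r v => ?_⟩
    · change 2 * ip ((v : V) + v') (w : V) = 2 * ip (v : V) (w : V) + 2 * ip (v' : V) (w : V)
      rw [ip_add_left, mul_add]
    · change 2 * ip (r • (v : V)) (w : V) = (r : ℂ) * (2 * ip (v : V) (w : V))
      rw [ip_real_smul_left, mul_left_comm]
  linear_right p w := by
    refine ⟨fun v v' => ?_, fun r v => ?_⟩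
    · change 2 * ip (w : V) ((v : V) + v') = 2 * ip (w : V) (v : V) + 2 * ip (w : V) (v' : V)
      rw [ip_add_right, mul_add]
    · change 2 * ip (w : V) (r • (v : V)) = (r : ℂ) * (2 * ip (w : V) (v : V))
      rw [ip_real_smul_right, mul_left_comm]
  smooth ψ := by
    simp only [rep₂_fubiniStudyH hip]
    have hL : ∀ L : hyperplane ψ × hyperplane ψ × hyperplane ψ →L[ℝ] hyperplane ψ,
        MBSmoothOn ℝ (fun x => (L x : V)) (univ ×ˢ univ) := fun L =>
      mbSmoothOn_clm (((hyperplane ψ).subtypeL.restrictScalars ℝ).comp L) _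
    exact mbSmoothOn_fsForm hip (isOpen_univ.prod isOpen_univ)
      ((mbSmoothOn_const (ψ : V) _).add (hL (ContinuousLinearMap.fst ℝ _ _)))
      (hL ((ContinuousLinearMap.fst ℝ _ _).comp (ContinuousLinearMap.snd ℝ _ _)))
      (hL ((ContinuousLinearMap.snd ℝ _ _).comp (ContinuousLinearMap.snd ℝ _ _)))
      fun x _ => add_ne_zero_of_mem ψ x.1

theorem ChartFamily.IsSmoothTwoTensor.imForm {M ι : Type*} [TopologicalSpace M] {E : ι → Type*}
    [∀ i, AddCommGroup (E i)] [∀ i, Module ℝ (E i)] [∀ i, TopologicalSpace (E i)]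
    {A : ChartFamily M E} {H : ∀ p, A.Tan p → A.Tan p → ℂ} (h : A.IsSmoothTwoTensor H) :
    A.IsSmoothTwoTensor (A.imForm H) where
  linear_left p w := by
    refine ⟨fun v v' => ?_, fun r v => ?_⟩
    · exact (congrArg Complex.im ((h.linear_left p w).map_add v v')).trans (Complex.add_im _ _)
    · exact (congrArg Complex.im ((h.linear_left p w).map_smul r v)).trans (Complex.smul_im _ _)
  linear_right p w := by
    refine ⟨fun v v' => ?_, fun r v => ?_⟩
    · exact (congrArg Complex.im ((h.linear_right p w).map_add v v')).trans (Complex.add_im _ _)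
    · exact (congrArg Complex.im ((h.linear_right p w).map_smul r v)).trans (Complex.smul_im _ _)
  smooth i := (h.smooth i).im

theorem isHermitian_fubiniStudyH [LocallyConvexSpace ℝ V]
    (hip : Continuous fun x : V × V => ip x.1 x.2) :
    (projCharts (V := V)).IsHermitian fubiniStudyH where
  manifold := isLCManifold_projCharts hip
  tensor := isSmoothTwoTensor_fubiniStudyH hip
  linear p w := by
    refine ⟨fun v v' => ?_, fun r v => ?_⟩
    · change 2 * ip (w : V) ((v : V) + v') = 2 * ip (w : V) (v : V) + 2 * ip (w : V) (v' : V)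
      rw [ip_add_right, mul_add]
    · change 2 * ip (w : V) (r • (v : V)) = r * (2 * ip (w : V) (v : V))
      rw [ip_smul_right, mul_left_comm]
  conj_symm p v w := by
    rw [fubiniStudyH, fubiniStudyH, star_mul', ip_conj, star_ofNat]
  posDef p v hv := by
    have h : (v : V) ≠ 0 := fun h => hv (Subtype.ext h)
    have := ip_self_pos h
    rw [fubiniStudyH]
    simpa using this

theorem isSymplectic_fubiniStudyΩ [LocallyConvexSpace ℝ V]
    (hip : Continuous fun x : V × V => ip x.1 x.2) :
    (projCharts (V := V)).IsSymplectic fubiniStudyΩ where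
  manifold := (isLCManifold_projCharts hip).restrictScalars
  tensor := by
    rw [← imForm_fubiniStudyH]
    exact (isSmoothTwoTensor_fubiniStudyH hip).imForm
  alternating p v := by
    rw [fubiniStudyΩ, ip_self_eq, Complex.ofReal_im, mul_zero]
  closed ψ x _ a u v := by
    have hd : ∀ a u v : hyperplane ψ,
        dirDeriv ℝ (fun y => projCharts.rep₂ fubiniStudyΩ ψ y u v) x a =
          (fsDeriv ((ψ : V) + x) a u v).im := by
      intro a u v
      refine HasDirDeriv.dirDeriv_eq ((hasDirDeriv_fsForm hip (add_ne_zero_of_mem ψ x)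
        (a : V) u v).im.congr (rep₂_fubiniStudyΩ hip ψ x u v).symm (Eventually.of_forall fun t => ?_))
      rw [rep₂_fubiniStudyΩ hip, Submodule.coe_add, ← add_assoc]
      rfl
    rw [extDeriv₂, hd, hd, hd, fsDeriv_cyclic (add_ne_zero_of_mem ψ x)]
  nondegenerate p v h := by
    by_contra hv
    -- Testing against `i v` gives `Ω(v, i v) = 2 ⟨v, v⟩`.
    have h1 := h (Complex.I • v)
    have h2 : (v : V) ≠ 0 := fun h => hv (Subtype.ext h)
    have h3 := ip_self_pos h2
    rw [fubiniStudyΩ, Submodule.coe_smul, ip_smul_right] at h1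
    simp at h1
    linarith

theorem isKaehler_fubiniStudyH [LocallyConvexSpace ℝ V]
    (hip : Continuous fun x : V × V => ip x.1 x.2) :
    (projCharts (V := V)).IsKaehler fubiniStudyH where
  hermitian := isHermitian_fubiniStudyH hip
  symplectic := by
    rw [imForm_fubiniStudyH]
    exact isSymplectic_fubiniStudyΩ hip

end Kaehler

/-! ### The principal connection on `S(V)` -/

section Connection

variable {V : Type*} [AddCommGroup V] [Module ℂ V] [TopologicalSpace V]
  [IsTopologicalAddGroup V] [ContinuousSMul ℂ V] [InnerProductSpace.Core ℂ V]

theorem sphereα_eq_im (φ : UnitSphere V) (v : (sphereCharts (V := V)).Tan φ) :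
    sphereα φ v = (ip (φ : V) (v : V)).im := by
  simp [sphereα]

theorem im_ip_toRealHyperplane (φ : UnitSphere V) (v : V) :
    (ip (φ : V) (toRealHyperplane φ v : V)).im = (ip (φ : V) v).im := by
  rw [coe_toRealHyperplane, ip_sub_right, ip_smul_right, φ.ip_self, mul_one, Complex.sub_im,
    Complex.ofReal_im, sub_zero]

theorem sphereα_toRealHyperplane (φ : UnitSphere V) (v : V) :
    sphereα φ (toRealHyperplane φ v) = (ip (φ : V) v).im :=
  (sphereα_eq_im φ _).trans (im_ip_toRealHyperplane φ v)

/-- The connection form in the charts of `S(V)`. -/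
theorem rep₁_sphereα (hip : Continuous fun x : V × V => ip x.1 x.2) (ψ : UnitSphere V)
    (x v : realHyperplane ψ) : sphereCharts.rep₁ sphereα ψ x v =
      (ip ((ψ : V) + x) (v : V)).im / (ip ((ψ : V) + x) ((ψ : V) + x)).re := by
  have hw := add_ne_zero_of_re ψ x.2
  refine (sphereα_eq_im _ _).trans ?_
  rw [sphereCharts_toTan hip rfl, im_ip_toRealHyperplane]
  -- The factor `1 / ‖ψ + x‖` occurs twice, once in the base point and once in the tangent vector,
  -- which produces the denominator `⟨w, w⟩`.
  change (ip (((ipNorm ((ψ : V) + x) : ℂ))⁻¹ • ((ψ : V) + x)) _).im = _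
  rw [← Complex.ofReal_inv, ip_smul_right, ip_smul_left, Complex.star_def, Complex.conj_ofReal,
    ← mul_assoc, ← Complex.ofReal_mul, Complex.im_ofReal_mul, ← mul_inv,
    ← sq, ipNorm, Real.sq_sqrt (ip_self_pos hw).le, div_eq_inv_mul]

theorem isSmoothOneForm_sphereα (hip : Continuous fun x : V × V => ip x.1 x.2) :
    (sphereCharts (V := V)).IsSmoothOneForm sphereα where
  linear p := by
    refine ⟨fun v v' => ?_, fun r v => ?_⟩
    · simp only [sphereα_eq_im]
      change (ip (p : V) ((v : V) + v')).im = _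
      rw [ip_add_right, Complex.add_im]
    · simp only [sphereα_eq_im]
      change (ip (p : V) (r • (v : V))).im = r * _
      rw [ip_real_smul_right, Complex.im_ofReal_mul]
  smooth ψ := by
    simp only [rep₁_sphereα hip]
    have hU : IsOpen ((univ : Set (realHyperplane ψ)) ×ˢ (univ : Set (realHyperplane ψ))) :=
      isOpen_univ.prod isOpen_univ
    have hL : ∀ L : realHyperplane ψ × realHyperplane ψ →L[ℝ] realHyperplane ψ,
        MBSmoothOn ℝ (fun x => (L x : V)) (univ ×ˢ univ) := fun L =>
      mbSmoothOn_clm ((realHyperplane ψ).subtypeL.comp L) _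
    have hw := (mbSmoothOn_const (ψ : V) _).add (hL (ContinuousLinearMap.fst ℝ _ _))
    have h1 := (MBSmoothOn.ip' hip hU hw hw).re.inv hU fun x _ =>
      (ip_self_pos (add_ne_zero_of_re ψ x.1.2)).ne'
    refine (h1.smul hU (MBSmoothOn.ip' hip hU hw
      (hL (ContinuousLinearMap.snd ℝ _ _))).im).congr hU fun x _ => ?_
    exact (div_eq_inv_mul _ _).symm

/-- The action is the restriction of the linear isometry `w ↦ z w`, whose tangent map sends `v` to
`z v` up to a real radial term that `α` does not see. -/
theorem sphereα_tangentMap_smul (hip : Continuous fun x : V × V => ip x.1 x.2) (z : Circle)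
    (s : UnitSphere V) (v : (sphereCharts (V := V)).Tan s) :
    sphereα (z • s) (ChartFamily.tangentMap sphereCharts sphereCharts (fun s' => z • s') s v) =
      sphereα s v := by
  have := t2Space_of_ip hip
  have h := hasDirDeriv_toRealHyperplane hip (φ := z • s) one_ne_zero
    (w := (z : ℂ) • (s : V)) (by rw [Complex.ofReal_one, one_smul]; rfl) ((z : ℂ) • (v : V))
  have h0 : sphereCharts.toFun (sphereCharts.chartIx s) s = 0 := sphereCharts_toFun_self s
  have hz : ∀ w : V, w ≠ 0 → (z : ℂ) • w ≠ 0 := fun w hw => smul_ne_zero (Circle.coe_ne_zero z) hw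
  have h1 : ChartFamily.tangentMap sphereCharts sphereCharts (fun s' => z • s') s v =
      toRealHyperplane (z • s) (((1 : ℝ) : ℂ)⁻¹ • (z : ℂ) • (v : V)) := by
    refine HasDirDeriv.dirDeriv_eq (𝕜 := ℝ) (h.congr ?_ (Eventually.of_forall fun t => ?_))
    · rw [h0, show sphereCharts.invFun (sphereCharts.chartIx s) 0 = s from
        sphereCharts_invFun_zero s]
      have h2 := sphereCharts_toFun_unitVec (z • s) (hz _ s.ne_zero)
      rw [← smul_unitVec z s.ne_zero, unitVec_unit] at h2
      exact h2.symm
    · rw [h0, zero_add]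
      have hw := add_ne_zero_of_re s (t • v : realHyperplane s).2
      have h2 := sphereCharts_toFun_unitVec (z • s) (hz _ hw)
      rw [← smul_unitVec z hw, smul_add] at h2
      rw [← smul_comm (z : ℂ) t (v : V)]
      exact h2.symm
  rw [h1]
  refine (sphereα_toRealHyperplane _ _).trans ?_
  rw [sphereα_eq_im, Complex.ofReal_one, inv_one, one_smul, coe_circle_smul, ip_smul_left,
    ip_smul_right, ← mul_assoc, star_circle_mul_self, one_mul]

theorem sphereα_circleField (hip : Continuous fun x : V × V => ip x.1 x.2) (s : UnitSphere V) :
    sphereα s (circleField sphereCharts s) = 1 := by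
  have := t2Space_of_ip hip
  have h1 : HasDerivAt (fun t : ℝ => Complex.exp (t * Complex.I)) Complex.I 0 := by
    have h := ((hasDerivAt_id (0 : ℝ)).ofReal_comp.mul_const Complex.I).cexp
    simpa using h
  have h2 : HasDirDeriv ℝ (fun t : ℝ => Complex.exp (t * Complex.I)) 0 1 Complex.I := by
    rw [hasDirDeriv_iff_hasDerivAt]
    simpa using h1
  -- In the chart at `s` the orbit is the projection of `e^{it} s / cos t`, since `Re ⟨s, e^{it} s⟩
  -- = cos t`; its velocity at zero is the projection of `i s`.
  have h3 := (h2.re.ofReal.complex_inv (by simp)).complex_smul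
    (h2.complex_smul (hasDirDeriv_const (𝕜 := ℝ) (0 : ℝ) 1 (s : V)))
  have h4 := h3.clm_comp (toRealHyperplaneCLM hip s)
  have h5 : circleField sphereCharts s = toRealHyperplane s (Complex.I • (s : V)) := by
    have h6 : (-(Complex.I.re : ℂ) / (Complex.exp ((0 : ℝ) * Complex.I)).re ^ 2) •
        Complex.exp ((0 : ℝ) * Complex.I) • (s : V) +
        (((Complex.exp ((0 : ℝ) * Complex.I)).re : ℂ))⁻¹ •
          (Complex.I • (s : V) + Complex.exp ((0 : ℝ) * Complex.I) • (0 : V)) =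
        Complex.I • (s : V) := by
      simp
    rw [h6] at h4
    have h7 : ∀ t : ℝ, toRealHyperplaneCLM hip s
        (((Complex.exp (t * Complex.I)).re : ℂ)⁻¹ • Complex.exp (t * Complex.I) • (s : V)) =
        sphereCharts.toFun (sphereCharts.chartIx s) (Circle.exp t • s) := by
      intro t
      change _ = toRealHyperplane s ((((ip (s : V) (Circle.exp t • s : UnitSphere V)).re)⁻¹ : ℂ) •
        ((Circle.exp t • s : UnitSphere V) : V))
      rw [coe_circle_smul, Circle.coe_exp, ip_smul_right, s.ip_self, mul_one]
      rfl
    exact HasDirDeriv.dirDeriv_eq (𝕜 := ℝ)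
      (h4.congr (h7 0) (Eventually.of_forall fun t => h7 _))
  rw [h5]
  refine (sphereα_toRealHyperplane _ _).trans ?_
  rw [ip_smul_right, s.ip_self, mul_one, Complex.I_im]

theorem isPrincipalConnection_sphereα (hip : Continuous fun x : V × V => ip x.1 x.2) :
    IsPrincipalConnection (sphereCharts (V := V)) sphereα where
  form := isSmoothOneForm_sphereα hip
  invariant := sphereα_tangentMap_smul hip
  generator := sphereα_circleField hip

/-- The derivative in the direction `u` of the connection form, evaluated on `v`, as a function
of the base point. -/
def connDeriv (w u v : V) : ℝ :=
  ((ip u v).im * (ip w w).re - (ip w v).im * (ip u w + ip w u).re) / (ip w w).re ^ 2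

theorem hasDirDeriv_connection (hip : Continuous fun x : V × V => ip x.1 x.2) {w : V} (hw : w ≠ 0)
    (u v : V) :
    HasDirDeriv ℝ (fun y : V => (ip y v).im / (ip y y).re) w u (connDeriv w u v) := by
  have hs := hasDirDeriv_self w u
  have h0 := (ip_self_pos hw).ne'
  have hN := hasDirDeriv_iff_hasDerivAt.1 (hs.ip' hip hs).re
  have hv := hasDirDeriv_iff_hasDerivAt.1
    (hs.ip' hip (hasDirDeriv_const (𝕜 := ℝ) w u v)).im
  rw [hasDirDeriv_iff_hasDerivAt]
  refine (hv.fun_div hN (by simpa using h0)).congr_deriv ?_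
  simp only [ip_zero_right, zero_smul, add_zero, connDeriv]

/-- After passing to complex numbers, real and imaginary parts are replaced by combinations of `⟨a,
b⟩` and `⟨b, a⟩`. The equality then is a rational identity. -/
theorem connDeriv_sub {w : V} (hw : w ≠ 0) (u v : V) :
    connDeriv w u v - connDeriv w v u = (fsForm w u v).im := by
  have h0 := ip_self_ne_zero hw
  have him : ∀ a b : V, ((ip a b).im : ℂ) = (ip a b - ip b a) / (2 * Complex.I) := by
    intro a b
    rw [← ip_conj a b, Complex.im_eq_sub_conj]
    rfl
  have hre : ∀ a b : V, ((ip a b + ip b a).re : ℂ) = ip a b + ip b a := by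
    intro a b
    refine Complex.conj_eq_iff_re.1 ?_
    change star _ = _
    rw [star_add, ip_conj, ip_conj, add_comm]
  have hfs : ((fsForm w u v).im : ℂ) = (fsForm w u v - fsForm w v u) / (2 * Complex.I) := by
    have h : star (fsForm w u v) = fsForm w v u := by
      simp only [fsForm, star_mul', star_sub, star_div₀, star_pow, ip_conj, star_ofNat]
      ring
    rw [← h, Complex.im_eq_sub_conj]
    rfl
  rw [← Complex.ofReal_inj, hfs]
  simp only [connDeriv]
  push_cast [him]
  have hre' : ∀ a b : V, ((ip a b).re : ℂ) + ((ip b a).re : ℂ) = ip a b + ip b a := by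
    intro a b
    rw [← hre, Complex.add_re, Complex.ofReal_add]
  simp only [Complex.add_re, Complex.ofReal_add, hre', ← ip_self_eq, fsForm]
  field_simp
  ring

theorem pullback₂_fubiniStudyΩ (hip : Continuous fun x : V × V => ip x.1 x.2) (s : UnitSphere V)
    (u v : realHyperplane s) :
    ChartFamily.pullback₂ sphereCharts projCharts sphereProj fubiniStudyΩ s u v =
      (fsForm (s : V) u v).im := by
  change 2 * (ip ((ChartFamily.tangentMap sphereCharts projCharts sphereProj s u :
    hyperplane _) : V) ((ChartFamily.tangentMap sphereCharts projCharts sphereProj s v :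
    hyperplane _) : V)).im = _
  rw [sphereProj_tangentMap hip rfl, sphereProj_tangentMap hip rfl,
    ← two_mul_ip_toHyperplane_of_eq_smul s.ne_zero (eq_smul_chartIx_sphereProj rfl) u v]
  simp

theorem principalCurvature_sphereα (hip : Continuous fun x : V × V => ip x.1 x.2) :
    PrincipalCurvature (sphereCharts (V := V)) projCharts sphereProj sphereα fubiniStudyΩ := by
  intro ψ x _ u v
  have hw := add_ne_zero_of_re ψ x.2
  have hd : ∀ u v : realHyperplane ψ, dirDeriv ℝ (fun y => sphereCharts.rep₁ sphereα ψ y v) x u =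
      connDeriv ((ψ : V) + x) u v := by
    intro u v
    refine HasDirDeriv.dirDeriv_eq ((hasDirDeriv_connection hip hw u v).congr
      (rep₁_sphereα hip ψ x v).symm (Eventually.of_forall fun t => ?_))
    rw [rep₁_sphereα hip, Submodule.coe_add, ← add_assoc]
    rfl
  rw [extDeriv₁, hd, hd, connDeriv_sub hw]
  refine Eq.trans ?_ (pullback₂_fubiniStudyΩ hip (sphereCharts.invFun ψ x) _ _).symm
  -- The tangent vectors differ from the scaled `u` and `v` by multiples of the base point, which
  -- `fsForm` ignores; the common scale `1 / ‖ψ + x‖` of base point and vectors then disappears by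
  -- `fsForm_smul`.
  rw [sphereCharts_toTan hip rfl, sphereCharts_toTan hip rfl, coe_toRealHyperplane,
    coe_toRealHyperplane, sub_eq_add_neg, sub_eq_add_neg, ← neg_smul, ← neg_smul,
    fsForm_add_smul (UnitSphere.ne_zero _)]
  have hn : (ipNorm ((ψ : V) + x) : ℂ)⁻¹ ≠ 0 :=
    inv_ne_zero (Complex.ofReal_ne_zero.2 (ipNorm_pos hw).ne')
  exact congrArg Complex.im (fsForm_smul hw hn u v).symm

end Connection

/-! ### The principal bundle `S(V) → P(V)` -/

theorem circle_exp_arg_pos_mul (z : Circle) {r : ℝ} (hr : 0 < r) :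
    Circle.exp (Complex.arg (r * z)) = z := by
  rw [Complex.arg_real_mul _ hr, Circle.exp_arg]

theorem coe_circle_exp_arg (a : ℂ) : a = ‖a‖ * (Circle.exp (Complex.arg a) : ℂ) := by
  rw [Circle.coe_exp, Complex.norm_mul_exp_arg_mul_I]

theorem circle_exp_arg_eq {a : ℂ} (ha : a ≠ 0) :
    (Circle.exp (Complex.arg a) : ℂ) = ((‖a‖⁻¹ : ℝ) : ℂ) * a := by
  have h0 : (‖a‖ : ℂ) ≠ 0 := Complex.ofReal_ne_zero.2 (norm_ne_zero_iff.2 ha)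
  rw [Complex.ofReal_inv, eq_inv_mul_iff_mul_eq₀ h0]
  exact (coe_circle_exp_arg a).symm

theorem isInducing_circle_coe : Topology.IsInducing ((↑) : Circle → ℂ) :=
  Topology.IsInducing.subtypeVal

/-- Although `arg` jumps across the cut, the phase equals `a / |a|`, which is continuous at every
nonzero `a`. -/
theorem continuousOn_circle_exp_arg :
    ContinuousOn (fun a : ℂ => Circle.exp (Complex.arg a)) {0}ᶜ := by
  refine isInducing_circle_coe.continuousOn_iff.2 ?_
  have h : ContinuousOn (fun a : ℂ => ((‖a‖⁻¹ : ℝ) : ℂ) * a) {0}ᶜ :=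
    (Complex.continuous_ofReal.comp_continuousOn (continuous_norm.continuousOn.inv₀
      fun a ha => norm_ne_zero_iff.2 ha)).mul continuousOn_id
  exact h.congr fun a ha => circle_exp_arg_eq ha

theorem contDiffOn_arg (n : ℕ) : ContDiffOn ℝ n Complex.arg Complex.slitPlane := by
  intro a ha
  have h := (Complex.contDiffAt_log (n := n) ha).restrict_scalars ℝ
  have h1 := ((Complex.imCLM.contDiff.contDiffAt).comp a h).contDiffWithinAt (s := Complex.slitPlane)
  exact h1.congr (fun b _ => (Complex.log_im b).symm) (Complex.log_im a).symm

/-! ### Smoothness of maps into `S(V)`, `P(V)` and `U(1)` -/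

section SmoothCharts

variable {V : Type*} [AddCommGroup V] [Module ℂ V] [TopologicalSpace V]
  [IsTopologicalAddGroup V] [ContinuousSMul ℂ V] [InnerProductSpace.Core ℂ V]
  {E : Type u} [AddCommGroup E] [Module ℝ E] [TopologicalSpace E] [ContinuousAdd E]
  [ContinuousSMul ℝ E]

/-- A map into the sphere need only be given by a smooth nonvanishing lift to `V`, not by the
normalised vector, because the charts ignore positive factors. The next lemma is the same criterion
for arbitrary nonzero factors. -/
theorem MBSmoothOn.sphereCharts_toFun (hip : Continuous fun x : V × V => ip x.1 x.2) {f : E → V}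
    {U : Set E} (hU : IsOpen U) (hf : MBSmoothOn ℝ f U) {g : E → UnitSphere V}
    (hg : ∀ x ∈ U, ∃ h : f x ≠ 0, g x = unitVec (f x) h) (j : UnitSphere V) :
    MBSmoothOn ℝ (fun x => sphereCharts.toFun j (g x)) (U ∩ {x | g x ∈ sphereCharts.source j}) := by
  have hO : IsOpen (U ∩ {x | 0 < (ip (j : V) (f x)).re}) :=
    hf.continuousOn.isOpen_inter_preimage hU (isOpen_re_ip_pos hip (j : V) continuous_id)
  refine (((hf.mono inter_subset_left).toRealHyperplane hip j hO fun x hx => ne_of_gt hx.2).congr hO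
    fun x hx => ?_).mono fun x hx => ⟨hx.1, ?_⟩
  · obtain ⟨h, hgx⟩ := hg x hx.1
    simp only [hgx, sphereCharts_toFun_unitVec]
  · obtain ⟨h, hgx⟩ := hg x hx.1
    have h2 := hx.2
    rw [mem_ofPred_eq, hgx, unitVec_mem_sphereCharts_source] at h2
    exact h2

theorem MBSmoothOn.projCharts_toFun (hip : Continuous fun x : V × V => ip x.1 x.2) {f : E → V}
    {U : Set E} (hU : IsOpen U) (hf : MBSmoothOn ℝ f U) {g : E → ℙ ℂ V}
    (hg : ∀ x ∈ U, ∃ h : f x ≠ 0, g x = Projectivization.mk ℂ (f x) h) (j : UnitSphere V) :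
    MBSmoothOn ℝ (fun x => projCharts.toFun j (g x)) (U ∩ {x | g x ∈ projCharts.source j}) := by
  have hO : IsOpen (U ∩ {x | ip (j : V) (f x) ≠ 0}) :=
    hf.continuousOn.isOpen_inter_preimage hU (isOpen_ip_ne_zero hip (j : V) continuous_id)
  refine (((hf.mono inter_subset_left).toHyperplane_real hip j hO fun x hx => hx.2).congr hO
    fun x hx => ?_).mono fun x hx => ⟨hx.1, ?_⟩
  · obtain ⟨h, hgx⟩ := hg x hx.1
    simp only [hgx, projCharts_toFun_mk]
  · obtain ⟨h, hgx⟩ := hg x hx.1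
    have h2 := hx.2
    rw [mem_ofPred_eq, hgx, mk_mem_projCharts_source] at h2
    exact h2

/-- Since `arg` ignores positive factors, a smooth complex function with the phase of `g` can
replace `g`; dividing by `z` moves the branch cut away from the chart. -/
theorem MBSmoothOn.circleCharts_toFun {f : E → ℂ} {U : Set E} (hU : IsOpen U)
    (hf : MBSmoothOn ℝ f U) {g : E → Circle} (hg : ∀ x ∈ U, ∃ r : ℝ, 0 < r ∧ f x = r * g x)
    (z : Circle) :
    MBSmoothOn ℝ (fun x => circleCharts.toFun z (g x)) (U ∩ {x | g x ∈ circleCharts.source z}) := by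
  have hfz : MBSmoothOn ℝ (fun x => ((z⁻¹ : Circle) : ℂ) * f x) U :=
    (mbSmoothOn_const ((z⁻¹ : Circle) : ℂ) U).complex_mul hU hf
  have hO : IsOpen (U ∩ {x | ((z⁻¹ : Circle) : ℂ) * f x ∈ Complex.slitPlane}) :=
    hfz.continuousOn.isOpen_inter_preimage hU Complex.isOpen_slitPlane
  have key : ∀ x ∈ U, ∃ r : ℝ, 0 < r ∧
      ((z⁻¹ : Circle) : ℂ) * f x = r * ((g x / z : Circle) : ℂ) := by
    intro x hx
    obtain ⟨r, hr, h⟩ := hg x hx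
    refine ⟨r, hr, ?_⟩
    rw [h, div_eq_inv_mul, Circle.coe_mul, mul_left_comm]
  refine ((ContDiffOn.comp_mbSmoothOn contDiffOn_arg Complex.isOpen_slitPlane hO
    (hfz.mono inter_subset_left) fun x hx => hx.2).congr hO fun x hx => ?_).mono
    fun x hx => ⟨hx.1, ?_⟩
  · obtain ⟨r, hr, h⟩ := key x hx.1
    simp only [h, Complex.arg_real_mul _ hr]
    rfl
  · obtain ⟨r, hr, h⟩ := key x hx.1
    have h2 : ((g x / z : Circle) : ℂ) ∈ Complex.slitPlane := hx.2
    rw [mem_ofPred_eq, h, Complex.mem_slitPlane_iff_arg, Complex.arg_real_mul _ hr]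
    rw [Complex.mem_slitPlane_iff_arg] at h2
    exact ⟨h2.1, mul_ne_zero (Complex.ofReal_ne_zero.2 hr.ne') h2.2⟩

theorem MBSmoothOn.circle_exp {f : E → ℝ} {U : Set E} (hU : IsOpen U) (hf : MBSmoothOn ℝ f U) :
    MBSmoothOn ℝ (fun x => ((Circle.exp (f x) : Circle) : ℂ)) U := by
  have h1 : MBSmoothOn ℝ (fun x => (f x : ℂ) * Complex.I) U :=
    hf.ofReal.complex_mul hU (mbSmoothOn_const _ _)
  have h2 := ContDiffOn.comp_mbSmoothOn (φ := Complex.exp) (O := univ)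
    (fun n => (Complex.contDiff_exp (𝕜 := ℝ)).contDiffOn) isOpen_univ hU h1 fun _ _ => mem_univ _
  exact h2.congr hU fun x _ => (Circle.coe_exp _).symm

end SmoothCharts

/-! ### The action, the projection and local trivialisations -/

section Bundle

variable {V : Type*} [AddCommGroup V] [Module ℂ V] [TopologicalSpace V]
  [IsTopologicalAddGroup V] [ContinuousSMul ℂ V] [InnerProductSpace.Core ℂ V]

theorem continuous_circle_smul_unitSphere :
    Continuous fun q : Circle × UnitSphere V => q.1 • q.2 :=
  Continuous.subtype_mk ((isInducing_circle_coe.continuous.comp continuous_fst).smul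
    (continuous_subtype_val.comp continuous_snd)) _

theorem continuous_sphereProj : Continuous (sphereProj (V := V)) :=
  continuous_projectivization_mk continuous_subtype_val _

theorem coe_circle_smul_ne_zero (z : Circle) {w : V} (hw : w ≠ 0) : (z : ℂ) • w ≠ 0 :=
  smul_ne_zero (Circle.coe_ne_zero z) hw

theorem smoothMapOn_circle_smul (hip : Continuous fun x : V × V => ip x.1 x.2) :
    (circleCharts.prod (sphereCharts (V := V))).SmoothMapOn sphereCharts
      (fun q => q.1 • q.2) univ := by
  refine ⟨continuous_circle_smul_unitSphere.continuousOn, fun i j => ?_⟩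
  obtain ⟨z, ψ⟩ := i
  have hf : MBSmoothOn ℝ (fun x : ℝ × realHyperplane ψ =>
      ((z * Circle.exp x.1 : Circle) : ℂ) • ((ψ : V) + x.2)) univ := by
    have h1 := (mbSmoothOn_const (z : ℂ) univ).complex_mul isOpen_univ
      (MBSmoothOn.circle_exp isOpen_univ
        (mbSmoothOn_clm (ContinuousLinearMap.fst ℝ ℝ (realHyperplane ψ)) univ))
    have h2 := (mbSmoothOn_add_coe_real ψ univ).comp_clm
      (ContinuousLinearMap.snd ℝ ℝ (realHyperplane ψ)) (mapsTo_univ _ univ)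
    exact (h1.complex_smul isOpen_univ h2).congr isOpen_univ fun x _ => by
      rw [Circle.coe_mul]
      rfl
  refine (hf.sphereCharts_toFun hip isOpen_univ (fun x _ =>
    ⟨coe_circle_smul_ne_zero _ (add_ne_zero_of_re ψ x.2.2),
      smul_unitVec _ (add_ne_zero_of_re ψ x.2.2) _⟩) j).mono ?_
  exact fun x hx => ⟨mem_univ _, hx.2.2⟩

theorem smoothMapOn_sphereProj (hip : Continuous fun x : V × V => ip x.1 x.2) :
    (sphereCharts (V := V)).SmoothMapOn projCharts sphereProj univ := by
  refine ⟨continuous_sphereProj.continuousOn, fun ψ j => ?_⟩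
  refine ((mbSmoothOn_add_coe_real ψ univ).projCharts_toFun hip isOpen_univ (fun x _ =>
    ⟨add_ne_zero_of_re ψ x.2, sphereProj_invFun ψ x⟩) j).mono ?_
  exact fun x hx => ⟨mem_univ _, hx.2.2⟩

/-- The section `[χ] ↦ (⟨ψ, χ⟩⁻¹ χ) / ‖⟨ψ, χ⟩⁻¹ χ‖` of `S(V) → P(V)`. -/
def sphereSection (ψ : UnitSphere V) (p : ℙ ℂ V) : UnitSphere V :=
  sphereCharts.invFun ψ (hyperplaneIncl ψ (projCharts.toFun ψ p))

theorem sphereSection_mk (ψ : UnitSphere V) {w : V} (hw : w ≠ 0) (h : ip (ψ : V) w ≠ 0) :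
    sphereSection ψ (Projectivization.mk ℂ w hw) =
      unitVec ((ip (ψ : V) w)⁻¹ • w) (smul_ne_zero (inv_ne_zero h) hw) := by
  have h1 : (ψ : V) + (hyperplaneIncl ψ (projCharts.toFun ψ (Projectivization.mk ℂ w hw)) : V) =
      (ip (ψ : V) w)⁻¹ • w := by
    rw [projCharts_toFun_mk]
    exact add_coe_toHyperplane h
  simp only [sphereSection, sphereCharts, h1]

theorem sphereProj_sphereSection {ψ : UnitSphere V} {p : ℙ ℂ V} (hp : p ∈ projCharts.source ψ) :
    sphereProj (sphereSection ψ p) = p := by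
  conv_rhs => rw [← projCharts_left_inv ψ hp]
  exact sphereProj_invFun ψ _

theorem continuousOn_sphereSection (hip : Continuous fun x : V × V => ip x.1 x.2)
    (ψ : UnitSphere V) : ContinuousOn (sphereSection ψ) (projCharts.source ψ) :=
  ((continuous_unitVec hip (continuous_add_coe_real ψ)
    fun v => add_ne_zero_of_re ψ v.2).comp (Continuous.subtype_mk continuous_subtype_val _ :
      Continuous (hyperplaneIncl ψ))).comp_continuousOn (continuousOn_projCharts_toFun hip ψ)

theorem ip_unitVec_right (y : V) {w : V} (hw : w ≠ 0) :
    ip y (unitVec w hw : V) = (((ipNorm w)⁻¹ : ℝ) : ℂ) * ip y w := by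
  rw [coe_unitVec, ip_smul_right, Complex.ofReal_inv]

/-- In every line with `⟨ψ, ·⟩ ≠ 0` there is exactly one unit vector whose product with `ψ` is
positive. It defines the section; `τ` rotates it by `z`, and `ζ` recovers the rotation as the phase
of `⟨ψ, s⟩`. -/
theorem exists_trivialization (hip : Continuous fun x : V × V => ip x.1 x.2) (p : ℙ ℂ V) :
    ∃ U : Set (ℙ ℂ V), IsOpen U ∧ p ∈ U ∧
    ∃ (τ : ℙ ℂ V × Circle → UnitSphere V) (ζ : UnitSphere V → Circle),
      (∀ q ∈ U, ∀ z, sphereProj (τ (q, z)) = q) ∧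
      (∀ q ∈ U, ∀ z w, τ (q, z * w) = z • τ (q, w)) ∧
      (∀ q ∈ U, ∀ z, ζ (τ (q, z)) = z) ∧
      (∀ s, sphereProj s ∈ U → τ (sphereProj s, ζ s) = s) ∧
      (projCharts.prod circleCharts).SmoothMapOn sphereCharts τ (U ×ˢ univ) ∧
      sphereCharts.SmoothMapOn circleCharts ζ (sphereProj ⁻¹' U) := by
  obtain ⟨ψ, hψ⟩ : ∃ ψ : UnitSphere V, p ∈ projCharts.source ψ := ⟨_, mem_source_chartIx p⟩
  have hmem : ∀ s : UnitSphere V, sphereProj s ∈ projCharts.source ψ ↔ ip (ψ : V) s ≠ 0 :=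
    fun s => mk_mem_projCharts_source ψ s.ne_zero
  refine ⟨projCharts.source ψ, isOpen_projCharts_source hip ψ, hψ,
    fun q => q.2 • sphereSection ψ q.1, fun s => Circle.exp (Complex.arg (ip (ψ : V) s)),
    fun q hq z => ?_, fun q hq z w => mul_smul _ _ _, fun q hq z => ?_, fun s hs => ?_,
    ⟨?_, fun i j => ?_⟩, ⟨?_, fun i z => ?_⟩⟩
  · rw [sphereProj_smul, sphereProj_sphereSection hq]
  · induction q with
    | h w hw =>
      have h := (mk_mem_projCharts_source ψ hw).1 hq
      simp only [sphereSection_mk ψ hw h]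
      rw [coe_circle_smul, ip_smul_right, ip_unitVec_right, ip_smul_right, inv_mul_cancel₀ h,
        mul_one, mul_comm]
      exact circle_exp_arg_pos_mul z
        (inv_pos.2 (ipNorm_pos (smul_ne_zero (inv_ne_zero h) hw)))
  · have h := (hmem s).1 hs
    simp only [sphereProj, sphereSection_mk ψ s.ne_zero h]
    have hn : 0 < ‖ip (ψ : V) s‖⁻¹ := inv_pos.2 (norm_pos_iff.2 h)
    -- Multiplying `⟨ψ, s⟩⁻¹ s` by the phase of `⟨ψ, s⟩` leaves a positive multiple of `s`, whose
    -- normalisation is `s`.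
    have h1 : ((Circle.exp (Complex.arg (ip (ψ : V) s)) : Circle) : ℂ) • (ip (ψ : V) s)⁻¹ • (s : V) =
        ((‖ip (ψ : V) s‖⁻¹ : ℝ) : ℂ) • (s : V) := by
      rw [circle_exp_arg_eq h, smul_smul, mul_assoc, mul_inv_cancel₀ h, mul_one]
    have h2 : ((‖ip (ψ : V) s‖⁻¹ : ℝ) : ℂ) • (s : V) ≠ 0 :=
      smul_ne_zero (Complex.ofReal_ne_zero.2 hn.ne') s.ne_zero
    rw [smul_unitVec _ _ (h1 ▸ h2)]
    simp only [h1]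
    rw [unitVec_real_smul hn s.ne_zero, unitVec_unit]
  · exact continuous_circle_smul_unitSphere.comp_continuousOn (continuousOn_snd.prodMk
      ((continuousOn_sphereSection hip ψ).comp continuousOn_fst fun x hx => hx.1))
  · obtain ⟨φ, z⟩ := i
    have hO : IsOpen {x : hyperplane φ × ℝ | ip (ψ : V) ((φ : V) + x.1) ≠ 0} :=
      isOpen_ip_ne_zero hip (ψ : V) ((continuous_add_coe φ).comp continuous_fst)
    have hf : MBSmoothOn ℝ (fun x : hyperplane φ × ℝ => ((z * Circle.exp x.2 : Circle) : ℂ) •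
        (ip (ψ : V) ((φ : V) + x.1))⁻¹ • ((φ : V) + x.1))
        {x : hyperplane φ × ℝ | ip (ψ : V) ((φ : V) + x.1) ≠ 0} := by
      have h1 := (mbSmoothOn_const (z : ℂ) _).complex_mul hO
        (MBSmoothOn.circle_exp hO
          (mbSmoothOn_clm (ContinuousLinearMap.snd ℝ (hyperplane φ) ℝ) _))
      have h2 := ((mbSmoothOn_add_coe φ univ).restrictScalars.comp_clm
        (ContinuousLinearMap.fst ℝ (hyperplane φ) ℝ) (mapsTo_univ _ univ)).mono
        (subset_univ {x : hyperplane φ × ℝ | ip (ψ : V) ((φ : V) + x.1) ≠ 0})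
      have h3 := (MBSmoothOn.ip' hip hO (mbSmoothOn_const (ψ : V) _) h2).complex_inv hO
        fun x hx => hx
      exact (h1.complex_smul hO (h3.complex_smul hO h2)).congr hO fun x _ => by
        rw [Circle.coe_mul]
        rfl
    refine (hf.sphereCharts_toFun hip hO
      (g := fun x => (z * Circle.exp x.2) • sphereSection ψ (projCharts.invFun φ x.1))
      (fun x hx => ?_) j).mono ?_
    · refine ⟨coe_circle_smul_ne_zero _ (smul_ne_zero (inv_ne_zero hx) (add_ne_zero_of_mem φ x.1)),
        ?_⟩
      rw [show projCharts.invFun φ x.1 = Projectivization.mk ℂ _ (add_ne_zero_of_mem φ x.1) from rfl,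
        sphereSection_mk ψ _ hx]
      exact smul_unitVec _ _ _
    · exact fun x hx => ⟨(projCharts_invFun_mem_source φ ψ x.1).1 hx.2.1.1, hx.2.2⟩
  · exact continuousOn_circle_exp_arg.comp
      (continuous_ip hip continuous_const continuous_subtype_val).continuousOn
      fun s hs => (hmem s).1 hs
  · have hO : IsOpen {x : realHyperplane i | ip (ψ : V) ((i : V) + x) ≠ 0} :=
      isOpen_ip_ne_zero hip (ψ : V) (continuous_add_coe_real i)
    have hf := MBSmoothOn.ip' hip hO (mbSmoothOn_const (ψ : V) _) (mbSmoothOn_add_coe_real i _)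
    refine (hf.circleCharts_toFun hO (g := fun x => Circle.exp (Complex.arg
      (ip (ψ : V) (sphereCharts.invFun i x : V)))) (fun x hx => ?_) z).mono ?_
    · have hw := add_ne_zero_of_re i x.2
      -- Normalising `i + x` does not change the phase of its product with `ψ`, so `⟨ψ, i + x⟩`
      -- serves as the smooth function with that phase.
      refine ⟨‖ip (ψ : V) ((i : V) + x)‖, norm_pos_iff.2 hx, ?_⟩
      rw [show sphereCharts.invFun i x = unitVec _ hw from rfl, ip_unitVec_right,
        Complex.arg_real_mul _ (inv_pos.2 (ipNorm_pos hw))]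
      exact coe_circle_exp_arg _
    · refine fun x hx => ⟨?_, hx.2.2⟩
      have h := hx.2.1
      rw [mem_preimage, sphereProj_invFun, mk_mem_projCharts_source] at h
      exact h

theorem isPrincipalCircleBundle_sphereProj [LocallyConvexSpace ℝ V]
    (hip : Continuous fun x : V × V => ip x.1 x.2) :
    IsPrincipalCircleBundle sphereCharts projCharts (sphereProj (V := V)) where
  total := isLCManifold_sphereCharts hip
  base := (isLCManifold_projCharts hip).restrictScalars
  smooth_action := smoothMapOn_circle_smul hip
  smooth_proj := smoothMapOn_sphereProj hip
  locally_trivial := exists_trivialization hip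

end Bundle

/-! ### The connection on the tautological bundle -/

section TautConnection

variable {V : Type*} [AddCommGroup V] [Module ℂ V] [TopologicalSpace V]
  [IsTopologicalAddGroup V] [ContinuousSMul ℂ V] [InnerProductSpace.Core ℂ V]

/-- The section `s` in the chart `ψ`. -/
def localSection (ψ : UnitSphere V) (s : ∀ q, TautFib V q) (x : hyperplane ψ) : ℂ :=
  tautFrames.coord ψ (projCharts.invFun ψ x) (s (projCharts.invFun ψ x))

theorem coe_section_invFun (s : ∀ q, TautFib V q) (ψ : UnitSphere V) (x : hyperplane ψ) :
    (s (projCharts.invFun ψ x) : V) = localSection ψ s x • ((ψ : V) + x) := by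
  obtain ⟨a, ha⟩ := (mem_mk_submodule (add_ne_zero_of_mem ψ x)).1 (s (projCharts.invFun ψ x)).2
  rw [localSection, tautFrames_coord, ← ha, ip_smul_right, ip_add_coe, mul_one]

theorem projCharts_invFun_zero (p : ℙ ℂ V) : projCharts.invFun (projCharts.chartIx p) 0 = p := by
  have h := projCharts_left_inv _ (mem_source_chartIx p)
  rwa [projCharts_toFun_chartIx] at h

theorem coe_section_eq (s : ∀ q, TautFib V q) (p : ℙ ℂ V) :
    (s p : V) = localSection (projCharts.chartIx p) s 0 • (projCharts.chartIx p : V) := by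
  have h := coe_section_invFun s (projCharts.chartIx p) 0
  rwa [projCharts_invFun_zero, Submodule.coe_zero, add_zero] at h

theorem isOpen_preimage_invFun (ψ : UnitSphere V) {U : Set (ℙ ℂ V)} (hU : IsOpen U) :
    IsOpen ((projCharts (V := V)).target ψ ∩ projCharts.invFun ψ ⁻¹' U) :=
  isOpen_univ.inter (hU.preimage (continuous_projCharts_invFun ψ))

theorem zero_mem_preimage_invFun {U : Set (ℙ ℂ V)} {p : ℙ ℂ V} (hp : p ∈ U) :
    (0 : hyperplane (projCharts.chartIx p)) ∈ (projCharts (V := V)).target (projCharts.chartIx p) ∩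
      projCharts.invFun (projCharts.chartIx p) ⁻¹' U :=
  ⟨mem_univ _, by rwa [mem_preimage, projCharts_invFun_zero]⟩

/-- The derivative of `⟨y, y⟩` at `φ` is `2 Re ⟨φ, X⟩ = 0`. Thus normalising vectors does not affect
first derivatives at the centre of a chart. -/
theorem hasDirDeriv_ipNorm (hip : Continuous fun x : V × V => ip x.1 x.2) (φ : UnitSphere V)
    (X : hyperplane φ) :
    HasDirDeriv ℝ (fun y : hyperplane φ => ipNorm ((φ : V) + y)) 0 X 0 := by
  have h1 : HasDirDeriv ℝ (fun y : hyperplane φ => (φ : V) + y) 0 X (0 + X) :=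
    (hasDirDeriv_const _ _ _).add
      (hasDirDeriv_clm ((hyperplane φ).subtypeL.restrictScalars ℝ) 0 X)
  have h2 := (h1.ip' hip h1).re
  rw [hasDirDeriv_iff_hasDerivAt] at h2 ⊢
  have h3 := h2.sqrt (by simp [φ.ip_self])
  refine h3.congr_deriv ?_
  simp [ip_hyperplane, ip_hyperplane_left]

/-- A section in terms of the corresponding function on the sphere. -/
theorem ip_unitVec_section (s : ∀ q, TautFib V q) (φ : UnitSphere V) (y : hyperplane φ) {b : ℂ}
    (hb : star b * b = 1) {w : V} (hw : w ≠ 0) (h : w = b • ((φ : V) + y)) :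
    ip (unitVec w hw : V) (s (sphereProj (unitVec w hw)) : V) =
      star b * ((ipNorm ((φ : V) + y) : ℂ) • localSection φ s y) := by
  have h1 : sphereProj (unitVec w hw) = projCharts.invFun φ y := by
    rw [sphereProj_unitVec]
    exact mk_eq_mk_of_smul _ _ h
  have h0 : (ipNorm ((φ : V) + y) : ℂ) ≠ 0 :=
    Complex.ofReal_ne_zero.2 (ipNorm_pos (add_ne_zero_of_mem φ y)).ne'
  have h2 : ipNorm w = ipNorm ((φ : V) + y) := by
    rw [ipNorm, h, ip_smul_left, ip_smul_right, ← mul_assoc, hb, one_mul, ipNorm]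
  rw [h1, coe_section_invFun, coe_unitVec, h2, h, ip_smul_right, ip_smul_left, ip_smul_left,
    ← ipNorm_sq, ← Complex.ofReal_inv, Complex.star_def, Complex.conj_ofReal, Complex.ofReal_inv,
    smul_eq_mul]
  field_simp

theorem sphereCharts_dFun (g : UnitSphere V → ℂ) (s : UnitSphere V) (Y : realHyperplane s) :
    sphereCharts.dFun g s Y = dirDeriv ℝ (fun y => g (sphereCharts.invFun s y)) 0 Y := by
  rw [← sphereCharts_toFun_self s]
  rfl

/-- In the chart at `p` the function `⟨χ, s([χ])⟩` is `‖φ + y‖` times the coordinate of `s`, and the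
norm is `1` and stationary at `y = 0`. In other words, the frame of the centred chart is parallel at
the centre. -/
theorem coe_tautConnection_of_hasDirDeriv (hip : Continuous fun x : V × V => ip x.1 x.2)
    {p : ℙ ℂ V} {X : (projCharts (V := V)).Tan p} {s : ∀ q, TautFib V q} {d : ℂ}
    (h : HasDirDeriv ℝ (localSection (projCharts.chartIx p) s) 0 X d) :
    (tautConnection p X s : V) = d • (projCharts.chartIx p : V) := by
  set φ : UnitSphere V := projCharts.chartIx p
  refine congrArg (fun a : ℂ => a • (φ : V)) ?_
  have h1 := (hasDirDeriv_ipNorm hip φ X).ofReal.complex_smul h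
  have h2 : ∀ y : hyperplane φ, ((ipNorm ((φ : V) + y) : ℝ) : ℂ) • localSection φ s y =
      ip (sphereCharts.invFun φ (hyperplaneIncl φ y) : V)
        (s (sphereProj (sphereCharts.invFun φ (hyperplaneIncl φ y))) : V) := by
    intro y
    have h3 := ip_unitVec_section s φ y (b := 1) (by simp) (add_ne_zero_of_mem φ y)
      (by rw [one_smul])
    rw [star_one, one_mul] at h3
    exact h3.symm
  have h4 : HasDirDeriv ℝ (fun y : realHyperplane φ => ip (sphereCharts.invFun φ y : V)
      (s (sphereProj (sphereCharts.invFun φ y)) : V)) 0 (hyperplaneIncl φ X) d := by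
    have h5 : ((0 : ℝ) : ℂ) • localSection φ s 0 +
        ((ipNorm ((φ : V) + (0 : hyperplane φ)) : ℝ) : ℂ) • d = d := by
      simp [ipNorm_unit]
    rw [h5] at h1
    refine h1.congr (h2 0) (Eventually.of_forall fun t => (h2 _).trans ?_)
    rw [zero_add, zero_add]
    rfl
  exact (sphereCharts_dFun _ φ _).trans h4.dirDeriv_eq

theorem hasDirDeriv_localSection {U : Set (ℙ ℂ V)} {s : ∀ q, TautFib V q}
    (hs : SmoothSectionOn projCharts tautFrames s U) {p : ℙ ℂ V} (hp : p ∈ U)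
    (X : (projCharts (V := V)).Tan p) :
    HasDirDeriv ℝ (localSection (projCharts.chartIx p) s) 0 X
      (dirDeriv ℝ (localSection (projCharts.chartIx p) s) 0 X) :=
  (hs (projCharts.chartIx p)).hasDirDeriv (zero_mem_preimage_invFun hp) X

theorem coe_tautConnection (hip : Continuous fun x : V × V => ip x.1 x.2) {U : Set (ℙ ℂ V)}
    {s : ∀ q, TautFib V q} (hs : SmoothSectionOn projCharts tautFrames s U) {p : ℙ ℂ V}
    (hp : p ∈ U) (X : (projCharts (V := V)).Tan p) :
    (tautConnection p X s : V) =
      dirDeriv ℝ (localSection (projCharts.chartIx p) s) 0 X • (projCharts.chartIx p : V) :=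
  coe_tautConnection_of_hasDirDeriv hip (hasDirDeriv_localSection hs hp X)

theorem isLinearMap_tautConnection (hip : Continuous fun x : V × V => ip x.1 x.2)
    {U : Set (ℙ ℂ V)} (hU : IsOpen U) {s : ∀ q, TautFib V q}
    (hs : SmoothSectionOn projCharts tautFrames s U) {p : ℙ ℂ V} (hp : p ∈ U) :
    IsLinearMap ℝ (fun X => tautConnection p X s) := by
  have h := MBSmoothOn.isLinearMap_dirDeriv (hs (projCharts.chartIx p))
    (isOpen_preimage_invFun _ hU) (zero_mem_preimage_invFun hp)
  refine ⟨fun X Y => Subtype.ext ?_, fun r X => Subtype.ext ?_⟩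
  · rw [Submodule.coe_add, coe_tautConnection hip hs hp, coe_tautConnection hip hs hp,
      coe_tautConnection hip hs hp, ← add_smul]
    exact congrArg (fun a : ℂ => a • (projCharts.chartIx p : V)) (h.map_add X Y)
  · rw [coe_tautConnection hip hs hp]
    change _ = r • (tautConnection p X s : V)
    rw [coe_tautConnection hip hs hp, ← smul_assoc]
    exact congrArg (fun a : ℂ => a • (projCharts.chartIx p : V)) (h.map_smul r X)

theorem tautConnection_local_eq (hip : Continuous fun x : V × V => ip x.1 x.2)
    {U : Set (ℙ ℂ V)} (hU : IsOpen U) {s s' : ∀ q, TautFib V q}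
    (hs : SmoothSectionOn projCharts tautFrames s U) (h : ∀ q ∈ U, s q = s' q) {p : ℙ ℂ V}
    (hp : p ∈ U) (X : (projCharts (V := V)).Tan p) :
    tautConnection p X s = tautConnection p X s' := by
  refine Subtype.ext ?_
  -- No smoothness is given for `s'`; its directional derivative is obtained from that of `s`, since
  -- their coordinates agree near the point.
  rw [coe_tautConnection hip hs hp, coe_tautConnection_of_hasDirDeriv hip]
  refine (hasDirDeriv_localSection hs hp X).congr_of_eqOn (isOpen_preimage_invFun _ hU)
    (zero_mem_preimage_invFun hp) fun x hx => ?_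
  rw [localSection, localSection, h _ hx.2]

theorem tautConnection_add (hip : Continuous fun x : V × V => ip x.1 x.2)
    {U : Set (ℙ ℂ V)} {s s' : ∀ q, TautFib V q}
    (hs : SmoothSectionOn projCharts tautFrames s U)
    (hs' : SmoothSectionOn projCharts tautFrames s' U) {p : ℙ ℂ V}
    (hp : p ∈ U) (X : (projCharts (V := V)).Tan p) :
    tautConnection p X (fun q => s q + s' q) = tautConnection p X s + tautConnection p X s' := by
  refine Subtype.ext ?_
  rw [Submodule.coe_add, coe_tautConnection hip hs hp, coe_tautConnection hip hs' hp, ← add_smul]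
  refine coe_tautConnection_of_hasDirDeriv hip ?_
  refine ((hasDirDeriv_localSection hs hp X).add (hasDirDeriv_localSection hs' hp X)).congr ?_
    (Eventually.of_forall fun t => ?_)
  all_goals exact (ip_add_right _ _ _).symm

theorem hasDirDeriv_dFun {U : Set (ℙ ℂ V)} {g : ℙ ℂ V → ℂ} (hg : projCharts.SmoothFunOn g U)
    {p : ℙ ℂ V} (hp : p ∈ U) (X : (projCharts (V := V)).Tan p) :
    HasDirDeriv ℝ (fun y => g (projCharts.invFun (projCharts.chartIx p) y)) 0 X
      (projCharts.dFun g p X) := by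
  have h := (hg (projCharts.chartIx p)).hasDirDeriv (zero_mem_preimage_invFun hp) X
  rw [ChartFamily.dFun, projCharts_toFun_chartIx]
  exact h

theorem tautConnection_leibniz (hip : Continuous fun x : V × V => ip x.1 x.2)
    {U : Set (ℙ ℂ V)} {g : ℙ ℂ V → ℂ} (hg : projCharts.SmoothFunOn g U) {s : ∀ q, TautFib V q}
    (hs : SmoothSectionOn projCharts tautFrames s U) {p : ℙ ℂ V} (hp : p ∈ U)
    (X : (projCharts (V := V)).Tan p) :
    tautConnection p X (fun q => g q • s q) =
      projCharts.dFun g p X • s p + g p • tautConnection p X s := by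
  refine Subtype.ext ?_
  rw [Submodule.coe_add, Submodule.coe_smul, Submodule.coe_smul, coe_tautConnection hip hs hp,
    coe_section_eq s p, smul_smul, smul_smul, ← add_smul]
  refine coe_tautConnection_of_hasDirDeriv hip ?_
  have h := (hasDirDeriv_dFun hg hp X).complex_smul (hasDirDeriv_localSection hs hp X)
  rw [projCharts_invFun_zero] at h
  refine h.congr ?_ (Eventually.of_forall fun t => ?_)
  all_goals exact (ip_smul_right _ _ _).symm

theorem localSection_frame (ψ φ : UnitSphere V) (x : hyperplane φ) :
    localSection φ (tautFrames.frame ψ) x = (ip (ψ : V) ((φ : V) + x))⁻¹ := by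
  rw [localSection, tautFrames_coord, coe_tautFrames_frame_invFun, ip_smul_right, ip_add_coe,
    mul_one]

theorem mbSmoothOn_ip_add_coe (hip : Continuous fun x : V × V => ip x.1 x.2) (y : V)
    (φ : UnitSphere V) (U : Set (hyperplane φ)) :
    MBSmoothOn ℝ (fun x : hyperplane φ => ip y ((φ : V) + x)) U :=
  ((mbSmoothOn_add_coe φ U).clm_comp (ipCLM hip y)).restrictScalars

theorem smoothSectionOn_frame (hip : Continuous fun x : V × V => ip x.1 x.2) (ψ : UnitSphere V) :
    SmoothSectionOn projCharts tautFrames (tautFrames.frame ψ) (projCharts.source ψ) := by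
  intro φ
  have h : MBSmoothOn ℝ (localSection φ (tautFrames.frame ψ))
      {x : hyperplane φ | ip (ψ : V) ((φ : V) + x) ≠ 0} :=
    ((mbSmoothOn_ip_add_coe hip (ψ : V) φ _).complex_inv
      (isOpen_ip_ne_zero hip _ (continuous_add_coe φ)) fun x hx => hx).congr
      (isOpen_ip_ne_zero hip _ (continuous_add_coe φ)) fun x _ => (localSection_frame ψ φ x).symm
  exact h.mono fun x hx => (projCharts_invFun_mem_source φ ψ x).1 hx.2

theorem SmoothSectionOn.mono {M ι : Type*} {E : ι → Type*} {Fib : M → Type*}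
    [∀ p, AddCommGroup (Fib p)] [∀ p, Module ℂ (Fib p)] [∀ i, AddCommGroup (E i)]
    [∀ i, Module ℝ (E i)] [∀ i, TopologicalSpace (E i)] [TopologicalSpace M]
    {A : ChartFamily M E} {D : LineFrames ι Fib} {s : ∀ p, Fib p} {U U' : Set M}
    (h : SmoothSectionOn A D s U) (hU : U' ⊆ U) : SmoothSectionOn A D s U' :=
  fun i => (h i).mono (inter_subset_inter_right _ (preimage_mono hU))

theorem smoothFunOn_coord (hip : Continuous fun x : V × V => ip x.1 x.2) {U : Set (ℙ ℂ V)}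
    (hU : IsOpen U) {s : ∀ q, TautFib V q} (hs : SmoothSectionOn projCharts tautFrames s U)
    (ψ : UnitSphere V) : projCharts.SmoothFunOn (fun q => ip (ψ : V) (s q : V)) U := by
  intro φ
  have hO := isOpen_preimage_invFun φ hU
  refine ((hs φ).complex_mul hO (mbSmoothOn_ip_add_coe hip (ψ : V) φ _)).congr hO fun x _ => ?_
  change localSection φ s x * _ = ip (ψ : V) (s (projCharts.invFun φ x) : V)
  rw [coe_section_invFun, ip_smul_right]

/-- With `b = ⟨φ, ψ + x⟩` one has `ψ + x = b φ`, and `⟨ψ, ψ + x⟩ = 1` gives `⟨ψ, φ⟩ = 1 / b`. The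
tangent vector is `b⁻¹ (v - ⟨φ, v⟩ φ)`, and `⟨ψ, v⟩ = 0`. -/
theorem ip_toTan (hip : Continuous fun x : V × V => ip x.1 x.2) (ψ : UnitSphere V)
    (x v : hyperplane ψ) {φ : UnitSphere V} (hφ : φ = projCharts.chartIx (projCharts.invFun ψ x)) :
    ip (φ : V) ((ψ : V) + x) ≠ 0 ∧ ip (ψ : V) (φ : V) = (ip (φ : V) ((ψ : V) + x))⁻¹ ∧
    ip (ψ : V) ((projCharts.toTan ψ x v : hyperplane _) : V) =
      -(ip (φ : V) (v : V) * (ip (φ : V) ((ψ : V) + x))⁻¹ ^ 2) := by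
  have hw := add_ne_zero_of_mem ψ x
  have h1 : (ψ : V) + x = ip (φ : V) ((ψ : V) + x) • (φ : V) := eq_smul_chartIx hw hφ
  have h0 : ip (φ : V) ((ψ : V) + x) ≠ 0 := fun h => hw (by rw [h1, h, zero_smul])
  have h2 : ip (ψ : V) (φ : V) = (ip (φ : V) ((ψ : V) + x))⁻¹ := by
    have h3 := ip_add_coe ψ x
    rw [h1, ip_smul_right] at h3
    exact eq_inv_of_mul_eq_one_right h3
  refine ⟨h0, h2, ?_⟩
  rw [projCharts_toTan hip hφ, coe_toHyperplane, ip_sub_right, ip_smul_right, ip_smul_right,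
    ip_smul_right, ip_hyperplane, h2]
  ring

/-- In the centred chart `φ` the frame `e_ψ` has coordinate `1 / ⟨ψ, φ + y⟩`, whose derivative at
zero is `⟨φ, v⟩` by `ip_toTan`. Returning to the frame `ψ` multiplies by `⟨ψ, φ⟩ = 1 / b`, and `⟨φ,
v⟩ / b` is the stated quotient because `ψ + x = b φ`. -/
theorem connectionForm_tautConnection (hip : Continuous fun x : V × V => ip x.1 x.2)
    (ψ : UnitSphere V) (x v : hyperplane ψ) :
    connectionForm projCharts tautFrames tautConnection ψ x v =
      ip ((ψ : V) + x) (v : V) / ip ((ψ : V) + x) ((ψ : V) + x) := by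
  set φ : UnitSphere V := projCharts.chartIx (projCharts.invFun ψ x) with hφ
  obtain ⟨h0, h1, h2⟩ := ip_toTan hip ψ x v hφ
  have h3 : (ψ : V) + x = ip (φ : V) ((ψ : V) + x) • (φ : V) :=
    eq_smul_chartIx (add_ne_zero_of_mem ψ x) hφ
  set X : hyperplane φ := projCharts.toTan ψ x v
  have h4 : HasDirDeriv ℝ (fun y : hyperplane φ => (φ : V) + y) 0 X (0 + X) :=
    (hasDirDeriv_const _ _ _).add
      (hasDirDeriv_clm ((hyperplane φ).subtypeL.restrictScalars ℝ) 0 X)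
  have h5 := ((hasDirDeriv_const (𝕜 := ℝ) (0 : hyperplane φ) X (ψ : V)).ip' hip h4).complex_inv
    (by rw [Submodule.coe_zero, add_zero, h1]; exact inv_ne_zero h0)
  have h6 : HasDirDeriv ℝ (localSection φ (tautFrames.frame ψ)) 0 X _ :=
    h5.congr (localSection_frame ψ φ 0).symm
      (Eventually.of_forall fun t => (localSection_frame ψ φ _).symm)
  have h7 := coe_tautConnection_of_hasDirDeriv hip (p := projCharts.invFun ψ x) h6
  rw [connectionForm, tautFrames_coord, h7, ip_smul_right]
  change _ * ip (ψ : V) (φ : V) = _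
  rw [ip_zero_left, Submodule.coe_zero, add_zero, zero_add, zero_add, h2, h1]
  generalize ip (φ : V) ((ψ : V) + x) = b at h0 h3
  rw [h3, ip_smul_left, ip_smul_left, ip_smul_right, φ.ip_self]
  have hb : star b ≠ 0 := star_ne_zero.2 h0
  field_simp

end TautConnection

/-! ### The prequantum structure of `L(V)` -/

section Prequantum

variable {V : Type*} [AddCommGroup V] [Module ℂ V] [TopologicalSpace V]
  [IsTopologicalAddGroup V] [ContinuousSMul ℂ V] [InnerProductSpace.Core ℂ V]

/-- The line `t ↦ φ + t X` in the chart `ψ`, where `X` is the tangent vector given by `v` in this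
chart. -/
theorem hasDirDeriv_transition (hip : Continuous fun x : V × V => ip x.1 x.2) (ψ : UnitSphere V)
    (x v : hyperplane ψ) {φ : UnitSphere V}
    (hφ : φ = projCharts.chartIx (projCharts.invFun ψ x)) {X : hyperplane φ}
    (hX : (X : V) = ((projCharts.toTan ψ x v : hyperplane _) : V)) :
    HasDirDeriv ℝ (fun y => projCharts.toFun ψ (projCharts.invFun φ y)) 0 X v := by
  obtain ⟨h0, h1, h2⟩ := ip_toTan hip ψ x v hφ
  have h3 : HasDirDeriv ℝ (fun y : hyperplane φ => (φ : V) + y) 0 X (0 + X) :=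
    (hasDirDeriv_const _ _ _).add
      (hasDirDeriv_clm ((hyperplane φ).subtypeL.restrictScalars ℝ) 0 X)
  have h4 := ((hasDirDeriv_const (𝕜 := ℝ) (0 : hyperplane φ) X (ψ : V)).ip' hip h3).complex_inv
    (by rw [Submodule.coe_zero, add_zero, h1]; exact inv_ne_zero h0)
  have h5 := (h4.complex_smul h3).clm_comp ((toHyperplaneCLM hip ψ).restrictScalars ℝ)
  have h6 := h5.congr (g := fun y => projCharts.toFun ψ (projCharts.invFun φ y)) (y := 0) (u := X)
    (projCharts_toFun_invFun φ ψ 0).symm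
    (Eventually.of_forall fun t => (projCharts_toFun_invFun φ ψ _).symm)
  convert h6 using 1
  -- Writing `v` as its own projection reduces the claim to an identity in `V`: the derivative
  -- before projection is `⟨φ, v⟩ φ + (v - ⟨φ, v⟩ φ)`.
  rw [← toHyperplane_coe ψ v]
  refine congrArg (toHyperplane ψ) ?_
  rw [ip_zero_left, zero_add, zero_add, Submodule.coe_zero, add_zero, hX, h2, h1,
    projCharts_toTan hip hφ, coe_toHyperplane, ip_smul_right]
  generalize ip (φ : V) ((ψ : V) + x) = b at h0
  generalize ip (φ : V) (v : V) = c
  rw [inv_inv, smul_sub, smul_smul, smul_smul, mul_inv_cancel₀ h0, one_smul, add_sub, eq_sub_iff_add_eq,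
    add_comm]
  congr 2
  field_simp

/-- The differential is defined by a straight line in the centred chart. In the chart `ψ` that line
is only a curve with velocity `v`, so the chain rule along curves is needed to compare the two
derivatives. -/
theorem dFun_toTan (hip : Continuous fun x : V × V => ip x.1 x.2) {U : Set (ℙ ℂ V)} (hU : IsOpen U)
    {g : ℙ ℂ V → ℂ} (hg : projCharts.SmoothFunOn g U) (ψ : UnitSphere V) {x : hyperplane ψ}
    (hx : projCharts.invFun ψ x ∈ U) (v : hyperplane ψ) :
    projCharts.dFun g (projCharts.invFun ψ x) (projCharts.toTan ψ x v) =
      dirDeriv ℝ (fun y => g (projCharts.invFun ψ y)) x v := by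
  set φ : UnitSphere V := projCharts.chartIx (projCharts.invFun ψ x) with hφ
  set X : hyperplane φ := projCharts.toTan ψ x v with hX
  have h1 := hasDirDeriv_transition hip ψ x v hφ (X := X) rfl
  have h2 := (hg ψ).hasDirDeriv (x := x) ⟨mem_univ _, hx⟩ v
  have h3 : projCharts.toFun ψ (projCharts.invFun φ 0) = x := by
    rw [hφ, projCharts_invFun_zero, projCharts_right_inv]
  have h4 := (hg ψ 1).tendsto_slope_curve (isOpen_preimage_invFun ψ hU) ⟨mem_univ _, hx⟩ h2
    (γ := fun t => projCharts.toFun ψ (projCharts.invFun φ (0 + t • X)))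
    (by simpa only [HasDirDeriv, h3] using h1)
  refine (hasDirDeriv_dFun hg hx _).unique (Tendsto.congr' ?_ h4)
  -- For small `t` the line stays in the domain of `κ_ψ`, so passing through that chart does not
  -- change its points.
  have h5 : ∀ᶠ t in 𝓝[≠] (0 : ℝ), (0 : hyperplane φ) + t • X ∈
      projCharts.invFun φ ⁻¹' projCharts.source ψ := by
    refine eventually_add_smul_mem ((isOpen_projCharts_source hip ψ).preimage
      (continuous_projCharts_invFun φ)) ?_ X
    rw [mem_preimage, hφ, projCharts_invFun_zero]
    exact projCharts_invFun_mem_source_self ψ x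
  filter_upwards [h5] with t ht
  rw [projCharts_left_inv ψ ht, projCharts_invFun_zero]

/-- The definition of `∇` at a point uses a chart chosen for that point, with no regularity of the
choice. In the fixed frame `e_ψ` a section is `s = s_ψ e_ψ`, and the Leibniz rule gives the
coordinate `ds_ψ(v) + s_ψ θ_ψ(v)`, which is smooth in both variables. -/
theorem tautConnection_smooth (hip : Continuous fun x : V × V => ip x.1 x.2) {U : Set (ℙ ℂ V)}
    (hU : IsOpen U) {s : ∀ q, TautFib V q} (hs : SmoothSectionOn projCharts tautFrames s U)
    (ψ : UnitSphere V) :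
    MBSmoothOn ℝ (fun x : hyperplane ψ × hyperplane ψ =>
      tautFrames.coord ψ (projCharts.invFun ψ x.1)
        (tautConnection (projCharts.invFun ψ x.1) (projCharts.toTan ψ x.1 x.2) s))
      ((projCharts.target ψ ∩ projCharts.invFun ψ ⁻¹' U) ×ˢ univ) := by
  have hO := isOpen_preimage_invFun ψ hU
  have hO' := hO.prod (isOpen_univ (X := hyperplane ψ))
  have h1 := MBSmoothOn.dirDeriv hO (hs ψ)
  have h2 := MBSmoothOn.comp_clm (hs ψ) (ContinuousLinearMap.fst ℝ (hyperplane ψ) (hyperplane ψ))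
    (U' := (projCharts.target ψ ∩ projCharts.invFun ψ ⁻¹' U) ×ˢ univ) fun x hx => hx.1
  have hw := (mbSmoothOn_add_coe ψ univ).restrictScalars.comp_clm
    (ContinuousLinearMap.fst ℝ (hyperplane ψ) (hyperplane ψ))
    (U' := (projCharts.target ψ ∩ projCharts.invFun ψ ⁻¹' U) ×ˢ univ) fun x hx => mem_univ _
  have hv := mbSmoothOn_clm ((((hyperplane ψ).subtypeL.restrictScalars ℝ)).comp
    (ContinuousLinearMap.snd ℝ (hyperplane ψ) (hyperplane ψ)))
    ((projCharts.target ψ ∩ projCharts.invFun ψ ⁻¹' U) ×ˢ univ)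
  have h3 := (MBSmoothOn.ip' hip hO' hw hv).complex_mul hO'
    ((MBSmoothOn.ip' hip hO' hw hw).complex_inv hO'
      fun x _ => ip_self_ne_zero (add_ne_zero_of_mem ψ x.1))
  refine (h1.add (h2.complex_mul hO' h3)).congr hO' fun x hx => ?_
  obtain ⟨x, v⟩ := x
  have hxU : projCharts.invFun ψ x ∈ U := hx.1.2
  have hxψ := projCharts_invFun_mem_source_self ψ x
  have hUψ := hU.inter (isOpen_projCharts_source hip ψ)
  -- The expansion of `s` in the frame holds only on the domain of `κ_ψ`; locality of `∇` makes this
  -- enough.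
  have hloc : tautConnection (projCharts.invFun ψ x) (projCharts.toTan ψ x v) s =
      tautConnection (projCharts.invFun ψ x) (projCharts.toTan ψ x v)
        (fun q => ip (ψ : V) (s q : V) • tautFrames.frame ψ q) :=
    tautConnection_local_eq hip hUψ (hs.mono inter_subset_left)
      (fun q hq => Subtype.ext (coord_smul_frame hq.2 (s q)).symm) ⟨hxU, hxψ⟩ _
  have hg := smoothFunOn_coord hip hU hs ψ
  change _ = ip (ψ : V) (tautConnection (projCharts.invFun ψ x) (projCharts.toTan ψ x v) s : V)
  rw [hloc, tautConnection_leibniz hip (U := U ∩ projCharts.source ψ)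
    (fun φ => (hg φ).mono (inter_subset_inter_right _ (preimage_mono inter_subset_left)))
    ((smoothSectionOn_frame hip ψ).mono inter_subset_right) ⟨hxU, hxψ⟩, dFun_toTan hip hU hg ψ hxU,
    Submodule.coe_add, ip_add_right (ψ : V), Submodule.coe_smul, Submodule.coe_smul,
    ip_smul_right (ψ : V), ip_smul_right (ψ : V), coe_tautFrames_frame_invFun_self, ip_add_coe, mul_one]
  refine congrArg₂ (· + ·) rfl (congrArg₂ (· * ·) rfl ?_)
  exact ((connectionForm_tautConnection hip ψ x v).trans (div_eq_mul_inv _ _)).symm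

theorem isConnection_tautConnection (hip : Continuous fun x : V × V => ip x.1 x.2) :
    IsConnection (projCharts (V := V)) tautFrames tautConnection where
  linear _ _ hU hs _ hp := isLinearMap_tautConnection hip hU hs hp
  local_eq _ _ _ hU hs h _ hp X := tautConnection_local_eq hip hU hs h hp X
  add _ _ _ _ hs hs' _ hp X := tautConnection_add hip hs hs' hp X
  leibniz _ _ _ _ hg hs _ hp X := tautConnection_leibniz hip hg hs hp X
  smooth _ _ hU hs ψ := tautConnection_smooth hip hU hs ψ

theorem isHermitianMetric_tautMetric (hip : Continuous fun x : V × V => ip x.1 x.2) :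
    IsHermitianMetric (projCharts (V := V)) tautFrames tautMetric where
  linear p l := ⟨fun m m' => ip_add_right _ _ _, fun a m => ip_smul_right _ _ _⟩
  conj_symm p l m := (ip_conj _ _).symm
  posDef p l hl := ip_self_pos fun h => hl (Subtype.ext h)
  smooth ψ φ := by
    have hO := isOpen_ip_ne_zero hip (ψ : V) (continuous_add_coe φ)
    have h1 := ((mbSmoothOn_ip_add_coe hip (ψ : V) φ _).complex_inv hO fun x hx => hx).complex_smul
      hO (mbSmoothOn_add_coe φ _).restrictScalars
    refine ((MBSmoothOn.ip' hip hO h1 h1).congr hO fun x _ => ?_).mono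
      fun x hx => (projCharts_invFun_mem_source φ ψ x).1 hx.2
    change _ = ip (tautFrames.frame ψ (projCharts.invFun φ x) : V)
      (tautFrames.frame ψ (projCharts.invFun φ x) : V)
    rw [coe_tautFrames_frame_invFun]

/-- Near `p` the section is its coordinate times `φ + y`. The product rule splits its derivative in
`V` into `∇_X s` on the line of `φ` and a multiple of `X` orthogonal to it; in the metric identity
the orthogonal parts contribute nothing. -/
theorem hasDirDeriv_section (hip : Continuous fun x : V × V => ip x.1 x.2) {U : Set (ℙ ℂ V)}
    {s : ∀ q, TautFib V q} (hs : SmoothSectionOn projCharts tautFrames s U) {p : ℙ ℂ V}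
    (hp : p ∈ U) (X : (projCharts (V := V)).Tan p) :
    HasDirDeriv ℝ (fun y => (s (projCharts.invFun (projCharts.chartIx p) y) : V)) 0 X
      ((tautConnection p X s : V) +
        localSection (projCharts.chartIx p) s 0 • (X : V)) := by
  set φ : UnitSphere V := projCharts.chartIx p
  have h3 : HasDirDeriv ℝ (fun y : hyperplane φ => (φ : V) + y) 0 X (0 + (X : V)) :=
    (hasDirDeriv_const _ _ _).add
      (hasDirDeriv_clm ((hyperplane φ).subtypeL.restrictScalars ℝ) 0 X)
  have h4 := (hasDirDeriv_localSection hs hp X).complex_smul h3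
  rw [Submodule.coe_zero, add_zero, zero_add, ← coe_tautConnection hip hs hp] at h4
  exact h4.congr (coe_section_invFun s φ 0).symm
    (Eventually.of_forall fun t => (coe_section_invFun s φ _).symm)

theorem isMetricConnection_tautConnection (hip : Continuous fun x : V × V => ip x.1 x.2) :
    IsMetricConnection (projCharts (V := V)) tautFrames tautMetric tautConnection := by
  intro U s s' _ hs hs' p hp X
  have h := (hasDirDeriv_section hip hs hp X).ip' hip (hasDirDeriv_section hip hs' hp X)
  rw [ChartFamily.dFun, projCharts_toFun_chartIx]
  refine (HasDirDeriv.dirDeriv_eq (𝕜 := ℝ) h).trans ?_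
  rw [projCharts_invFun_zero]
  have hX : ip (projCharts.chartIx p : V) (X : V) = 0 := ip_hyperplane X
  have hX' : ip (X : V) (projCharts.chartIx p : V) = 0 := ip_hyperplane_left X
  rw [ip_add_left, ip_add_right, ip_smul_left, ip_smul_right]
  simp only [tautMetric]
  rw [coe_section_eq s p, coe_section_eq s' p, ip_smul_right (X : V), ip_smul_left _ (X : V), hX, hX']
  simp

/-- The derivative in the direction `u` of `⟨w, v⟩ / ⟨w, w⟩` with respect to `w`. -/
def tautConnDeriv (w u v : V) : ℂ :=
  (ip u v * ip w w - ip w v * (ip u w + ip w u)) / ip w w ^ 2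

theorem hasDirDeriv_tautConnection (hip : Continuous fun x : V × V => ip x.1 x.2) {w : V}
    (hw : w ≠ 0) (u v : V) :
    HasDirDeriv ℝ (fun y : V => ip y v / ip y y) w u (tautConnDeriv w u v) := by
  have hs := hasDirDeriv_self w u
  have hN := hasDirDeriv_iff_hasDerivAt.1 (hs.ip' hip hs)
  have hv := hasDirDeriv_iff_hasDerivAt.1 (hs.ip' hip (hasDirDeriv_const (𝕜 := ℝ) w u v))
  rw [hasDirDeriv_iff_hasDerivAt]
  refine (hv.fun_div hN (by simpa using ip_self_ne_zero hw)).congr_deriv ?_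
  simp only [ip_zero_right, zero_smul, add_zero, tautConnDeriv]

/-- The real part of `⟨w, v⟩ / ⟨w, w⟩` is `½ d log ⟨w, w⟩`, so only the imaginary part has
curvature. Algebraically, `i Im z` is half of `z` minus its conjugate, and conjugation exchanges `u`
and `v` in `fsForm`. -/
theorem tautConnDeriv_sub {w : V} (hw : w ≠ 0) (u v : V) :
    tautConnDeriv w u v - tautConnDeriv w v u = Complex.I * ((fsForm w u v).im : ℝ) := by
  have h0 := ip_self_ne_zero hw
  have h : star (fsForm w u v) = fsForm w v u := by
    simp only [fsForm, star_mul', star_sub, star_div₀, star_pow, ip_conj, star_ofNat]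
    ring
  have hfs : Complex.I * ((fsForm w u v).im : ℂ) = (fsForm w u v - fsForm w v u) / 2 := by
    rw [← h, Complex.im_eq_sub_conj]
    change _ = (_ - (starRingEnd ℂ) _) / 2
    field_simp
  rw [hfs]
  simp only [tautConnDeriv, fsForm]
  field_simp
  ring

theorem lineBundleCurvature_tautConnection (hip : Continuous fun x : V × V => ip x.1 x.2) :
    LineBundleCurvature (projCharts (V := V)) tautFrames tautConnection fubiniStudyΩ := by
  intro ψ x _ u v
  have hw := add_ne_zero_of_mem ψ x
  have hd : ∀ u v : hyperplane ψ,
      dirDeriv ℝ (fun y => connectionForm projCharts tautFrames tautConnection ψ y v) x u =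
        tautConnDeriv ((ψ : V) + x) u v := by
    intro u v
    refine HasDirDeriv.dirDeriv_eq ((hasDirDeriv_tautConnection hip hw u v).congr
      (connectionForm_tautConnection hip ψ x v).symm (Eventually.of_forall fun t => ?_))
    rw [connectionForm_tautConnection hip, Submodule.coe_add, ← add_assoc]
    rfl
  rw [extDeriv₁, hd, hd, tautConnDeriv_sub hw, rep₂_fubiniStudyΩ hip]

theorem isPrequantum_tautConnection [LocallyConvexSpace ℝ V]
    (hip : Continuous fun x : V × V => ip x.1 x.2) :
    IsPrequantum (projCharts (V := V)) tautFrames tautMetric tautConnection fubiniStudyΩ where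
  symplectic := isSymplectic_fubiniStudyΩ hip
  bundle := isLineBundle_tautFrames_real hip
  metric := isHermitianMetric_tautMetric hip
  connection := isConnection_tautConnection hip
  metric_connection := isMetricConnection_tautConnection hip
  curvature := lineBundleCurvature_tautConnection hip

/-! ### The tautological bundle as an associated bundle -/

theorem MBSmoothOn.inv_ipNorm (hip : Continuous fun x : V × V => ip x.1 x.2) {E : Type u}
    [AddCommGroup E] [Module ℝ E] [TopologicalSpace E] [ContinuousAdd E] [ContinuousSMul ℝ E]
    {f : E → V} {U : Set E} (hU : IsOpen U) (hf : MBSmoothOn ℝ f U) (h0 : ∀ x ∈ U, f x ≠ 0) :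
    MBSmoothOn ℝ (fun x => (ipNorm (f x))⁻¹) U :=
  (ContDiffOn.comp_mbSmoothOn (φ := Real.sqrt) (O := {0}ᶜ)
    (fun _ _ hr => (Real.contDiffAt_sqrt hr).contDiffWithinAt) isOpen_compl_singleton hU
    (MBSmoothOn.ip' hip hU hf hf).re fun x hx => (ip_self_pos (h0 x hx)).ne').inv hU
    fun x hx => (ipNorm_pos (h0 x hx)).ne'

theorem isAssociatedBundle_tautVec (hip : Continuous fun x : V × V => ip x.1 x.2) :
    IsAssociatedBundle (sphereCharts (V := V)) projCharts tautFrames sphereProj tautVec where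
  smooth := by
    refine ⟨(continuous_induced_rng.2
      (continuous_sphereProj.prodMk continuous_subtype_val)).continuousOn, fun ψ j => ?_⟩
    have hw := mbSmoothOn_add_coe_real ψ univ
    have h1 := hw.projCharts_toFun hip isOpen_univ (g := fun x => sphereProj (sphereCharts.invFun ψ x))
      (fun x _ => ⟨add_ne_zero_of_re ψ x.2, sphereProj_invFun ψ x⟩) j
    have h2 : MBSmoothOn ℝ (fun x : realHyperplane ψ =>
        ip (j : V) (sphereCharts.invFun ψ x : V)) univ := by
      refine ((MBSmoothOn.inv_ipNorm hip isOpen_univ hw fun x _ =>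
        add_ne_zero_of_re ψ x.2).ofReal.complex_mul isOpen_univ (MBSmoothOn.ip' hip isOpen_univ
        (mbSmoothOn_const (j : V) _) hw)).congr isOpen_univ fun x _ => ?_
      exact (ip_unitVec_right (j : V) (add_ne_zero_of_re ψ x.2)).symm
    exact (h1.mono fun x hx => ⟨mem_univ _, hx.2.2⟩).prodMk (h2.mono (subset_univ _))
  equivariant z s := tautTotalSpace_ext (sphereProj_smul z s) rfl
  basis s l := by
    obtain ⟨a, ha⟩ := (mem_mk_submodule s.ne_zero).1 l.2
    refine ⟨a, Subtype.ext ha.symm, fun b hb => ?_⟩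
    have h : b • (s : V) = a • (s : V) := (congrArg Subtype.val hb).symm.trans ha.symm
    exact smul_left_injective ℂ s.ne_zero h

/-- The given `s` and the chosen unit vector `φ` of its line differ by a phase, `s = b φ`, and a
horizontal `Y` is `b X` with `X` its projection. Along `s + t Y = b (φ + t X)` the function `f` is
`b̄ ‖φ + t X‖` times the coordinate of `σ`; with `d` the derivative of that coordinate, `f` has
derivative `b̄ d`, and `b̄ d s = d φ`. -/
theorem isAssociatedConnection_tautConnection (hip : Continuous fun x : V × V => ip x.1 x.2) :
    IsAssociatedConnection (sphereCharts (V := V)) projCharts tautFrames sphereProj tautVec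
      sphereα tautConnection := by
  intro U σ f _ hσ hf s hs Y hY
  have hf' : ∀ χ : UnitSphere V, f χ = ip (χ : V) (σ (sphereProj χ) : V) := by
    intro χ
    rw [hf χ, Submodule.coe_smul, ip_smul_right]
    change _ = _ * ip (χ : V) (χ : V)
    rw [χ.ip_self, mul_one]
  -- Tangency to the sphere removes the real part and horizontality the imaginary part, so `Y` is
  -- orthogonal to the complex line of `s`, and the projection in the tangent map leaves it
  -- unchanged.
  have hY0 : ip (s : V) (Y : V) = 0 := by
    rw [sphereα_eq_im] at hY
    exact Complex.ext (re_ip_realHyperplane Y) hY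
  set φ : UnitSphere V := projCharts.chartIx (sphereProj s) with hφ
  set b := ip (φ : V) (s : V) with hb
  have hsφ : (s : V) = b • (φ : V) := eq_smul_chartIx_sphereProj hφ
  have hbb : star b * b = 1 := by
    have h := s.ip_self
    rw [hsφ, ip_smul_left, ip_smul_right, φ.ip_self, mul_one] at h
    exact h
  have hb0 : b ≠ 0 := right_ne_zero_of_mul_eq_one hbb
  set X : hyperplane φ := ChartFamily.tangentMap sphereCharts projCharts sphereProj s Y with hX
  have hXY : b • (X : V) = (Y : V) := by
    have h := sphereProj_tangentMap hip hφ Y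
    rw [show (X : V) = _ from h, coe_toHyperplane, ip_smul_right]
    have h1 : ip (φ : V) (Y : V) = 0 := by
      rw [hsφ, ip_smul_left] at hY0
      exact (mul_eq_zero.1 hY0).resolve_left (star_ne_zero.2 hb0)
    rw [h1, mul_zero, zero_smul, sub_zero, smul_smul, mul_inv_cancel₀ hb0, one_smul]
  refine Subtype.ext ?_
  rw [coe_tautConnection hip hσ hs, Submodule.coe_smul]
  change _ = _ • (s : V)
  set d := dirDeriv ℝ (localSection (projCharts.chartIx (sphereProj s)) σ) 0
    (ChartFamily.tangentMap sphereCharts projCharts sphereProj s Y)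
  have h1 := (hasDirDeriv_ipNorm hip φ X).ofReal.complex_smul (hasDirDeriv_localSection hσ hs X)
  have h2 := (hasDirDeriv_const (𝕜 := ℝ) (0 : hyperplane φ) X (star b)).complex_smul h1
  have h3 : ∀ (y : realHyperplane s) (x : hyperplane φ), (s : V) + y = b • ((φ : V) + x) →
      star b • ((ipNorm ((φ : V) + x) : ℝ) : ℂ) • localSection φ σ x =
        f (sphereCharts.invFun s y) := by
    intro y x hyx
    rw [hf']
    exact (ip_unitVec_section σ φ x hbb (add_ne_zero_of_re s y.2) hyx).symm
  have h4 : sphereCharts.dFun f s Y = star b * d := by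
    refine (sphereCharts_dFun f s Y).trans (HasDirDeriv.dirDeriv_eq (𝕜 := ℝ) ?_)
    have h5 := h2.congr (g := fun y => f (sphereCharts.invFun s y)) (y := 0) (u := Y)
      (h3 0 0 (by rw [Submodule.coe_zero, Submodule.coe_zero, add_zero, add_zero, hsφ]))
      (Eventually.of_forall fun t => h3 _ _ ?_)
    · convert h5 using 1
      simp [ipNorm_unit]
      exact Or.inl rfl
    · change (s : V) + ((0 : V) + t • (Y : V)) = b • ((φ : V) + ((0 : V) + t • (X : V)))
      rw [zero_add, zero_add, smul_add, ← hsφ, smul_comm b t, hXY]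
  rw [h4]
  change d • (φ : V) = _
  conv_rhs => rw [hsφ, smul_smul, mul_right_comm, hbb, one_mul]

end Prequantum

end

/-- Let `V` be a complex locally convex space with a continuous Hermitian scalar product. -/
theorem mainTheorem3 {V : Type*} [AddCommGroup V] [Module ℂ V] [TopologicalSpace V]
    [IsTopologicalAddGroup V] [ContinuousSMul ℂ V] [LocallyConvexSpace ℝ V]
    [InnerProductSpace.Core ℂ V] (hip : Continuous fun x : V × V => ip x.1 x.2) :
    -- `P(V)` with the Hermitian form `H` is a locally convex Kähler manifold
    (projCharts (V := V)).IsKaehler fubiniStudyH ∧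
    -- with symplectic form `Ω`
    (projCharts (V := V)).imForm fubiniStudyH = fubiniStudyΩ ∧
    -- `H` and `Ω` are given by `2 ⟨v, w⟩` and `2 Im ⟨v, w⟩` in the chart `κ_ψ` at `[ψ]`, for every
    -- unit vector `ψ`
    (∀ (ψ : UnitSphere V) (v w : hyperplane ψ),
      projCharts.rep₂ fubiniStudyH ψ 0 v w = 2 * ip (v : V) (w : V) ∧
      projCharts.rep₂ fubiniStudyΩ ψ 0 v w = 2 * (ip (v : V) (w : V)).im) ∧
    -- `S(V) → P(V)` is a principal `U(1)`-bundle with connection `α` and curvature `Ω`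
    IsPrincipalCircleBundle sphereCharts projCharts (sphereProj (V := V)) ∧
    IsPrincipalConnection (sphereCharts (V := V)) sphereα ∧
    PrincipalCurvature (sphereCharts (V := V)) projCharts sphereProj sphereα fubiniStudyΩ ∧
    -- `L(V)` is a holomorphic line bundle over `P(V)` that is associated to `S(V)`, and `∇` is the
    -- connection inherited from `α`
    IsLineBundle ℂ (projCharts (V := V)) tautFrames ∧
    IsAssociatedBundle (sphereCharts (V := V)) projCharts tautFrames sphereProj tautVec ∧
    IsAssociatedConnection (sphereCharts (V := V)) projCharts tautFrames sphereProj tautVec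
      sphereα tautConnection ∧
    -- `L(V)` with `∇` is a prequantum line bundle for `Ω`
    IsPrequantum (projCharts (V := V)) tautFrames tautMetric tautConnection fubiniStudyΩ := by
  exact ⟨isKaehler_fubiniStudyH hip, imForm_fubiniStudyH,
    fun ψ v w => ⟨rep₂_fubiniStudyH_zero hip ψ v w, rep₂_fubiniStudyΩ_zero hip ψ v w⟩,
    isPrincipalCircleBundle_sphereProj hip, isPrincipalConnection_sphereα hip,
    principalCurvature_sphereα hip, isLineBundle_tautFrames hip, isAssociatedBundle_tautVec hip,
    isAssociatedConnection_tautConnection hip, isPrequantum_tautConnection hip⟩
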